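/- **Languages.** The *source language* is the simply typed $\lambda$-calculus with types generated by base types $\mathbb R^n$ ($n\in\mathbb N$), $\mathbf 1$, $\tau*\sigma$, $\tau\Rightarrow\sigma$, with let-bindings and with sets $\mathrm{Op}^m_{n_1,\dots,n_k}$ of primitive operations $\mathrm{op}(t_1,\dots,t_k):\mathbb R^m$ for $t_i:\mathbb R^{n_i}$. Terms are considered up to $\beta\eta$-equivalence $\equiv$. $\mathbf{Syn}$ is its syntactic category: objects are types, and morphisms $\tau\to\sigma$ are terms $x:\tau\vdash t:\sigma$ up to $\equiv$. The *target language* has Cartesian types, generated by $\mathbb R^n,\mathbf 1,*,\Rightarrow$ and types $\underline\tau\multimap\underline\sigma$ of linear functions, and linear types, generated by $\underline{\mathbb R}^n$, $\underline{\mathbf 1}$, $\underline\tau*\underline\sigma$, powers $\tau\Rightarrow\underline\sigma$ and copowers $!\tau\otimes\underline\sigma$. It has Cartesian terms $\Gamma\vdash t:\tau$ and linear terms $\Gamma;v:\underline\sigma\vdash t:\underline\tau$ with one linear variable $v$: the usual introduction and elimination terms of all these types, let-bindings, the primitive operations, arbitrary sets of linear operations, $0$ and $+$ on linear terms; $\lambda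 v.\,t$ and $t\bullet s$ are abstraction and application for $\multimap$. Its equivalence $\equiv$ ($\beta\eta+$) is generated by the $\beta\eta$-laws of all type formers, the commutative monoid laws for $(0,+)$, and $t[0/v]\equiv 0$, $t[s+r/v]\equiv t[s/v]+t[r/v]$. Its syntactic model is the category $\mathbf{CSyn}$ of Cartesian types and terms $x:\tau\vdash t:\sigma$ up to $\equiv$, with the locally indexed category $\mathbf{LSyn}:\mathbf{CSyn}^{op}\to\mathbf{Cat}$; the objects of $\mathbf{LSyn}(\tau)$ are the linear types, and its morphisms $\underline\sigma\to\underline\rho$ are the terms $x:\tau;v:\underline\sigma\vdash t:\underline\rho$ up to $\equiv$. The Grothendieck constructions $\Sigma_{\mathbf{CSyn}}\mathbf{LSyn}$ and $\Sigma_{\mathbf{CSyn}}\mathbf{LSyn}^{op}$ have pairs (Cartesian type, linear type) as objects. Their terminal object and products are componentwise. Their exponentials $(A_1,A_2)\Rightarrow(B_1,B_2)$ are $(A_1\Rightarrow(B_1*(A_2\multimap B_2)),\ A_1\Rightarrow B_2)$ and $(A_1\Rightarrow(B_1*(B_2\multimap A_2)),\ !A_1\otimes B_2)$, respectively. A *Cartesian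 closed functor* is one that preserves the chosen terminal object, binary products with their projections, and exponentials with their evaluation maps, on the nose. **Code transformations.** Fix for every $\mathrm{op}\in\mathrm{Op}^m_{n_1,\dots,n_k}$ target-language terms $$x_1:\mathbb R^{n_1},\dots,x_k:\mathbb R^{n_k};\ v:\underline{\mathbb R}^{n_1}*\cdots*\underline{\mathbb R}^{n_k}\vdash D\mathrm{op}(x_1,\dots,x_k;v):\underline{\mathbb R}^m,$$ $$x_1:\mathbb R^{n_1},\dots,x_k:\mathbb R^{n_k};\ v:\underline{\mathbb R}^m\vdash D\mathrm{op}^{t}(x_1,\dots,x_k;v):\underline{\mathbb R}^{n_1}*\cdots*\underline{\mathbb R}^{n_k}.$$ Forward mode $\mathcal D$ and reverse mode $\overline{\mathcal D}$ send $\mathbb R^n\mapsto(\mathbb R^n,\underline{\mathbb R}^n)$, $\mathbf 1\mapsto(\mathbf 1,\underline{\mathbf 1})$ and products componentwise to products, with $$\mathcal D(\tau\Rightarrow\sigma)_1=\mathcal D(\tau)_1\Rightarrow(\mathcal D(\sigma)_1*(\mathcal D(\tau)_2\multimap\mathcal D(\sigma)_2)),\quad \mathcal D(\tau\Rightarrow\sigma)_2=\mathcal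 D(\tau)_1\Rightarrow\mathcal D(\sigma)_2,$$ $$\overline{\mathcal D}(\tau\Rightarrow\sigma)_1=\overline{\mathcal D}(\tau)_1\Rightarrow(\overline{\mathcal D}(\sigma)_1*(\overline{\mathcal D}(\sigma)_2\multimap\overline{\mathcal D}(\tau)_2)),\quad \overline{\mathcal D}(\tau\Rightarrow\sigma)_2=\,!\overline{\mathcal D}(\tau)_1\otimes\overline{\mathcal D}(\sigma)_2.$$ A context $\Gamma=x_1:\tau_1,\dots,x_n:\tau_n$ is sent to the context $\mathcal D(\Gamma)_1=x_1:\mathcal D(\tau_1)_1,\dots,x_n:\mathcal D(\tau_n)_1$ and the linear type $\mathcal D(\Gamma)_2=\mathcal D(\tau_1)_2*\cdots*\mathcal D(\tau_n)_2$ (left-nested; $\underline{\mathbf 1}$ if $n=0$), and likewise for $\overline{\mathcal D}$. A term $\Gamma\vdash t:\tau$ is sent to terms $$\mathcal D(\Gamma)_1\vdash\mathcal D_\Gamma[t]:\mathcal D(\tau)_1*(\mathcal D(\Gamma)_2\multimap\mathcal D(\tau)_2),\qquad \overline{\mathcal D}(\Gamma)_1\vdash\overline{\mathcal D}_\Gamma[t]:\overline{\mathcal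 D}(\tau)_1*(\overline{\mathcal D}(\tau)_2\multimap\overline{\mathcal D}(\Gamma)_2),$$ defined by recursion on $t$. Here $\mathrm{let}\,\langle x,x'\rangle=t\,\mathrm{in}\,s$ stands for $\mathrm{let}\,z=t\,\mathrm{in}\,\mathrm{let}\,x=\mathrm{fst}\,z\,\mathrm{in}\,\mathrm{let}\,x'=\mathrm{snd}\,z\,\mathrm{in}\,s$, each subterm of a term former is transformed once, and $x,x'$ (resp. $y,y'$) are bound by such a let to the transform of the first (resp. second) subterm, unless said otherwise: * variable: $\mathcal D$: $\langle x_i,\lambda v.\,\mathrm{proj}_i v\rangle$; $\overline{\mathcal D}$: $\langle x_i,\lambda v.\,\langle 0,\dots,v,\dots,0\rangle\rangle$ (with $v$ at position $i$); * $\mathrm{let}\,x=t\,\mathrm{in}\,s$ (with $s$ transformed in $\Gamma,x$): $\mathcal D$: $\langle y,\lambda v.\,y'\bullet\langle v,x'\bullet v\rangle\rangle$; $\overline{\mathcal D}$: $\langle y,\lambda v.\,\mathrm{let}\,v=y'\bullet v\,\mathrm{in}\,\mathrm{fst}\,v+x'\bullet\mathrm{snd}\,v\rangle$; * $\mathrm{op}(t_1,\dots,t_k)$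 (with $x_i,x_i'$ bound to the transform of $t_i$): $\mathcal D$: $\langle\mathrm{op}(x_1,\dots,x_k),\lambda v.\,D\mathrm{op}(x_1,\dots,x_k;\langle x_1'\bullet v,\dots,x_k'\bullet v\rangle)\rangle$; $\overline{\mathcal D}$: $\langle\mathrm{op}(x_1,\dots,x_k),\lambda v.\,\mathrm{let}\,v=D\mathrm{op}^t(x_1,\dots,x_k;v)\,\mathrm{in}\,x_1'\bullet\mathrm{proj}_1v+\cdots+x_k'\bullet\mathrm{proj}_kv\rangle$; * $\langle\rangle$: $\mathcal D$: $\langle\langle\rangle,\lambda v.\langle\rangle\rangle$; $\overline{\mathcal D}$: $\langle\langle\rangle,\lambda v.\,0\rangle$; * $\langle t,s\rangle$: $\mathcal D$: $\langle\langle x,y\rangle,\lambda v.\langle x'\bullet v,y'\bullet v\rangle\rangle$; $\overline{\mathcal D}$: $\langle\langle x,y\rangle,\lambda v.\,x'\bullet\mathrm{fst}\,v+y'\bullet\mathrm{snd}\,v\rangle$; * $\mathrm{fst}\,t$: $\mathcal D$: $\langle\mathrm{fst}\,x,\lambda v.\,\mathrm{fst}(x'\bullet v)\rangle$; $\overline{\mathcal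 D}$: $\langle\mathrm{fst}\,x,\lambda v.\,x'\bullet\langle v,0\rangle\rangle$; and $\mathrm{snd}\,t$: $\mathcal D$: $\langle\mathrm{snd}\,x,\lambda v.\,\mathrm{snd}(x'\bullet v)\rangle$; $\overline{\mathcal D}$: $\langle\mathrm{snd}\,x,\lambda v.\,x'\bullet\langle 0,v\rangle\rangle$; * $\lambda x.t$: $\mathcal D$: $\mathrm{let}\,y=\lambda x.\mathcal D_{\Gamma,x}[t]\,\mathrm{in}\,\langle\lambda x.\,\mathrm{let}\,\langle z,z'\rangle=y\,x\,\mathrm{in}\,\langle z,\lambda v.\,z'\bullet\langle 0,v\rangle\rangle,\ \lambda v.\lambda x.\,(\mathrm{snd}(y\,x))\bullet\langle v,0\rangle\rangle$; $\overline{\mathcal D}$: $\mathrm{let}\,y=\lambda x.\overline{\mathcal D}_{\Gamma,x}[t]\,\mathrm{in}\,\langle\lambda x.\,\mathrm{let}\,\langle z,z'\rangle=y\,x\,\mathrm{in}\,\langle z,\lambda v.\,\mathrm{snd}(z'\bullet v)\rangle,\ \lambda v.\,\mathrm{case}\ v\ \mathrm{of}\ !x\otimes v\to\mathrm{fst}((\mathrm{snd}(y\,x))\bullet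 v)\rangle$; * $t\,s$ (then also $\mathrm{let}\,\langle z,z'\rangle=x\,y$): $\mathcal D$: $\langle z,\lambda v.\,(x'\bullet v)\,y+z'\bullet(y'\bullet v)\rangle$; $\overline{\mathcal D}$: $\langle z,\lambda v.\,x'\bullet(!y\otimes v)+y'\bullet(z'\bullet v)\rangle$. (In the clauses for $\mathrm{let}$ and $\lambda$, if $\Gamma$ is empty then $\langle t,s\rangle$, $\mathrm{fst}\,t$, $\mathrm{snd}\,t$ at type $\mathcal D(\Gamma,x)_2$ mean $s$, $\langle\rangle$, $t$.) **Theorem.** Let $\mathbf S$ be $\Sigma_{\mathbf{CSyn}}\mathbf{LSyn}$ (forward mode) or $\Sigma_{\mathbf{CSyn}}\mathbf{LSyn}^{op}$ (reverse mode). 1. For every choice of objects $R_n$ of $\mathbf S$ and of morphisms $d_{\mathrm{op}}:R_{n_1}\times\cdots\times R_{n_k}\to R_m$ of $\mathbf S$, one for each $\mathrm{op}\in\mathrm{Op}^m_{n_1,\dots,n_k}$, there is a unique Cartesian closed functor $F:\mathbf{Syn}\to\mathbf S$ with $F(\mathbb R^n)=R_n$ and $F(\mathrm{op})=d_{\mathrm{op}}$.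 2. In particular there is a unique Cartesian closed functor $F:\mathbf{Syn}\to\mathbf S$ with $F(\mathbb R^n)=(\mathbb R^n,\underline{\mathbb R}^n)$ and $F(\mathrm{op})=(\mathrm{op},D\mathrm{op})$ in forward mode, respectively $F(\mathrm{op})=(\mathrm{op},D\mathrm{op}^t)$ in reverse mode. 3. The code transformations represent this functor. In forward mode, $F(\tau)=(\mathcal D(\tau)_1,\mathcal D(\tau)_2)$ for every type $\tau$, and for every term $\Gamma\vdash t:\tau$ with $\Gamma=x_1:\tau_1,\dots,x_n:\tau_n$, $F$ sends the morphism $\tau_1*\cdots*\tau_n\to\tau$ represented by $t$ to the morphism $(\mathcal D(\tau_1)_1*\cdots*\mathcal D(\tau_n)_1,\ \mathcal D(\Gamma)_2)\to(\mathcal D(\tau)_1,\mathcal D(\tau)_2)$ represented by the pair of $\mathrm{fst}\,\mathcal D_\Gamma[t]$ and $(\mathrm{snd}\,\mathcal D_\Gamma[t])\bullet v$. The same holds in reverse mode with $\overline{\mathcal D}$. 4. The code transformations respect equivalence: if $\Gamma\vdash t\equiv s:\tau$ in the source language, then $\mathcal D_\Gamma[t]\equiv\mathcal D_\Gamma[s]$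 and $\overline{\mathcal D}_\Gamma[t]\equiv\overline{\mathcal D}_\Gamma[s]$ in the target language. -/

import Mathlib

open CategoryTheory

universe u v w w'

namespace CHAD

/-! ## Contexts and variables -/

/-- Finite lists `a₁, …, aₙ`, extended on the right. -/
inductive Ctx (α : Type w) : Type w
  | nil : Ctx α
  | snoc (Γ : Ctx α) (a : α) : Ctx α

/-- Positions in a list at which `a` occurs (de Bruijn variables; `zero` is the last entry). -/
inductive Var {α : Type w} : Ctx α → α → Type w
  | zero {Γ : Ctx α} {a : α} : Var (Γ.snoc a) a
  | succ {Γ : Ctx α} {a b : α} (x : Var Γ a) : Var (Γ.snoc b) a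

/-- The list `f a₁, …, f aₙ`. -/
def Ctx.map {α : Type w} {β : Type w'} (f : α → β) : Ctx α → Ctx β
  | .nil => .nil
  | .snoc Γ a => .snoc (Γ.map f) (f a)

/-- A position in `a₁, …, aₙ`, as a position in `f a₁, …, f aₙ`. -/
def Var.map {α : Type w} {β : Type w'} (f : α → β) :
    {Γ : Ctx α} → {a : α} → Var Γ a → Var (Γ.map f) (f a)
  | _, _, .zero => .zero
  | _, _, .succ x => .succ (x.map f)

/-- The `n`-ary product `((X₁ * X₂) * ⋯) * Xₙ`; it is `one` for `n = 0` and `X₁` for `n = 1`. -/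
def nprod {X : Type w} (one : X) (mul : X → X → X) : Ctx X → X
  | .nil => one
  | .snoc .nil a => a
  | .snoc (.snoc Γ b) a => mul (nprod one mul (.snoc Γ b)) a

/-- Renamings of variables. -/
def Ren {α : Type w} (Γ Δ : Ctx α) : Type w := ∀ a, Var Γ a → Var Δ a

/-- A renaming, extended under a binder. -/
def Ren.lift {α : Type w} {Γ Δ : Ctx α} (ρ : Ren Γ Δ) (b : α) : Ren (Γ.snoc b) (Δ.snoc b)
  | _, .zero => .zero
  | _, .succ x => .succ (ρ _ x)

/-- Weakening by one variable. -/
def Ren.wk {α : Type w} {Γ : Ctx α} (b : α) : Ren Γ (Γ.snoc b) := fun _ x => .succ x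

theorem Ren.lift_comp {α : Type w} {Γ Δ Θ : Ctx α} (ρ : Ren Γ Δ) (ρ' : Ren Δ Θ) (b : α) :
    (fun a x => (ρ'.lift b) a ((ρ.lift b) a x)) =
      Ren.lift (fun a x => ρ' a (ρ a x)) b := by
  funext a x; cases x <;> rfl

/-! ## The source language -/

/-- Types of the source language. -/
inductive STy : Type
  | real (n : ℕ) : STy
  | unit : STy
  | prod (A B : STy) : STy
  | fn (A B : STy) : STy

/-- Well-typed terms `Γ ⊢ t : A` of the source language, up to renaming of bound variables.
`Op ns m` is the set of primitive operations with argument types `ℝ^{n₁}, …, ℝ^{nₖ}` and result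
type `ℝ^m`. -/
inductive STm (Op : Ctx ℕ → ℕ → Type u) : Ctx STy → STy → Type u
  | var {Γ : Ctx STy} {A : STy} (x : Var Γ A) : STm Op Γ A
  | letin {Γ : Ctx STy} {A B : STy} (t : STm Op Γ A) (s : STm Op (Γ.snoc A) B) : STm Op Γ B
  | op {Γ : Ctx STy} {ns : Ctx ℕ} {m : ℕ} (o : Op ns m)
      (ts : ∀ n, Var ns n → STm Op Γ (.real n)) : STm Op Γ (.real m)
  | unit {Γ : Ctx STy} : STm Op Γ .unit
  | pair {Γ : Ctx STy} {A B : STy} (t : STm Op Γ A) (s : STm Op Γ B) : STm Op Γ (.prod A B)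
  | fst {Γ : Ctx STy} {A B : STy} (t : STm Op Γ (.prod A B)) : STm Op Γ A
  | snd {Γ : Ctx STy} {A B : STy} (t : STm Op Γ (.prod A B)) : STm Op Γ B
  | lam {Γ : Ctx STy} {A B : STy} (t : STm Op (Γ.snoc A) B) : STm Op Γ (.fn A B)
  | app {Γ : Ctx STy} {A B : STy} (t : STm Op Γ (.fn A B)) (s : STm Op Γ A) : STm Op Γ B

namespace STm

variable {Op : Ctx ℕ → ℕ → Type u}

/-- Renaming of free variables. -/
def rename : {Γ Δ : Ctx STy} → {A : STy} → Ren Γ Δ → STm Op Γ A → STm Op Δ A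
  | _, _, _, ρ, .var x => .var (ρ _ x)
  | _, _, _, ρ, .letin t s => .letin (t.rename ρ) (s.rename (ρ.lift _))
  | _, _, _, ρ, .op o ts => .op o (fun n i => (ts n i).rename ρ)
  | _, _, _, _, .unit => .unit
  | _, _, _, ρ, .pair t s => .pair (t.rename ρ) (s.rename ρ)
  | _, _, _, ρ, .fst t => .fst (t.rename ρ)
  | _, _, _, ρ, .snd t => .snd (t.rename ρ)
  | _, _, _, ρ, .lam t => .lam (t.rename (ρ.lift _))
  | _, _, _, ρ, .app t s => .app (t.rename ρ) (s.rename ρ)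

/-- Weakening by one variable. -/
def wk {Γ : Ctx STy} {A : STy} (B : STy) (t : STm Op Γ A) : STm Op (Γ.snoc B) A :=
  t.rename (Ren.wk B)

/-- Simultaneous substitutions. -/
def Sub (Op : Ctx ℕ → ℕ → Type u) (Γ Δ : Ctx STy) : Type u := ∀ A, Var Γ A → STm Op Δ A

/-- The empty substitution. -/
def Sub.nil (Δ : Ctx STy) : Sub Op .nil Δ := fun _ x => nomatch x

/-- Extension of a substitution by a term for the last variable. -/
def Sub.snoc {Γ Δ : Ctx STy} {B : STy} (σ : Sub Op Γ Δ) (t : STm Op Δ B) : Sub Op (Γ.snoc B) Δ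
  | _, .zero => t
  | _, .succ x => σ _ x

/-- A substitution, extended under a binder. -/
def Sub.lift {Γ Δ : Ctx STy} (σ : Sub Op Γ Δ) (B : STy) : Sub Op (Γ.snoc B) (Δ.snoc B) :=
  Sub.snoc (fun _ x => (σ _ x).wk B) (.var .zero)

/-- Capture-avoiding simultaneous substitution. -/
def subst : {Γ Δ : Ctx STy} → {A : STy} → Sub Op Γ Δ → STm Op Γ A → STm Op Δ A
  | _, _, _, σ, .var x => σ _ x
  | _, _, _, σ, .letin t s => .letin (t.subst σ) (s.subst (σ.lift _))
  | _, _, _, σ, .op o ts => .op o (fun n i => (ts n i).subst σ)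
  | _, _, _, _, .unit => .unit
  | _, _, _, σ, .pair t s => .pair (t.subst σ) (s.subst σ)
  | _, _, _, σ, .fst t => .fst (t.subst σ)
  | _, _, _, σ, .snd t => .snd (t.subst σ)
  | _, _, _, σ, .lam t => .lam (t.subst (σ.lift _))
  | _, _, _, σ, .app t s => .app (t.subst σ) (s.subst σ)

/-- `s[t/x]` for the last variable `x` of the context. -/
def inst {Γ : Ctx STy} {A B : STy} (s : STm Op (Γ.snoc A) B) (t : STm Op Γ A) : STm Op Γ B :=
  s.subst (Sub.snoc (fun _ x => .var x) t)

theorem rename_rename {Γ Δ Θ : Ctx STy} {A : STy} (t : STm Op Γ A) (ρ : Ren Γ Δ) (ρ' : Ren Δ Θ) :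
    (t.rename ρ).rename ρ' = t.rename (fun a x => ρ' a (ρ a x)) := by
  induction t generalizing Δ Θ <;> simp_all [rename, Ren.lift_comp]

theorem subst_rename {Γ Δ Θ : Ctx STy} {A : STy} (t : STm Op Γ A) (ρ : Ren Γ Δ) (σ : Sub Op Δ Θ) :
    (t.rename ρ).subst σ = t.subst (fun a x => σ a (ρ a x)) := by
  have key : ∀ {Γ Δ Θ : Ctx STy} (ρ : Ren Γ Δ) (σ : Sub Op Δ Θ) (B : STy),
      (fun a x => (σ.lift B) a ((ρ.lift B) a x)) = Sub.lift (fun a x => σ a (ρ a x)) B := by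
    intros; funext a x; cases x <;> rfl
  induction t generalizing Δ Θ <;> simp_all [rename, subst]

theorem rename_subst {Γ Δ Θ : Ctx STy} {A : STy} (t : STm Op Γ A) (σ : Sub Op Γ Δ) (ρ : Ren Δ Θ) :
    (t.subst σ).rename ρ = t.subst (fun a x => (σ a x).rename ρ) := by
  have key : ∀ {Γ Δ Θ : Ctx STy} (σ : Sub Op Γ Δ) (ρ : Ren Δ Θ) (B : STy),
      (fun a x => ((σ.lift B) a x).rename (ρ.lift B)) =
        Sub.lift (fun a x => (σ a x).rename ρ) B := by
    intros
    funext a x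
    cases x
    · rfl
    · simp only [Sub.lift, Sub.snoc, wk, rename_rename]; rfl
  induction t generalizing Δ Θ <;> simp_all [rename, subst]

theorem subst_subst {Γ Δ Θ : Ctx STy} {A : STy} (t : STm Op Γ A) (σ : Sub Op Γ Δ)
    (τ : Sub Op Δ Θ) : (t.subst σ).subst τ = t.subst (fun a x => (σ a x).subst τ) := by
  have key : ∀ {Γ Δ Θ : Ctx STy} (σ : Sub Op Γ Δ) (τ : Sub Op Δ Θ) (B : STy),
      (fun a x => ((σ.lift B) a x).subst (τ.lift B)) =
        Sub.lift (fun a x => (σ a x).subst τ) B := by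
    intros
    funext a x
    cases x
    · rfl
    · simp only [Sub.lift, Sub.snoc, wk, rename_subst, subst_rename]; rfl
  induction t generalizing Δ Θ <;> simp_all [subst]

theorem subst_var {Γ : Ctx STy} {A : STy} (t : STm Op Γ A) : t.subst (fun _ x => .var x) = t := by
  have key : ∀ (Γ : Ctx STy) (B : STy),
      Sub.lift (fun _ x => .var x : Sub Op Γ Γ) B = fun _ x => .var x := by
    intros; funext a x; cases x <;> rfl
  induction t <;> simp_all [subst]

/-- The `βη`-equational theory of the source language. -/
inductive Eqv : {Γ : Ctx STy} → {A : STy} → STm Op Γ A → STm Op Γ A → Prop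
  | refl {Γ : Ctx STy} {A : STy} (t : STm Op Γ A) : Eqv t t
  | symm {Γ : Ctx STy} {A : STy} {t s : STm Op Γ A} : Eqv t s → Eqv s t
  | trans {Γ : Ctx STy} {A : STy} {t s r : STm Op Γ A} : Eqv t s → Eqv s r → Eqv t r
  | letin_congr {Γ : Ctx STy} {A B : STy} {t t' : STm Op Γ A} {s s' : STm Op (Γ.snoc A) B} :
      Eqv t t' → Eqv s s' → Eqv (.letin t s) (.letin t' s')
  | op_congr {Γ : Ctx STy} {ns : Ctx ℕ} {m : ℕ} (o : Op ns m)
      {ts ts' : ∀ n, Var ns n → STm Op Γ (.real n)} :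
      (∀ n i, Eqv (ts n i) (ts' n i)) → Eqv (.op o ts) (.op o ts')
  | pair_congr {Γ : Ctx STy} {A B : STy} {t t' : STm Op Γ A} {s s' : STm Op Γ B} :
      Eqv t t' → Eqv s s' → Eqv (.pair t s) (.pair t' s')
  | fst_congr {Γ : Ctx STy} {A B : STy} {t t' : STm Op Γ (.prod A B)} :
      Eqv t t' → Eqv (.fst t) (.fst t')
  | snd_congr {Γ : Ctx STy} {A B : STy} {t t' : STm Op Γ (.prod A B)} :
      Eqv t t' → Eqv (.snd t) (.snd t')
  | lam_congr {Γ : Ctx STy} {A B : STy} {t t' : STm Op (Γ.snoc A) B} :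
      Eqv t t' → Eqv (.lam t) (.lam t')
  | app_congr {Γ : Ctx STy} {A B : STy} {t t' : STm Op Γ (.fn A B)} {s s' : STm Op Γ A} :
      Eqv t t' → Eqv s s' → Eqv (.app t s) (.app t' s')
  | let_beta {Γ : Ctx STy} {A B : STy} (t : STm Op Γ A) (s : STm Op (Γ.snoc A) B) :
      Eqv (.letin t s) (s.inst t)
  | unit_eta {Γ : Ctx STy} (t : STm Op Γ .unit) : Eqv t .unit
  | fst_beta {Γ : Ctx STy} {A B : STy} (t : STm Op Γ A) (s : STm Op Γ B) :
      Eqv (.fst (.pair t s)) t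
  | snd_beta {Γ : Ctx STy} {A B : STy} (t : STm Op Γ A) (s : STm Op Γ B) :
      Eqv (.snd (.pair t s)) s
  | pair_eta {Γ : Ctx STy} {A B : STy} (t : STm Op Γ (.prod A B)) :
      Eqv t (.pair (.fst t) (.snd t))
  | fn_beta {Γ : Ctx STy} {A B : STy} (t : STm Op (Γ.snoc A) B) (s : STm Op Γ A) :
      Eqv (.app (.lam t) s) (t.inst s)
  | fn_eta {Γ : Ctx STy} {A B : STy} (t : STm Op Γ (.fn A B)) :
      Eqv t (.lam (.app (t.wk A) (.var .zero)))

theorem inst_subst {Γ Δ : Ctx STy} {A B : STy} (s : STm Op (Γ.snoc A) B) (t : STm Op Γ A)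
    (σ : Sub Op Γ Δ) : (s.inst t).subst σ = (s.subst (σ.lift A)).inst (t.subst σ) := by
  simp only [inst, subst_subst]
  congr 1
  funext a x
  cases x
  · rfl
  · simp only [Sub.lift, Sub.snoc, wk, subst_rename, subst]
    exact (subst_var _).symm

theorem wk_subst {Γ Δ : Ctx STy} {A : STy} (t : STm Op Γ A) (σ : Sub Op Γ Δ) (B : STy) :
    (t.wk B).subst (σ.lift B) = (t.subst σ).wk B := by
  simp only [wk, subst_rename, rename_subst]; rfl

theorem wk_inst {Γ : Ctx STy} {A B : STy} (t : STm Op Γ A) (s : STm Op Γ B) :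
    (t.wk B).inst s = t := by
  simp only [wk, inst, subst_rename]; exact subst_var t

theorem Eqv.subst {Γ Δ : Ctx STy} {A : STy} {t s : STm Op Γ A} (h : Eqv t s) (σ : Sub Op Γ Δ) :
    Eqv (t.subst σ) (s.subst σ) := by
  induction h generalizing Δ with
  | refl t => exact .refl _
  | symm _ ih => exact .symm (ih σ)
  | trans _ _ ih₁ ih₂ => exact .trans (ih₁ σ) (ih₂ σ)
  | letin_congr _ _ ih₁ ih₂ => exact .letin_congr (ih₁ σ) (ih₂ _)
  | op_congr o _ ih => exact .op_congr o fun n i => ih n i σ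
  | pair_congr _ _ ih₁ ih₂ => exact .pair_congr (ih₁ σ) (ih₂ σ)
  | fst_congr _ ih => exact .fst_congr (ih σ)
  | snd_congr _ ih => exact .snd_congr (ih σ)
  | lam_congr _ ih => exact .lam_congr (ih _)
  | app_congr _ _ ih₁ ih₂ => exact .app_congr (ih₁ σ) (ih₂ σ)
  | let_beta t s => rw [inst_subst]; exact .let_beta _ _
  | unit_eta t => exact .unit_eta _
  | fst_beta t s => exact .fst_beta _ _
  | snd_beta t s => exact .snd_beta _ _
  | pair_eta t => exact .pair_eta _
  | fn_beta t s => rw [inst_subst]; exact .fn_beta _ _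
  | fn_eta t =>
    have := Eqv.fn_eta (t.subst σ)
    rw [← wk_subst] at this
    exact this

theorem Eqv.wk {Γ : Ctx STy} {A : STy} {t s : STm Op Γ A} (h : Eqv t s) (B : STy) :
    Eqv (t.wk B) (s.wk B) := by
  have := h.subst (fun _ x => .var (.succ x) : Sub Op Γ (Γ.snoc B))
  have key : ∀ t : STm Op Γ A, t.subst (fun _ x => .var (.succ x)) = t.wk B := fun t => by
    exact (subst_rename t (Ren.wk B) (fun _ x => .var x)).symm.trans (subst_var _)
  simpa only [key] using this

theorem Eqv.subst_right {Γ Δ : Ctx STy} {A : STy} (t : STm Op Γ A) {σ τ : Sub Op Γ Δ}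
    (h : ∀ a x, Eqv (σ a x) (τ a x)) : Eqv (t.subst σ) (t.subst τ) := by
  have key : ∀ {Γ Δ : Ctx STy} {σ τ : Sub Op Γ Δ} (B : STy), (∀ a x, Eqv (σ a x) (τ a x)) →
      ∀ a x, Eqv (σ.lift B a x) (τ.lift B a x) := by
    intro Γ Δ σ τ B h a x
    cases x
    · exact .refl _
    · exact (h _ _).wk B
  induction t generalizing Δ with
  | var x => exact h _ x
  | letin _ _ ih₁ ih₂ => exact .letin_congr (ih₁ h) (ih₂ (key _ h))
  | op o _ ih => exact .op_congr o fun n i => ih n i h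
  | unit => exact .refl _
  | pair _ _ ih₁ ih₂ => exact .pair_congr (ih₁ h) (ih₂ h)
  | fst _ ih => exact .fst_congr (ih h)
  | snd _ ih => exact .snd_congr (ih h)
  | lam _ ih => exact .lam_congr (ih (key _ h))
  | app _ _ ih₁ ih₂ => exact .app_congr (ih₁ h) (ih₂ h)

/-- Terms up to `βη`-equivalence. -/
def setoid (Op : Ctx ℕ → ℕ → Type u) (Γ : Ctx STy) (A : STy) : Setoid (STm Op Γ A) :=
  ⟨Eqv, Eqv.refl, Eqv.symm, Eqv.trans⟩

end STm

/-! ## Cartesian closed categories and their strict functors -/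

section CCC

open MonoidalCategory CartesianMonoidalCategory Limits

/-- Chosen finite products and exponentials, given by operations and equations. -/
structure CCStr (C : Type u) [Category.{v} C] where
  one : C
  bang (X : C) : X ⟶ one
  bang_uniq {X : C} (f g : X ⟶ one) : f = g
  prod : C → C → C
  fst (X Y : C) : prod X Y ⟶ X
  snd (X Y : C) : prod X Y ⟶ Y
  pair {X Y Z : C} (f : X ⟶ Y) (g : X ⟶ Z) : X ⟶ prod Y Z
  pair_fst {X Y Z : C} (f : X ⟶ Y) (g : X ⟶ Z) : pair f g ≫ fst Y Z = f
  pair_snd {X Y Z : C} (f : X ⟶ Y) (g : X ⟶ Z) : pair f g ≫ snd Y Z = g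
  pair_eta {X Y Z : C} (h : X ⟶ prod Y Z) : pair (h ≫ fst Y Z) (h ≫ snd Y Z) = h
  exp : C → C → C
  ev (A B : C) : prod A (exp A B) ⟶ B
  curry {A X B : C} (f : prod A X ⟶ B) : X ⟶ exp A B
  curry_beta {A X B : C} (f : prod A X ⟶ B) :
    pair (fst A X) (snd A X ≫ curry f) ≫ ev A B = f
  curry_eta {A X B : C} (g : X ⟶ exp A B) :
    curry (pair (fst A X) (snd A X ≫ g) ≫ ev A B) = g

namespace CCStr

variable {C : Type u} [Category.{v} C] (S : CCStr C)

theorem hom_ext {X Y Z : C} {h k : X ⟶ S.prod Y Z} (h₁ : h ≫ S.fst Y Z = k ≫ S.fst Y Z)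
    (h₂ : h ≫ S.snd Y Z = k ≫ S.snd Y Z) : h = k := by
  rw [← S.pair_eta h, ← S.pair_eta k, h₁, h₂]

theorem comp_pair {W X Y Z : C} (e : W ⟶ X) (f : X ⟶ Y) (g : X ⟶ Z) :
    e ≫ S.pair f g = S.pair (e ≫ f) (e ≫ g) :=
  S.hom_ext (by simp [S.pair_fst]) (by simp [S.pair_snd])

/-- The chosen finite products, as a Mathlib structure. -/
abbrev cartesian : CartesianMonoidalCategory C :=
  .ofChosenFiniteProducts
    ⟨asEmptyCone S.one, IsTerminal.ofUniqueHom S.bang fun _ _ => S.bang_uniq _ _⟩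
    fun X Y => ⟨BinaryFan.mk (S.fst X Y) (S.snd X Y),
      BinaryFan.IsLimit.mk _ (fun f g => S.pair f g) (fun f g => S.pair_fst f g)
        (fun f g => S.pair_snd f g)
        (fun f g _ h₁ h₂ => S.hom_ext (h₁.trans (S.pair_fst f g).symm)
          (h₂.trans (S.pair_snd f g).symm))⟩

/-- The chosen exponentials, as a Mathlib structure. -/
abbrev closed : letI := S.cartesian; MonoidalClosed C :=
  letI := S.cartesian
  have hw : ∀ {A X Y : C} (f : X ⟶ Y), A ◁ f = S.pair (S.fst A X) (S.snd A X ≫ f) := by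
    intro A X Y f
    refine S.hom_ext ?_ ?_
    · rw [S.pair_fst]; exact whiskerLeft_fst A f
    · rw [S.pair_snd]; exact whiskerLeft_snd A f
  have hc : ∀ {A X B : C} (f : S.prod A X ⟶ B) (g : X ⟶ S.exp A B),
      S.pair (S.fst A X) (S.snd A X ≫ g) ≫ S.ev A B = f → S.curry f = g := by
    intro A X B f g h
    rw [← h, S.curry_eta]
  { closed := fun A =>
      { rightAdj := Adjunction.rightAdjointOfEquiv (F := tensorLeft A) (G_obj := S.exp A)
          (fun X B => ⟨S.curry, fun g => S.pair (S.fst A X) (S.snd A X ≫ g) ≫ S.ev A B,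
            S.curry_beta, S.curry_eta⟩) (by
            intro X' X Y f g
            refine hc _ _ ?_
            change _ = (A ◁ f) ≫ g
            rw [hw]
            conv_rhs => rw [← S.curry_beta g]
            rw [← Category.assoc _ _ (S.ev A Y), S.comp_pair, S.pair_fst,
              ← Category.assoc _ _ (S.curry g), S.pair_snd, Category.assoc]
            rfl)
        adj := Adjunction.adjunctionOfEquivRight _ _ } }

end CCStr

/-- `F` sends `f : X ⟶ Y` to `g : X' ⟶ Y'`. -/
def SendsTo {C : Type u} [Category.{v} C] {D : Type w} [Category.{w'} D] (F : C ⥤ D) {X Y : C}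
    (f : X ⟶ Y) {X' Y' : D} (g : X' ⟶ Y') : Prop :=
  ∃ (hX : F.obj X = X') (hY : F.obj Y = Y'), F.map f = eqToHom hX ≫ g ≫ eqToHom hY.symm

open scoped CartesianClosed in
/-- `F` is a Cartesian closed functor: it preserves the chosen terminal object, binary products and
exponentials, with the projections and the evaluations. -/
structure IsCartesianClosed {C : Type u} [Category.{v} C] [CartesianMonoidalCategory C]
    [MonoidalClosed C] {D : Type w} [Category.{w'} D] [CartesianMonoidalCategory D]
    [MonoidalClosed D] (F : C ⥤ D) : Prop where
  one : F.obj (𝟙_ C) = 𝟙_ D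
  prod (X Y : C) : F.obj (X ⊗ Y) = F.obj X ⊗ F.obj Y
  fst (X Y : C) : SendsTo F (fst X Y) (fst (F.obj X) (F.obj Y))
  snd (X Y : C) : SendsTo F (snd X Y) (snd (F.obj X) (F.obj Y))
  exp (X Y : C) : F.obj (X ⟹ Y) = (F.obj X ⟹ F.obj Y)
  ev (X Y : C) : SendsTo F ((ihom.ev X).app Y) ((ihom.ev (F.obj X)).app (F.obj Y))

end CCC

/-! ## Locally indexed categories and their Grothendieck constructions -/

/-- A locally indexed category over `C`: a strict functor `𝓛 : Cᵒᵖ ⥤ Cat` such that all categories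
`𝓛 A` have the same objects and all reindexing functors `𝓛 f` are the identity on objects.
The composition of `𝓛 A` is `comp`, in diagrammatic order; `re f` is the action of `𝓛 f`. -/
structure LocIdx (C : Type u) [Category.{v} C] where
  Obj : Type w
  Hom : C → Obj → Obj → Type w'
  id (A : C) (X : Obj) : Hom A X X
  comp {A : C} {X Y Z : Obj} (f : Hom A X Y) (g : Hom A Y Z) : Hom A X Z
  id_comp {A : C} {X Y : Obj} (f : Hom A X Y) : comp (id A X) f = f
  comp_id {A : C} {X Y : Obj} (f : Hom A X Y) : comp f (id A Y) = f
  assoc {A : C} {X Y Z W : Obj} (f : Hom A X Y) (g : Hom A Y Z) (h : Hom A Z W) :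
    comp (comp f g) h = comp f (comp g h)
  re {A B : C} (a : A ⟶ B) {X Y : Obj} (f : Hom B X Y) : Hom A X Y
  re_idm {A B : C} (a : A ⟶ B) (X : Obj) : re a (id B X) = id A X
  re_compm {A B : C} (a : A ⟶ B) {X Y Z : Obj} (f : Hom B X Y) (g : Hom B Y Z) :
    re a (comp f g) = comp (re a f) (re a g)
  re_id {A : C} {X Y : Obj} (f : Hom A X Y) : re (𝟙 A) f = f
  re_comp {A B D : C} (a : A ⟶ B) (b : B ⟶ D) {X Y : Obj} (f : Hom D X Y) :
    re (a ≫ b) f = re a (re b f)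

/-- Objects of the Grothendieck construction `Σ_C 𝓛`. -/
@[ext]
structure Sig {C : Type u} [Category.{v} C] (L : LocIdx.{u, v, w, w'} C) where
  fst : C
  snd : L.Obj

/-- Objects of the Grothendieck construction `Σ_C 𝓛ᵒᵖ` of the fibrewise dual. -/
@[ext]
structure SigOp {C : Type u} [Category.{v} C] (L : LocIdx.{u, v, w, w'} C) where
  fst : C
  snd : L.Obj

section Sig

variable {C : Type u} [Category.{v} C] {L : LocIdx.{u, v, w, w'} C}

/-- Morphisms of `Σ_C 𝓛`: a morphism `f₁ : A₁ ⟶ B₁` of `C` and a morphism `f₂ : A₂ ⟶ B₂` of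
`𝓛 A₁`. -/
@[ext]
structure Sig.Hom (A B : Sig L) where
  fst : A.fst ⟶ B.fst
  snd : L.Hom A.fst A.snd B.snd

/-- Morphisms of `Σ_C 𝓛ᵒᵖ`: a morphism `f₁ : A₁ ⟶ B₁` of `C` and a morphism `f₂ : B₂ ⟶ A₂` of
`𝓛 A₁`. -/
@[ext]
structure SigOp.Hom (A B : SigOp L) where
  fst : A.fst ⟶ B.fst
  snd : L.Hom A.fst B.snd A.snd

instance : Category (Sig L) where
  Hom := Sig.Hom
  id A := ⟨𝟙 A.fst, L.id _ _⟩
  comp f g := ⟨f.fst ≫ g.fst, L.comp f.snd (L.re f.fst g.snd)⟩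
  id_comp f := Sig.Hom.ext (Category.id_comp _) (by simp [L.re_id, L.id_comp])
  comp_id f := Sig.Hom.ext (Category.comp_id _) (by simp [L.re_idm, L.comp_id])
  assoc f g h := Sig.Hom.ext (Category.assoc _ _ _) (by simp [L.re_compm, L.re_comp, L.assoc])

instance : Category (SigOp L) where
  Hom := SigOp.Hom
  id A := ⟨𝟙 A.fst, L.id _ _⟩
  comp f g := ⟨f.fst ≫ g.fst, L.comp (L.re f.fst g.snd) f.snd⟩
  id_comp f := SigOp.Hom.ext (Category.id_comp _) (by simp [L.re_id, L.comp_id])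
  comp_id f := SigOp.Hom.ext (Category.comp_id _) (by simp [L.re_idm, L.id_comp])
  assoc f g h := SigOp.Hom.ext (Category.assoc _ _ _) (by simp [L.re_compm, L.re_comp, L.assoc])

@[simp] theorem Sig.comp_fst {A B D : Sig L} (f : A ⟶ B) (g : B ⟶ D) :
    Sig.Hom.fst (f ≫ g) = Sig.Hom.fst f ≫ Sig.Hom.fst g := rfl
@[simp] theorem Sig.comp_snd {A B D : Sig L} (f : A ⟶ B) (g : B ⟶ D) :
    Sig.Hom.snd (f ≫ g) = L.comp (Sig.Hom.snd f) (L.re (Sig.Hom.fst f) (Sig.Hom.snd g)) := rfl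
@[simp] theorem SigOp.comp_fst {A B D : SigOp L} (f : A ⟶ B) (g : B ⟶ D) :
    SigOp.Hom.fst (f ≫ g) = SigOp.Hom.fst f ≫ SigOp.Hom.fst g := rfl
@[simp] theorem SigOp.comp_snd {A B D : SigOp L} (f : A ⟶ B) (g : B ⟶ D) :
    SigOp.Hom.snd (f ≫ g) = L.comp (L.re (SigOp.Hom.fst f) (SigOp.Hom.snd g)) (SigOp.Hom.snd f) :=
  rfl

/-- Categorical models of the target language over a Cartesian closed category: locally indexed
categories that are enriched in commutative monoids and have finite (bi)products `one`, `prod`,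
powers `pow`, copowers `copow` and types of linear functions `lolli`. -/
structure Model (S : CCStr C) (L : LocIdx.{u, v, w, w'} C) where
  zero (A : C) (X Y : L.Obj) : L.Hom A X Y
  add {A : C} {X Y : L.Obj} (f g : L.Hom A X Y) : L.Hom A X Y
  add_zero {A : C} {X Y : L.Obj} (f : L.Hom A X Y) : add f (zero A X Y) = f
  add_assoc {A : C} {X Y : L.Obj} (f g h : L.Hom A X Y) : add (add f g) h = add f (add g h)
  add_comm {A : C} {X Y : L.Obj} (f g : L.Hom A X Y) : add f g = add g f
  comp_zero {A : C} {X Y Z : L.Obj} (f : L.Hom A X Y) : L.comp f (zero A Y Z) = zero A X Z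
  zero_comp {A : C} {X Y Z : L.Obj} (f : L.Hom A Y Z) : L.comp (zero A X Y) f = zero A X Z
  comp_add {A : C} {X Y Z : L.Obj} (f : L.Hom A X Y) (g h : L.Hom A Y Z) :
    L.comp f (add g h) = add (L.comp f g) (L.comp f h)
  add_comp {A : C} {X Y Z : L.Obj} (f g : L.Hom A X Y) (h : L.Hom A Y Z) :
    L.comp (add f g) h = add (L.comp f h) (L.comp g h)
  re_zero {A B : C} (a : A ⟶ B) (X Y : L.Obj) : L.re a (zero B X Y) = zero A X Y
  re_add {A B : C} (a : A ⟶ B) {X Y : L.Obj} (f g : L.Hom B X Y) :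
    L.re a (add f g) = add (L.re a f) (L.re a g)
  one : L.Obj
  one_uniq {A : C} {X : L.Obj} (f g : L.Hom A X one) : f = g
  prod : L.Obj → L.Obj → L.Obj
  fst (A : C) (X Y : L.Obj) : L.Hom A (prod X Y) X
  snd (A : C) (X Y : L.Obj) : L.Hom A (prod X Y) Y
  pair {A : C} {X Y Z : L.Obj} (f : L.Hom A X Y) (g : L.Hom A X Z) : L.Hom A X (prod Y Z)
  pair_fst {A : C} {X Y Z : L.Obj} (f : L.Hom A X Y) (g : L.Hom A X Z) :
    L.comp (pair f g) (fst A Y Z) = f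
  pair_snd {A : C} {X Y Z : L.Obj} (f : L.Hom A X Y) (g : L.Hom A X Z) :
    L.comp (pair f g) (snd A Y Z) = g
  pair_eta {A : C} {X Y Z : L.Obj} (h : L.Hom A X (prod Y Z)) :
    pair (L.comp h (fst A Y Z)) (L.comp h (snd A Y Z)) = h
  re_fst {A B : C} (a : A ⟶ B) (X Y : L.Obj) : L.re a (fst B X Y) = fst A X Y
  re_snd {A B : C} (a : A ⟶ B) (X Y : L.Obj) : L.re a (snd B X Y) = snd A X Y
  pow : C → L.Obj → L.Obj
  pev (B : C) (Y : L.Obj) : L.Hom B (pow B Y) Y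
  pcurry {B A : C} {X Y : L.Obj} (f : L.Hom (S.prod B A) X Y) : L.Hom A X (pow B Y)
  pow_beta {B A : C} {X Y : L.Obj} (f : L.Hom (S.prod B A) X Y) :
    L.comp (L.re (S.snd B A) (pcurry f)) (L.re (S.fst B A) (pev B Y)) = f
  pow_eta {B A : C} {X Y : L.Obj} (g : L.Hom A X (pow B Y)) :
    pcurry (L.comp (L.re (S.snd B A) g) (L.re (S.fst B A) (pev B Y))) = g
  copow : C → L.Obj → L.Obj
  cin (B : C) (X : L.Obj) : L.Hom B X (copow B X)
  cmatch {B A : C} {X Y : L.Obj} (f : L.Hom (S.prod B A) X Y) : L.Hom A (copow B X) Y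
  copow_beta {B A : C} {X Y : L.Obj} (f : L.Hom (S.prod B A) X Y) :
    L.comp (L.re (S.fst B A) (cin B X)) (L.re (S.snd B A) (cmatch f)) = f
  copow_eta {B A : C} {X Y : L.Obj} (g : L.Hom A (copow B X) Y) :
    cmatch (L.comp (L.re (S.fst B A) (cin B X)) (L.re (S.snd B A) g)) = g
  lolli : L.Obj → L.Obj → C
  lev (X Y : L.Obj) : L.Hom (lolli X Y) X Y
  lcurry {A : C} {X Y : L.Obj} (f : L.Hom A X Y) : A ⟶ lolli X Y
  lolli_beta {A : C} {X Y : L.Obj} (f : L.Hom A X Y) : L.re (lcurry f) (lev X Y) = f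
  lolli_eta {A : C} {X Y : L.Obj} (g : A ⟶ lolli X Y) : lcurry (L.re g (lev X Y)) = g

namespace Model

variable {S : CCStr C} (M : Model S L)

theorem zero_add {A : C} {X Y : L.Obj} (f : L.Hom A X Y) : M.add (M.zero A X Y) f = f := by
  rw [M.add_comm, M.add_zero]

theorem hom_ext {A : C} {X Y Z : L.Obj} {h k : L.Hom A X (M.prod Y Z)}
    (h₁ : L.comp h (M.fst A Y Z) = L.comp k (M.fst A Y Z))
    (h₂ : L.comp h (M.snd A Y Z) = L.comp k (M.snd A Y Z)) : h = k := by
  rw [← M.pair_eta h, ← M.pair_eta k, h₁, h₂]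

theorem re_pair {A B : C} (a : A ⟶ B) {X Y Z : L.Obj} (f : L.Hom B X Y) (g : L.Hom B X Z) :
    L.re a (M.pair f g) = M.pair (L.re a f) (L.re a g) := by
  refine M.hom_ext ?_ ?_
  · rw [M.pair_fst, ← M.re_fst a, ← L.re_compm, M.pair_fst]
  · rw [M.pair_snd, ← M.re_snd a, ← L.re_compm, M.pair_snd]

theorem comp_pair {A : C} {W X Y Z : L.Obj} (e : L.Hom A W X) (f : L.Hom A X Y)
    (g : L.Hom A X Z) : L.comp e (M.pair f g) = M.pair (L.comp e f) (L.comp e g) :=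
  M.hom_ext (by simp [L.assoc, M.pair_fst]) (by simp [L.assoc, M.pair_snd])

/-- The coprojections. -/
def inl (A : C) (X Y : L.Obj) : L.Hom A X (M.prod X Y) := M.pair (L.id A X) (M.zero A X Y)
def inr (A : C) (X Y : L.Obj) : L.Hom A Y (M.prod X Y) := M.pair (M.zero A Y X) (L.id A Y)

theorem re_inl {A B : C} (a : A ⟶ B) (X Y : L.Obj) : L.re a (M.inl B X Y) = M.inl A X Y := by
  simp [inl, M.re_pair, L.re_idm, M.re_zero]

theorem re_inr {A B : C} (a : A ⟶ B) (X Y : L.Obj) : L.re a (M.inr B X Y) = M.inr A X Y := by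
  simp [inr, M.re_pair, L.re_idm, M.re_zero]

theorem inl_fst (A : C) (X Y : L.Obj) : L.comp (M.inl A X Y) (M.fst A X Y) = L.id A X :=
  M.pair_fst _ _
theorem inl_snd (A : C) (X Y : L.Obj) : L.comp (M.inl A X Y) (M.snd A X Y) = M.zero A X Y :=
  M.pair_snd _ _
theorem inr_fst (A : C) (X Y : L.Obj) : L.comp (M.inr A X Y) (M.fst A X Y) = M.zero A Y X :=
  M.pair_fst _ _
theorem inr_snd (A : C) (X Y : L.Obj) : L.comp (M.inr A X Y) (M.snd A X Y) = L.id A Y :=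
  M.pair_snd _ _

theorem biprod (A : C) (X Y : L.Obj) :
    M.add (L.comp (M.fst A X Y) (M.inl A X Y)) (L.comp (M.snd A X Y) (M.inr A X Y)) =
      L.id A (M.prod X Y) := by
  refine M.hom_ext ?_ ?_ <;>
    simp [M.add_comp, L.assoc, inl_fst, inl_snd, inr_fst, inr_snd, L.comp_id, L.id_comp,
      M.comp_zero, M.add_zero, M.zero_add]

theorem copair_eq {A : C} {X Y Z : L.Obj} (f : L.Hom A (M.prod X Y) Z) :
    M.add (L.comp (M.fst A X Y) (L.comp (M.inl A X Y) f))
      (L.comp (M.snd A X Y) (L.comp (M.inr A X Y) f)) = f := by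
  rw [← L.assoc, ← L.assoc, ← M.add_comp, biprod, L.id_comp]

/-- The Cartesian closed structure of `Σ_C 𝓛`:
`(A₁, A₂) ⇒ (B₁, B₂) = (A₁ ⇒ B₁ × (A₂ ⊸ B₂), A₁ ⇒ B₂)`. -/
def sig : CCStr (Sig L) where
  one := ⟨S.one, M.one⟩
  bang X := ⟨S.bang X.fst, M.zero _ _ _⟩
  bang_uniq f g := Sig.Hom.ext (S.bang_uniq _ _) (M.one_uniq _ _)
  prod X Y := ⟨S.prod X.fst Y.fst, M.prod X.snd Y.snd⟩
  fst X Y := ⟨S.fst _ _, M.fst _ _ _⟩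
  snd X Y := ⟨S.snd _ _, M.snd _ _ _⟩
  pair f g := ⟨S.pair f.fst g.fst, M.pair f.snd g.snd⟩
  pair_fst f g := Sig.Hom.ext (S.pair_fst _ _) (by simp [M.re_fst, M.pair_fst])
  pair_snd f g := Sig.Hom.ext (S.pair_snd _ _) (by simp [M.re_snd, M.pair_snd])
  pair_eta h := Sig.Hom.ext (S.pair_eta _) (by simp [M.re_fst, M.re_snd, M.pair_eta])
  exp A B := ⟨S.exp A.fst (S.prod B.fst (M.lolli A.snd B.snd)), M.pow A.fst B.snd⟩
  ev A B := ⟨S.ev _ _ ≫ S.fst _ _,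
    M.add (L.comp (M.fst _ _ _) (L.re (S.ev _ _ ≫ S.snd _ _) (M.lev A.snd B.snd)))
      (L.comp (M.snd _ _ _) (L.re (S.fst _ _) (M.pev A.fst B.snd)))⟩
  curry {A X B} f := ⟨S.curry (S.pair f.fst (M.lcurry (L.comp (M.inl _ _ _) f.snd))),
    M.pcurry (L.comp (M.inr _ _ _) f.snd)⟩
  curry_beta {A X B} f := by
    refine Sig.Hom.ext ?_ ?_
    · simp only [Sig.comp_fst]
      rw [← Category.assoc, S.curry_beta, S.pair_fst]
    · simp only [Sig.comp_snd, Sig.comp_fst, M.re_add, M.comp_add, L.re_compm, M.re_fst, M.re_snd]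
      rw [← L.assoc, M.pair_fst, ← L.assoc, M.pair_snd, ← L.re_comp, ← L.re_comp,
        ← Category.assoc, S.curry_beta, S.pair_snd, M.lolli_beta, S.pair_fst, L.assoc,
        M.pow_beta, copair_eq]
  curry_eta {A X B} g := by
    refine Sig.Hom.ext ?_ ?_
    · simp only [Sig.comp_snd, Sig.comp_fst, M.re_add, M.comp_add, L.re_compm, M.re_fst, M.re_snd]
      have h : ∀ {P} (k : P ⟶ S.prod B.fst (M.lolli A.snd B.snd)),
          S.pair (k ≫ S.fst _ _) (M.lcurry (L.re (k ≫ S.snd _ _) (M.lev A.snd B.snd))) = k := by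
        intro P k; rw [M.lolli_eta, S.pair_eta]
      conv_rhs => rw [← S.curry_eta g.fst]
      congr 1
      rw [← h (S.pair (S.fst A.fst X.fst) (S.snd A.fst X.fst ≫ g.fst) ≫ S.ev _ _)]
      simp only [Category.assoc]
      congr 2
      rw [← L.assoc (M.pair _ _), M.pair_fst, ← L.assoc (M.pair _ _), M.pair_snd, ← L.assoc,
        M.inl_fst, L.id_comp, ← L.assoc, ← L.assoc, M.inl_snd, M.zero_comp, M.zero_comp,
        M.add_zero, ← L.re_comp]
    · simp only [Sig.comp_snd, Sig.comp_fst, M.re_add, M.comp_add, L.re_compm, M.re_fst, M.re_snd]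
      rw [← L.assoc (M.pair _ _), M.pair_fst, ← L.assoc (M.pair _ _), M.pair_snd, ← L.assoc,
        M.inr_fst, M.zero_comp, M.zero_add, ← L.assoc, ← L.assoc, M.inr_snd, L.id_comp,
        ← L.re_comp, S.pair_fst, M.pow_eta]

/-- The Cartesian closed structure of `Σ_C 𝓛ᵒᵖ`:
`(A₁, A₂) ⇒ (B₁, B₂) = (A₁ ⇒ B₁ × (B₂ ⊸ A₂), !A₁ ⊗ B₂)`. -/
def sigOp : CCStr (SigOp L) where
  one := ⟨S.one, M.one⟩
  bang X := ⟨S.bang X.fst, M.zero _ _ _⟩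
  bang_uniq f g := SigOp.Hom.ext (S.bang_uniq _ _) (by
    have : ∀ {A : C} {X : L.Obj} (k : L.Hom A M.one X), k = M.zero _ _ _ := fun k => by
      rw [← L.id_comp k, M.one_uniq (L.id _ _) (M.zero _ _ _), M.zero_comp]
    rw [this f.snd, this g.snd])
  prod X Y := ⟨S.prod X.fst Y.fst, M.prod X.snd Y.snd⟩
  fst X Y := ⟨S.fst _ _, M.inl _ _ _⟩
  snd X Y := ⟨S.snd _ _, M.inr _ _ _⟩
  pair f g := ⟨S.pair f.fst g.fst,
    M.add (L.comp (M.fst _ _ _) f.snd) (L.comp (M.snd _ _ _) g.snd)⟩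
  pair_fst f g := SigOp.Hom.ext (S.pair_fst _ _) (by
    simp [M.re_inl, M.comp_add, ← L.assoc, M.inl_fst, M.inl_snd, L.id_comp, M.zero_comp,
      M.add_zero])
  pair_snd f g := SigOp.Hom.ext (S.pair_snd _ _) (by
    simp [M.re_inr, M.comp_add, ← L.assoc, M.inr_fst, M.inr_snd, L.id_comp, M.zero_comp,
      M.zero_add])
  pair_eta h := SigOp.Hom.ext (S.pair_eta _) (by
    simp [M.re_inl, M.re_inr, copair_eq])
  exp A B := ⟨S.exp A.fst (S.prod B.fst (M.lolli B.snd A.snd)), M.copow A.fst B.snd⟩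
  ev A B := ⟨S.ev _ _ ≫ S.fst _ _,
    M.pair (L.re (S.ev _ _ ≫ S.snd _ _) (M.lev B.snd A.snd)) (L.re (S.fst _ _) (M.cin A.fst B.snd))⟩
  curry {A X B} f := ⟨S.curry (S.pair f.fst (M.lcurry (L.comp f.snd (M.fst _ _ _)))),
    M.cmatch (L.comp f.snd (M.snd _ _ _))⟩
  curry_beta {A X B} f := by
    refine SigOp.Hom.ext ?_ ?_
    · simp only [SigOp.comp_fst]
      rw [← Category.assoc, S.curry_beta, S.pair_fst]
    · simp only [SigOp.comp_snd, SigOp.comp_fst, M.re_pair, M.comp_add, ← L.re_comp]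
      rw [← L.assoc, M.pair_fst, ← Category.assoc, S.curry_beta, S.pair_snd, M.lolli_beta,
        S.pair_fst, ← L.assoc (M.pair _ _), M.pair_snd, ← L.assoc, M.copow_beta, L.assoc, L.assoc,
        ← M.comp_add, biprod, L.comp_id]
  curry_eta {A X B} g := by
    have e1 : ∀ {P : C} {Y Z W : L.Obj} (p : L.Hom P Y Z) (q : L.Hom P Y W),
        M.add (L.comp p (M.inl P Z W)) (L.comp q (M.inr P Z W)) = M.pair p q := by
      intro P Y Z W p q
      refine M.hom_ext ?_ ?_ <;>
        simp [M.add_comp, L.assoc, inl_fst, inl_snd, inr_fst, inr_snd, L.comp_id, M.comp_zero,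
          M.add_zero, M.zero_add, M.pair_fst, M.pair_snd]
    refine SigOp.Hom.ext ?_ ?_
    · simp only [SigOp.comp_snd, SigOp.comp_fst, M.re_pair, M.comp_add, ← L.re_comp]
      have h : ∀ {P} (k : P ⟶ S.prod B.fst (M.lolli B.snd A.snd)),
          S.pair (k ≫ S.fst _ _) (M.lcurry (L.re (k ≫ S.snd _ _) (M.lev B.snd A.snd))) = k := by
        intro P k; rw [M.lolli_eta, S.pair_eta]
      conv_rhs => rw [← S.curry_eta g.fst]
      congr 1
      rw [← h (S.pair (S.fst A.fst X.fst) (S.snd A.fst X.fst ≫ g.fst) ≫ S.ev _ _)]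
      simp only [Category.assoc]
      congr 2
      rw [← L.assoc (M.pair _ _), M.pair_fst, ← L.assoc (M.pair _ _), M.pair_snd, ← L.assoc,
        e1, M.pair_fst]
    · simp only [SigOp.comp_snd, SigOp.comp_fst, M.re_pair, M.comp_add, ← L.re_comp]
      rw [← L.assoc (M.pair _ _), M.pair_fst, ← L.assoc (M.pair _ _), M.pair_snd, ← L.assoc,
        e1, M.pair_snd, S.pair_fst, M.copow_eta]

end Model

end Sig

/-! ## The category `Syn` -/

namespace STm

variable {Op : Ctx ℕ → ℕ → Type u}

/-- The substitution of a term for the variable of a context with a single variable. -/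
def Sub.one {A : STy} {Δ : Ctx STy} (t : STm Op Δ A) : Sub Op (Ctx.nil.snoc A) Δ :=
  (Sub.nil Δ).snoc t

/-- `s[t/x]` for a term `x : A ⊢ s : B`. -/
def plug {A B : STy} {Δ : Ctx STy} (s : STm Op (Ctx.nil.snoc A) B) (t : STm Op Δ A) :
    STm Op Δ B := s.subst (Sub.one t)

theorem sub_ext {A : STy} {Δ : Ctx STy} {σ τ : Sub Op (Ctx.nil.snoc A) Δ}
    (h : σ _ .zero = τ _ .zero) : σ = τ := by
  funext a x
  cases x with
  | zero => exact h
  | succ x => cases x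

theorem Eqv.plug {A B : STy} {Δ : Ctx STy} {s s' : STm Op (Ctx.nil.snoc A) B} {t t' : STm Op Δ A}
    (h : s.Eqv s') (h' : t.Eqv t') : (s.plug t).Eqv (s'.plug t') := by
  refine (h.subst _).trans (Eqv.subst_right s' fun a x => ?_)
  cases x with
  | zero => exact h'
  | succ x => cases x

theorem plug_var {A B : STy} (t : STm Op (Ctx.nil.snoc A) B) : t.plug (.var .zero) = t :=
  (congrArg (fun σ => t.subst σ) (sub_ext (σ := Sub.one (.var .zero))
    (τ := fun _ x => .var x) rfl)).trans (subst_var t)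

theorem plug_subst {A B : STy} {Γ Δ : Ctx STy} (s : STm Op (Ctx.nil.snoc A) B)
    (t : STm Op Γ A) (σ : Sub Op Γ Δ) : (s.plug t).subst σ = s.plug (t.subst σ) :=
  (subst_subst _ _ _).trans (congrArg (fun σ => s.subst σ) (sub_ext rfl))

theorem plug_plug {A B D : STy} {Δ : Ctx STy} (s : STm Op (Ctx.nil.snoc B) D)
    (t : STm Op (Ctx.nil.snoc A) B) (r : STm Op Δ A) : (s.plug t).plug r = s.plug (t.plug r) :=
  plug_subst _ _ _

theorem plug_wk {A B : STy} {Γ : Ctx STy} (s : STm Op (Ctx.nil.snoc A) B)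
    (t : STm Op Γ A) (D : STy) : (s.plug t).wk D = s.plug (t.wk D) :=
  (rename_subst _ _ _).trans (congrArg (fun σ => s.subst σ) (sub_ext rfl))

/-- `βη`-equivalence classes of terms `x : A ⊢ t : B`. -/
def Cls (Op : Ctx ℕ → ℕ → Type u) (A B : STy) : Type u :=
  Quotient (setoid Op (Ctx.nil.snoc A) B)

namespace Cls

/-- The class of a term. -/
def mk {A B : STy} (t : STm Op (Ctx.nil.snoc A) B) : Cls Op A B := Quotient.mk _ t

theorem sound {A B : STy} {t s : STm Op (Ctx.nil.snoc A) B} (h : t.Eqv s) : mk t = mk s :=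
  Quotient.sound h

theorem ind {A B : STy} {p : Cls Op A B → Prop} (h : ∀ t, p (mk t)) (f : Cls Op A B) : p f :=
  Quotient.ind h f

/-- The action on classes of an operation on terms that respects equivalence. -/
def map {A B A' B' : STy} (F : STm Op (Ctx.nil.snoc A) B → STm Op (Ctx.nil.snoc A') B')
    (h : ∀ t t', t.Eqv t' → (F t).Eqv (F t')) : Cls Op A B → Cls Op A' B' :=
  Quot.map F h

/-- The action on classes of a binary operation on terms that respects equivalence. -/
def map₂ {A B A' B' A'' B'' : STy} (F : STm Op (Ctx.nil.snoc A) B →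
    STm Op (Ctx.nil.snoc A') B' → STm Op (Ctx.nil.snoc A'') B'')
    (h : ∀ t t' s s', t.Eqv t' → s.Eqv s' → (F t s).Eqv (F t' s')) :
    Cls Op A B → Cls Op A' B' → Cls Op A'' B'' :=
  Quot.map₂ F (fun t _ _ h' => h _ _ _ _ (.refl t) h') (fun _ _ s h' => h _ _ _ _ h' (.refl s))

end Cls

/-- The term `x : A ⊢ λ a. f[⟨a, x⟩] : D ⇒ B` of a term `z : D * A ⊢ f : B`. -/
def curry {D A B : STy} (f : STm Op (Ctx.nil.snoc (.prod D A)) B) :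
    STm Op (Ctx.nil.snoc A) (.fn D B) :=
  .lam (f.plug (.pair (.var .zero) (.var (.succ .zero))))

theorem curry_plug_app {D A B : STy} {Δ : Ctx STy} (f : STm Op (Ctx.nil.snoc (.prod D A)) B)
    (t : STm Op Δ A) (s : STm Op Δ D) :
    (STm.app (f.curry.plug t) s).Eqv (f.plug (.pair s t)) := by
  refine (Eqv.fn_beta _ _).trans ?_
  have h : ((f.plug (.pair (.var .zero) (.var (.succ .zero)))).subst
      ((Sub.one t).lift D)).inst s = f.plug (.pair s ((t.wk D).inst s)) := by
    simp only [inst, plug_subst]; rfl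
  rw [h, wk_inst]
  exact .refl _

theorem curry_beta {D A B : STy} (f : STm Op (Ctx.nil.snoc (.prod D A)) B) :
    (STm.app (.snd (.pair (.fst (.var .zero)) (f.curry.plug (.snd (.var .zero)))))
      (.fst (.pair (.fst (.var .zero)) (f.curry.plug (.snd (.var .zero)))))).Eqv f := by
  refine (Eqv.app_congr (.snd_beta _ _) (.fst_beta _ _)).trans
    ((curry_plug_app f _ _).trans ?_)
  have h := Eqv.plug (.refl f) (Eqv.pair_eta (Op := Op) (Γ := Ctx.nil.snoc (.prod D A))
    (.var .zero)).symm
  rwa [plug_var] at h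

theorem curry_eta {D A B : STy} (g : STm Op (Ctx.nil.snoc A) (.fn D B)) :
    (curry (.app (.snd (.pair (.fst (.var .zero)) (g.plug (.snd (.var .zero)))))
      (.fst (.pair (.fst (.var .zero)) (g.plug (.snd (.var .zero))))))).Eqv g := by
  refine Eqv.trans (.lam_congr ?_) (Eqv.fn_eta g).symm
  refine Eqv.app_congr ((Eqv.snd_beta _ _).trans ?_) ((Eqv.fst_beta _ _).trans (.fst_beta _ _))
  have h : g.wk D = g.plug (.var (.succ .zero)) := by
    conv_lhs => rw [← plug_var g, plug_wk]
    rfl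
  rw [h]
  change Eqv ((g.plug _).plug _) _
  rw [plug_plug]
  exact Eqv.plug (.refl g) (.snd_beta _ _)

end STm

/-- The syntactic category of the source language; its objects are the types. -/
structure Syn (Op : Ctx ℕ → ℕ → Type u) : Type where
  ty : STy

section Syn

variable {Op : Ctx ℕ → ℕ → Type u}

/-- Morphisms `A ⟶ B` are the terms `x : A ⊢ t : B` up to `βη`-equivalence. The composition of
`x : A ⊢ t : B` and `y : B ⊢ s : D` is `x : A ⊢ s[t/y] : D`, that is, `let y = t in s`. -/
instance : Category (Syn Op) where
  Hom A B := STm.Cls Op A.ty B.ty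
  id A := .mk (.var .zero)
  comp f g := STm.Cls.map₂ (fun t s => s.plug t) (fun _ _ _ _ h h' => h'.plug h) f g
  id_comp f := by
    induction f using STm.Cls.ind with | h t => exact congrArg STm.Cls.mk (STm.plug_var t)
  comp_id f := by induction f using STm.Cls.ind with | h t => rfl
  assoc f g h := by
    induction f using STm.Cls.ind with | h t =>
    induction g using STm.Cls.ind with | h s =>
    induction h using STm.Cls.ind with | h r =>
    exact congrArg STm.Cls.mk (STm.plug_plug r s t).symm

/-- The Cartesian closed structure of `Syn`. -/
def Syn.ccStr (Op : Ctx ℕ → ℕ → Type u) : CCStr (Syn Op) where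
  one := ⟨.unit⟩
  bang A := STm.Cls.mk .unit
  bang_uniq f g := by
    induction f using STm.Cls.ind with | h t =>
    induction g using STm.Cls.ind with | h s =>
    exact STm.Cls.sound ((STm.Eqv.unit_eta t).trans (STm.Eqv.unit_eta s).symm)
  prod A B := ⟨.prod A.ty B.ty⟩
  fst A B := STm.Cls.mk (.fst (.var .zero))
  snd A B := STm.Cls.mk (.snd (.var .zero))
  pair f g := STm.Cls.map₂ STm.pair (fun _ _ _ _ h h' => .pair_congr h h') f g
  pair_fst f g := by
    induction f using STm.Cls.ind with | h t =>
    induction g using STm.Cls.ind with | h s =>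
    exact STm.Cls.sound (.fst_beta t s)
  pair_snd f g := by
    induction f using STm.Cls.ind with | h t =>
    induction g using STm.Cls.ind with | h s =>
    exact STm.Cls.sound (.snd_beta t s)
  pair_eta f := by
    induction f using STm.Cls.ind with | h t => exact STm.Cls.sound (STm.Eqv.pair_eta t).symm
  exp A B := ⟨.fn A.ty B.ty⟩
  ev A B := STm.Cls.mk (.app (.snd (.var .zero)) (.fst (.var .zero)))
  curry f := STm.Cls.map STm.curry (fun _ _ h => .lam_congr (h.plug (.refl _))) f
  curry_beta f := by
    induction f using STm.Cls.ind with | h t => exact STm.Cls.sound (STm.curry_beta t)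
  curry_eta g := by
    induction g using STm.Cls.ind with | h t => exact STm.Cls.sound (STm.curry_eta t)

instance : CartesianMonoidalCategory (Syn Op) := (Syn.ccStr Op).cartesian
instance : MonoidalClosed (Syn Op) := (Syn.ccStr Op).closed

end Syn

/-! ## The target language -/

mutual

/-- Cartesian types of the target language; `lfun` is `⊸`. -/
inductive CTy : Type
  | real (n : ℕ) : CTy
  | unit : CTy
  | prod (A B : CTy) : CTy
  | fn (A B : CTy) : CTy
  | lfun (S T : LTy) : CTy

/-- Linear types of the target language; `pow A T` is `A ⇒ T` and `copow A T` is `!A ⊗ T`. -/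
inductive LTy : Type
  | real (n : ℕ) : LTy
  | unit : LTy
  | prod (S T : LTy) : LTy
  | pow (A : CTy) (T : LTy) : LTy
  | copow (A : CTy) (T : LTy) : LTy

end

/-- The two judgement forms `Γ ⊢ t : A` and `Γ; v : S ⊢ t : T`. -/
inductive Jdg : Type
  | val (A : CTy) : Jdg
  | lin (S T : LTy) : Jdg

/-- Well-typed terms of the target language, up to renaming of bound variables.
`LOp ns ls ms` is the set of linear operations with Cartesian arguments `ℝ^{n₁}, …, ℝ^{nₖ}`, linear
argument `ℝ^{l₁} * ⋯ * ℝ^{lₚ}` and linear result `ℝ^{m₁} * ⋯ * ℝ^{mᵣ}`. -/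
inductive Tm (Op : Ctx ℕ → ℕ → Type u) (LOp : Ctx ℕ → Ctx ℕ → Ctx ℕ → Type v) :
    Ctx CTy → Jdg → Type (max u v)
  | var {Γ : Ctx CTy} {A : CTy} (x : Var Γ A) : Tm Op LOp Γ (.val A)
  -- `let x = t in s`, where `s` is of either form
  | letin {Γ : Ctx CTy} {A : CTy} {J : Jdg} (t : Tm Op LOp Γ (.val A))
      (s : Tm Op LOp (Γ.snoc A) J) : Tm Op LOp Γ J
  | op {Γ : Ctx CTy} {ns : Ctx ℕ} {m : ℕ} (o : Op ns m)
      (ts : ∀ n, Var ns n → Tm Op LOp Γ (.val (.real n))) : Tm Op LOp Γ (.val (.real m))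
  | unit {Γ : Ctx CTy} : Tm Op LOp Γ (.val .unit)
  | pair {Γ : Ctx CTy} {A B : CTy} (t : Tm Op LOp Γ (.val A)) (s : Tm Op LOp Γ (.val B)) :
      Tm Op LOp Γ (.val (.prod A B))
  | fst {Γ : Ctx CTy} {A B : CTy} (t : Tm Op LOp Γ (.val (.prod A B))) : Tm Op LOp Γ (.val A)
  | snd {Γ : Ctx CTy} {A B : CTy} (t : Tm Op LOp Γ (.val (.prod A B))) : Tm Op LOp Γ (.val B)
  | lam {Γ : Ctx CTy} {A B : CTy} (t : Tm Op LOp (Γ.snoc A) (.val B)) :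
      Tm Op LOp Γ (.val (.fn A B))
  | app {Γ : Ctx CTy} {A B : CTy} (t : Tm Op LOp Γ (.val (.fn A B))) (s : Tm Op LOp Γ (.val A)) :
      Tm Op LOp Γ (.val B)
  -- `λ v. t` and `t • s`
  | lfun {Γ : Ctx CTy} {S T : LTy} (t : Tm Op LOp Γ (.lin S T)) : Tm Op LOp Γ (.val (.lfun S T))
  | lfapp {Γ : Ctx CTy} {S T U : LTy} (t : Tm Op LOp Γ (.val (.lfun T U)))
      (s : Tm Op LOp Γ (.lin S T)) : Tm Op LOp Γ (.lin S U)
  -- the linear variable `v`, and `let v = t in s`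
  | lvar {Γ : Ctx CTy} {S : LTy} : Tm Op LOp Γ (.lin S S)
  | llet {Γ : Ctx CTy} {S T U : LTy} (t : Tm Op LOp Γ (.lin S T)) (s : Tm Op LOp Γ (.lin T U)) :
      Tm Op LOp Γ (.lin S U)
  | lop {Γ : Ctx CTy} {S : LTy} {ns ls ms : Ctx ℕ} (o : LOp ns ls ms)
      (ts : ∀ n, Var ns n → Tm Op LOp Γ (.val (.real n)))
      (s : Tm Op LOp Γ (.lin S (nprod .unit .prod (ls.map .real)))) :
      Tm Op LOp Γ (.lin S (nprod .unit .prod (ms.map .real)))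
  | lunit {Γ : Ctx CTy} {S : LTy} : Tm Op LOp Γ (.lin S .unit)
  | lpair {Γ : Ctx CTy} {S T U : LTy} (t : Tm Op LOp Γ (.lin S T)) (s : Tm Op LOp Γ (.lin S U)) :
      Tm Op LOp Γ (.lin S (.prod T U))
  | lfst {Γ : Ctx CTy} {S T U : LTy} (t : Tm Op LOp Γ (.lin S (.prod T U))) :
      Tm Op LOp Γ (.lin S T)
  | lsnd {Γ : Ctx CTy} {S T U : LTy} (t : Tm Op LOp Γ (.lin S (.prod T U))) :
      Tm Op LOp Γ (.lin S U)
  -- `λ y. t` and `t s` for powers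
  | plam {Γ : Ctx CTy} {A : CTy} {S T : LTy} (t : Tm Op LOp (Γ.snoc A) (.lin S T)) :
      Tm Op LOp Γ (.lin S (.pow A T))
  | papp {Γ : Ctx CTy} {A : CTy} {S T : LTy} (t : Tm Op LOp Γ (.lin S (.pow A T)))
      (s : Tm Op LOp Γ (.val A)) : Tm Op LOp Γ (.lin S T)
  -- `!t ⊗ s` and `case t of !y ⊗ v → s`
  | cpair {Γ : Ctx CTy} {A : CTy} {S T : LTy} (t : Tm Op LOp Γ (.val A))
      (s : Tm Op LOp Γ (.lin S T)) : Tm Op LOp Γ (.lin S (.copow A T))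
  | cmatch {Γ : Ctx CTy} {A : CTy} {S T U : LTy} (t : Tm Op LOp Γ (.lin S (.copow A T)))
      (s : Tm Op LOp (Γ.snoc A) (.lin T U)) : Tm Op LOp Γ (.lin S U)
  | zero {Γ : Ctx CTy} {S T : LTy} : Tm Op LOp Γ (.lin S T)
  | add {Γ : Ctx CTy} {S T : LTy} (t s : Tm Op LOp Γ (.lin S T)) : Tm Op LOp Γ (.lin S T)

/-- The judgement `J`, with the linear variable (if any) of type `S` instead. -/
abbrev Jdg.withVar (S : LTy) : Jdg → Jdg
  | .val A => .val A
  | .lin _ U => .lin S U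

namespace Tm

variable {Op : Ctx ℕ → ℕ → Type u} {LOp : Ctx ℕ → Ctx ℕ → Ctx ℕ → Type v}

/-- Renaming of free Cartesian variables. -/
def rename : {Γ Δ : Ctx CTy} → {J : Jdg} → Ren Γ Δ → Tm Op LOp Γ J → Tm Op LOp Δ J
  | _, _, _, ρ, .var x => .var (ρ _ x)
  | _, _, _, ρ, .letin t s => .letin (t.rename ρ) (s.rename (ρ.lift _))
  | _, _, _, ρ, .op o ts => .op o (fun n i => (ts n i).rename ρ)
  | _, _, _, _, .unit => .unit
  | _, _, _, ρ, .pair t s => .pair (t.rename ρ) (s.rename ρ)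
  | _, _, _, ρ, .fst t => .fst (t.rename ρ)
  | _, _, _, ρ, .snd t => .snd (t.rename ρ)
  | _, _, _, ρ, .lam t => .lam (t.rename (ρ.lift _))
  | _, _, _, ρ, .app t s => .app (t.rename ρ) (s.rename ρ)
  | _, _, _, ρ, .lfun t => .lfun (t.rename ρ)
  | _, _, _, ρ, .lfapp t s => .lfapp (t.rename ρ) (s.rename ρ)
  | _, _, _, _, .lvar => .lvar
  | _, _, _, ρ, .llet t s => .llet (t.rename ρ) (s.rename ρ)
  | _, _, _, ρ, .lop o ts s => .lop o (fun n i => (ts n i).rename ρ) (s.rename ρ)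
  | _, _, _, _, .lunit => .lunit
  | _, _, _, ρ, .lpair t s => .lpair (t.rename ρ) (s.rename ρ)
  | _, _, _, ρ, .lfst t => .lfst (t.rename ρ)
  | _, _, _, ρ, .lsnd t => .lsnd (t.rename ρ)
  | _, _, _, ρ, .plam t => .plam (t.rename (ρ.lift _))
  | _, _, _, ρ, .papp t s => .papp (t.rename ρ) (s.rename ρ)
  | _, _, _, ρ, .cpair t s => .cpair (t.rename ρ) (s.rename ρ)
  | _, _, _, ρ, .cmatch t s => .cmatch (t.rename ρ) (s.rename (ρ.lift _))
  | _, _, _, _, .zero => .zero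
  | _, _, _, ρ, .add t s => .add (t.rename ρ) (s.rename ρ)

/-- Weakening by one variable. -/
def wk {Γ : Ctx CTy} {J : Jdg} (B : CTy) (t : Tm Op LOp Γ J) : Tm Op LOp (Γ.snoc B) J :=
  t.rename (Ren.wk B)

/-- Simultaneous substitutions for Cartesian variables. -/
def Sub (Op : Ctx ℕ → ℕ → Type u) (LOp : Ctx ℕ → Ctx ℕ → Ctx ℕ → Type v) (Γ Δ : Ctx CTy) :
    Type (max u v) := ∀ A, Var Γ A → Tm Op LOp Δ (.val A)

/-- The empty substitution. -/
def Sub.nil (Δ : Ctx CTy) : Sub Op LOp .nil Δ := fun _ x => nomatch x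

/-- Extension of a substitution by a term for the last variable. -/
def Sub.snoc {Γ Δ : Ctx CTy} {B : CTy} (σ : Sub Op LOp Γ Δ) (t : Tm Op LOp Δ (.val B)) :
    Sub Op LOp (Γ.snoc B) Δ
  | _, .zero => t
  | _, .succ x => σ _ x

/-- A substitution, extended under a binder. -/
def Sub.lift {Γ Δ : Ctx CTy} (σ : Sub Op LOp Γ Δ) (B : CTy) :
    Sub Op LOp (Γ.snoc B) (Δ.snoc B) :=
  Sub.snoc (fun _ x => (σ _ x).wk B) (.var .zero)

/-- Capture-avoiding simultaneous substitution for the Cartesian variables. -/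
def subst : {Γ Δ : Ctx CTy} → {J : Jdg} → Sub Op LOp Γ Δ → Tm Op LOp Γ J → Tm Op LOp Δ J
  | _, _, _, σ, .var x => σ _ x
  | _, _, _, σ, .letin t s => .letin (t.subst σ) (s.subst (σ.lift _))
  | _, _, _, σ, .op o ts => .op o (fun n i => (ts n i).subst σ)
  | _, _, _, _, .unit => .unit
  | _, _, _, σ, .pair t s => .pair (t.subst σ) (s.subst σ)
  | _, _, _, σ, .fst t => .fst (t.subst σ)
  | _, _, _, σ, .snd t => .snd (t.subst σ)
  | _, _, _, σ, .lam t => .lam (t.subst (σ.lift _))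
  | _, _, _, σ, .app t s => .app (t.subst σ) (s.subst σ)
  | _, _, _, σ, .lfun t => .lfun (t.subst σ)
  | _, _, _, σ, .lfapp t s => .lfapp (t.subst σ) (s.subst σ)
  | _, _, _, _, .lvar => .lvar
  | _, _, _, σ, .llet t s => .llet (t.subst σ) (s.subst σ)
  | _, _, _, σ, .lop o ts s => .lop o (fun n i => (ts n i).subst σ) (s.subst σ)
  | _, _, _, _, .lunit => .lunit
  | _, _, _, σ, .lpair t s => .lpair (t.subst σ) (s.subst σ)
  | _, _, _, σ, .lfst t => .lfst (t.subst σ)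
  | _, _, _, σ, .lsnd t => .lsnd (t.subst σ)
  | _, _, _, σ, .plam t => .plam (t.subst (σ.lift _))
  | _, _, _, σ, .papp t s => .papp (t.subst σ) (s.subst σ)
  | _, _, _, σ, .cpair t s => .cpair (t.subst σ) (s.subst σ)
  | _, _, _, σ, .cmatch t s => .cmatch (t.subst σ) (s.subst (σ.lift _))
  | _, _, _, _, .zero => .zero
  | _, _, _, σ, .add t s => .add (t.subst σ) (s.subst σ)

/-- `s[t/x]` for the last Cartesian variable `x` of the context. -/
def inst {Γ : Ctx CTy} {A : CTy} {J : Jdg} (s : Tm Op LOp (Γ.snoc A) J)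
    (t : Tm Op LOp Γ (.val A)) : Tm Op LOp Γ J :=
  s.subst (Sub.snoc (fun _ x => .var x) t)

/-- What is substituted for the linear variable of a term of judgement form `J`, if any. -/
abbrev LArg (Op : Ctx ℕ → ℕ → Type u) (LOp : Ctx ℕ → Ctx ℕ → Ctx ℕ → Type v) (Γ : Ctx CTy)
    (S : LTy) : Jdg → Type (max u v)
  | .val _ => PUnit
  | .lin T _ => Tm Op LOp Γ (.lin S T)

/-- The action of an operation on terms. -/
def LArg.map {Γ Δ : Ctx CTy} {S S' : LTy}
    (F : ∀ T, Tm Op LOp Γ (.lin S T) → Tm Op LOp Δ (.lin S' T)) :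
    {J : Jdg} → LArg Op LOp Γ S J → LArg Op LOp Δ S' J
  | .val _, _ => PUnit.unit
  | .lin _ _, s => F _ s

/-- Substitution for the linear variable. -/
def lsubstAux : {Γ : Ctx CTy} → {J : Jdg} → {S : LTy} → Tm Op LOp Γ J → LArg Op LOp Γ S J →
    Tm Op LOp Γ (J.withVar S)
  | _, _, _, .var x, _ => .var x
  | _, _, _, .letin t s, r => .letin t (s.lsubstAux (r.map fun _ r => r.wk _))
  | _, _, _, .op o ts, _ => .op o ts
  | _, _, _, .unit, _ => .unit
  | _, _, _, .pair t s, _ => .pair t s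
  | _, _, _, .fst t, _ => .fst t
  | _, _, _, .snd t, _ => .snd t
  | _, _, _, .lam t, _ => .lam t
  | _, _, _, .app t s, _ => .app t s
  | _, _, _, .lfun t, _ => .lfun t
  | _, _, _, .lfapp t s, r => .lfapp t (s.lsubstAux r)
  | _, _, _, .lvar, r => r
  | _, _, _, .llet t s, r => .llet (t.lsubstAux r) s
  | _, _, _, .lop o ts s, r => .lop o ts (s.lsubstAux r)
  | _, _, _, .lunit, _ => .lunit
  | _, _, _, .lpair t s, r => .lpair (t.lsubstAux r) (s.lsubstAux r)
  | _, _, _, .lfst t, r => .lfst (t.lsubstAux r)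
  | _, _, _, .lsnd t, r => .lsnd (t.lsubstAux r)
  | _, _, _, .plam t, r => .plam (t.lsubstAux (wk _ r))
  | _, _, _, .papp t s, r => .papp (t.lsubstAux r) s
  | _, _, _, .cpair t s, r => .cpair t (s.lsubstAux r)
  | _, _, _, .cmatch t s, r => .cmatch (t.lsubstAux r) s
  | _, _, _, .zero, _ => .zero
  | _, _, _, .add t s, r => .add (t.lsubstAux r) (s.lsubstAux r)

/-- `t[s/v]` for the linear variable `v`. -/
def lsubst {Γ : Ctx CTy} {S T U : LTy} (t : Tm Op LOp Γ (.lin T U)) (s : Tm Op LOp Γ (.lin S T)) :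
    Tm Op LOp Γ (.lin S U) := t.lsubstAux s

theorem rename_rename {Γ Δ Θ : Ctx CTy} {J : Jdg} (t : Tm Op LOp Γ J) (ρ : Ren Γ Δ)
    (ρ' : Ren Δ Θ) : (t.rename ρ).rename ρ' = t.rename (fun a x => ρ' a (ρ a x)) := by
  induction t generalizing Δ Θ <;> simp only [rename, Ren.lift_comp, *]

theorem subst_rename {Γ Δ Θ : Ctx CTy} {J : Jdg} (t : Tm Op LOp Γ J) (ρ : Ren Γ Δ)
    (σ : Sub Op LOp Δ Θ) : (t.rename ρ).subst σ = t.subst (fun a x => σ a (ρ a x)) := by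
  have key : ∀ {Γ Δ Θ : Ctx CTy} (ρ : Ren Γ Δ) (σ : Sub Op LOp Δ Θ) (B : CTy),
      (fun a x => (σ.lift B) a ((ρ.lift B) a x)) = Sub.lift (fun a x => σ a (ρ a x)) B := by
    intros; funext a x; cases x <;> rfl
  induction t generalizing Δ Θ <;> simp only [rename, subst, *]

theorem rename_subst {Γ Δ Θ : Ctx CTy} {J : Jdg} (t : Tm Op LOp Γ J) (σ : Sub Op LOp Γ Δ)
    (ρ : Ren Δ Θ) : (t.subst σ).rename ρ = t.subst (fun a x => (σ a x).rename ρ) := by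
  have key : ∀ {Γ Δ Θ : Ctx CTy} (σ : Sub Op LOp Γ Δ) (ρ : Ren Δ Θ) (B : CTy),
      (fun a x => ((σ.lift B) a x).rename (ρ.lift B)) =
        Sub.lift (fun a x => (σ a x).rename ρ) B := by
    intros
    funext a x
    cases x
    · rfl
    · simp only [Sub.lift, Sub.snoc, wk, rename_rename]; rfl
  induction t generalizing Δ Θ <;> simp only [rename, subst, *]

theorem subst_subst {Γ Δ Θ : Ctx CTy} {J : Jdg} (t : Tm Op LOp Γ J) (σ : Sub Op LOp Γ Δ)
    (τ : Sub Op LOp Δ Θ) : (t.subst σ).subst τ = t.subst (fun a x => (σ a x).subst τ) := by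
  have key : ∀ {Γ Δ Θ : Ctx CTy} (σ : Sub Op LOp Γ Δ) (τ : Sub Op LOp Δ Θ) (B : CTy),
      (fun a x => ((σ.lift B) a x).subst (τ.lift B)) =
        Sub.lift (fun a x => (σ a x).subst τ) B := by
    intros
    funext a x
    cases x
    · rfl
    · simp only [Sub.lift, Sub.snoc, wk, rename_subst, subst_rename]; rfl
  induction t generalizing Δ Θ <;> simp only [subst, *]

theorem subst_var {Γ : Ctx CTy} {J : Jdg} (t : Tm Op LOp Γ J) :
    t.subst (fun _ x => .var x) = t := by
  have key : ∀ (Γ : Ctx CTy) (B : CTy),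
      Sub.lift (fun _ x => .var x : Sub Op LOp Γ Γ) B = fun _ x => .var x := by
    intros; funext a x; cases x <;> rfl
  induction t <;> simp only [subst, *]

theorem inst_subst {Γ Δ : Ctx CTy} {A : CTy} {J : Jdg} (s : Tm Op LOp (Γ.snoc A) J)
    (t : Tm Op LOp Γ (.val A)) (σ : Sub Op LOp Γ Δ) :
    (s.inst t).subst σ = (s.subst (σ.lift A)).inst (t.subst σ) := by
  simp only [inst, subst_subst]
  congr 1
  funext a x
  cases x
  · rfl
  · simp only [Sub.lift, Sub.snoc, wk, subst_rename, subst]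
    exact (subst_var _).symm

theorem wk_subst {Γ Δ : Ctx CTy} {J : Jdg} (t : Tm Op LOp Γ J) (σ : Sub Op LOp Γ Δ) (B : CTy) :
    (t.wk B).subst (σ.lift B) = (t.subst σ).wk B := by
  simp only [wk, subst_rename, rename_subst]; rfl

theorem wk_inst {Γ : Ctx CTy} {B : CTy} {J : Jdg} (t : Tm Op LOp Γ J)
    (s : Tm Op LOp Γ (.val B)) : (t.wk B).inst s = t := by
  simp only [wk, inst, subst_rename]; exact subst_var t

theorem lsubstAux_val {Γ : Ctx CTy} {A : CTy} {S : LTy} (t : Tm Op LOp Γ (.val A))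
    (r : LArg Op LOp Γ S (.val A)) : t.lsubstAux r = t := by
  let P : ∀ (Γ : Ctx CTy) (J : Jdg), Tm Op LOp Γ J → Prop := fun Γ J => match J with
    | .val A => fun t => ∀ r : LArg Op LOp Γ S (.val A), t.lsubstAux r = t
    | .lin _ _ => fun _ => True
  have h : ∀ {Γ : Ctx CTy} {J : Jdg} (t : Tm Op LOp Γ J), P Γ J t := by
    intro Γ J t
    induction t with
    | @letin _ A J t s _ ih =>
      cases J with
      | val B => exact fun r => congrArg (Tm.letin t) (ih _)
      | lin => trivial
    | _ => first | trivial | exact fun _ => rfl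
  exact h t r

theorem lsubstAux_subst {Γ Δ : Ctx CTy} {J : Jdg} {S : LTy} (t : Tm Op LOp Γ J)
    (r : LArg Op LOp Γ S J) (σ : Sub Op LOp Γ Δ) :
    (t.lsubstAux r).subst σ = (t.subst σ).lsubstAux (r.map fun _ r => r.subst σ) := by
  induction t generalizing Δ with
  | @letin _ A J t s _ ih =>
    cases J <;> simp_all [lsubstAux, subst, LArg.map, wk_subst]
  | var x => exact (lsubstAux_val _ _).symm
  | _ => simp_all [lsubstAux, subst, LArg.map, wk_subst]

theorem lsubst_subst {Γ Δ : Ctx CTy} {S T U : LTy} (t : Tm Op LOp Γ (.lin T U))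
    (s : Tm Op LOp Γ (.lin S T)) (σ : Sub Op LOp Γ Δ) :
    (t.lsubst s).subst σ = (t.subst σ).lsubst (s.subst σ) := lsubstAux_subst t s σ

theorem wk_eq {Γ : Ctx CTy} {J : Jdg} (t : Tm Op LOp Γ J) (B : CTy) :
    t.wk B = t.subst (fun _ x => .var (.succ x)) :=
  ((subst_rename t (Ren.wk B) (fun _ x => .var x)).symm.trans (subst_var _)).symm

theorem lsubst_wk {Γ : Ctx CTy} {S T U : LTy} (t : Tm Op LOp Γ (.lin T U))
    (s : Tm Op LOp Γ (.lin S T)) (B : CTy) :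
    (t.lsubst s).wk B = (t.wk B).lsubst (s.wk B) :=
  (wk_eq _ _).trans ((lsubst_subst _ _ _).trans
    (congrArg₂ lsubst (wk_eq t B).symm (wk_eq s B).symm))

theorem lsubst_lvar {Γ : Ctx CTy} {T U : LTy} (t : Tm Op LOp Γ (.lin T U)) :
    t.lsubst .lvar = t := by
  let P : ∀ (Γ : Ctx CTy) (J : Jdg), Tm Op LOp Γ J → Prop := fun Γ J => match J with
    | .val _ => fun _ => True
    | .lin T U => fun t => t.lsubst .lvar = t
  have h : ∀ {Γ : Ctx CTy} {J : Jdg} (t : Tm Op LOp Γ J), P Γ J t := by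
    intro Γ J t
    induction t with
    | @letin _ A J t s _ ih =>
      cases J with
      | val B => trivial
      | lin => exact congrArg (Tm.letin t) ih
    | lfapp t _ _ ih => exact congrArg (lfapp t) ih
    | llet _ s ih _ => exact congrArg (fun t => llet t s) ih
    | lop o ts _ _ ih => exact congrArg (lop o ts) ih
    | lpair _ _ ih₁ ih₂ => exact congrArg₂ lpair ih₁ ih₂
    | lfst _ ih => exact congrArg lfst ih
    | lsnd _ ih => exact congrArg lsnd ih
    | plam _ ih => exact congrArg plam ih
    | papp _ s ih _ => exact congrArg (fun t => papp t s) ih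
    | cpair t _ _ ih => exact congrArg (cpair t) ih
    | cmatch _ s ih _ => exact congrArg (fun t => cmatch t s) ih
    | add _ _ ih₁ ih₂ => exact congrArg₂ add ih₁ ih₂
    | _ => trivial
  exact h t

theorem lsubst_lsubst {Γ : Ctx CTy} {R S T U : LTy} (t : Tm Op LOp Γ (.lin T U))
    (s : Tm Op LOp Γ (.lin S T)) (r : Tm Op LOp Γ (.lin R S)) :
    (t.lsubst s).lsubst r = t.lsubst (s.lsubst r) := by
  let P : ∀ (Γ : Ctx CTy) (J : Jdg), Tm Op LOp Γ J → Prop := fun Γ J => match J with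
    | .val _ => fun _ => True
    | .lin T U => fun t => ∀ (s : Tm Op LOp Γ (.lin S T)) (r : Tm Op LOp Γ (.lin R S)),
        (t.lsubst s).lsubst r = t.lsubst (s.lsubst r)
  have h : ∀ {Γ : Ctx CTy} {J : Jdg} (t : Tm Op LOp Γ J), P Γ J t := by
    intro Γ J t
    induction t with
    | @letin _ A J t s _ ih =>
      cases J with
      | val B => trivial
      | lin T U =>
        exact fun q r => congrArg (Tm.letin t) ((ih (q.wk _) (r.wk _)).trans
          (congrArg (fun q => s.lsubst q) (lsubst_wk q r _).symm))
    | lfapp t _ _ ih => exact fun q r => congrArg (lfapp t) (ih q r)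
    | llet _ s ih _ => exact fun q r => congrArg (fun t => llet t s) (ih q r)
    | lop o ts _ _ ih => exact fun q r => congrArg (lop o ts) (ih q r)
    | lpair _ _ ih₁ ih₂ => exact fun q r => congrArg₂ lpair (ih₁ q r) (ih₂ q r)
    | lfst _ ih => exact fun q r => congrArg lfst (ih q r)
    | lsnd _ ih => exact fun q r => congrArg lsnd (ih q r)
    | plam s ih =>
      exact fun q r => congrArg plam ((ih (q.wk _) (r.wk _)).trans
        (congrArg (fun q => s.lsubst q) (lsubst_wk q r _).symm))
    | papp _ s ih _ => exact fun q r => congrArg (fun t => papp t s) (ih q r)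
    | cpair t _ _ ih => exact fun q r => congrArg (cpair t) (ih q r)
    | cmatch _ s ih _ => exact fun q r => congrArg (fun t => cmatch t s) (ih q r)
    | add _ _ ih₁ ih₂ => exact fun q r => congrArg₂ add (ih₁ q r) (ih₂ q r)
    | _ => first | trivial | exact fun _ _ => rfl
  exact h t s r

/-- The `βη+`-equational theory of the target language: `βη`-laws for all type formers, the
commutative monoid laws for `0` and `+`, and the homomorphism laws for the linear variable. -/
inductive Eqv : {Γ : Ctx CTy} → {J : Jdg} → Tm Op LOp Γ J → Tm Op LOp Γ J → Prop
  | refl {Γ : Ctx CTy} {J : Jdg} (t : Tm Op LOp Γ J) : Eqv t t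
  | symm {Γ : Ctx CTy} {J : Jdg} {t s : Tm Op LOp Γ J} : Eqv t s → Eqv s t
  | trans {Γ : Ctx CTy} {J : Jdg} {t s r : Tm Op LOp Γ J} : Eqv t s → Eqv s r → Eqv t r
  -- congruence
  | letin_congr {Γ : Ctx CTy} {A : CTy} {J : Jdg} {t t' : Tm Op LOp Γ (.val A)}
      {s s' : Tm Op LOp (Γ.snoc A) J} : Eqv t t' → Eqv s s' → Eqv (.letin t s) (.letin t' s')
  | op_congr {Γ : Ctx CTy} {ns : Ctx ℕ} {m : ℕ} (o : Op ns m)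
      {ts ts' : ∀ n, Var ns n → Tm Op LOp Γ (.val (.real n))} :
      (∀ n i, Eqv (ts n i) (ts' n i)) → Eqv (.op o ts) (.op o ts')
  | pair_congr {Γ : Ctx CTy} {A B : CTy} {t t' : Tm Op LOp Γ (.val A)}
      {s s' : Tm Op LOp Γ (.val B)} : Eqv t t' → Eqv s s' → Eqv (.pair t s) (.pair t' s')
  | fst_congr {Γ : Ctx CTy} {A B : CTy} {t t' : Tm Op LOp Γ (.val (.prod A B))} :
      Eqv t t' → Eqv (.fst t) (.fst t')
  | snd_congr {Γ : Ctx CTy} {A B : CTy} {t t' : Tm Op LOp Γ (.val (.prod A B))} :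
      Eqv t t' → Eqv (.snd t) (.snd t')
  | lam_congr {Γ : Ctx CTy} {A B : CTy} {t t' : Tm Op LOp (Γ.snoc A) (.val B)} :
      Eqv t t' → Eqv (.lam t) (.lam t')
  | app_congr {Γ : Ctx CTy} {A B : CTy} {t t' : Tm Op LOp Γ (.val (.fn A B))}
      {s s' : Tm Op LOp Γ (.val A)} : Eqv t t' → Eqv s s' → Eqv (.app t s) (.app t' s')
  | lfun_congr {Γ : Ctx CTy} {S T : LTy} {t t' : Tm Op LOp Γ (.lin S T)} :
      Eqv t t' → Eqv (.lfun t) (.lfun t')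
  | lfapp_congr {Γ : Ctx CTy} {S T U : LTy} {t t' : Tm Op LOp Γ (.val (.lfun T U))}
      {s s' : Tm Op LOp Γ (.lin S T)} : Eqv t t' → Eqv s s' → Eqv (.lfapp t s) (.lfapp t' s')
  | llet_congr {Γ : Ctx CTy} {S T U : LTy} {t t' : Tm Op LOp Γ (.lin S T)}
      {s s' : Tm Op LOp Γ (.lin T U)} : Eqv t t' → Eqv s s' → Eqv (.llet t s) (.llet t' s')
  | lop_congr {Γ : Ctx CTy} {S : LTy} {ns ls ms : Ctx ℕ} (o : LOp ns ls ms)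
      {ts ts' : ∀ n, Var ns n → Tm Op LOp Γ (.val (.real n))}
      {s s' : Tm Op LOp Γ (.lin S (nprod .unit .prod (ls.map .real)))} :
      (∀ n i, Eqv (ts n i) (ts' n i)) → Eqv s s' → Eqv (.lop o ts s) (.lop o ts' s')
  | lpair_congr {Γ : Ctx CTy} {S T U : LTy} {t t' : Tm Op LOp Γ (.lin S T)}
      {s s' : Tm Op LOp Γ (.lin S U)} : Eqv t t' → Eqv s s' → Eqv (.lpair t s) (.lpair t' s')
  | lfst_congr {Γ : Ctx CTy} {S T U : LTy} {t t' : Tm Op LOp Γ (.lin S (.prod T U))} :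
      Eqv t t' → Eqv (.lfst t) (.lfst t')
  | lsnd_congr {Γ : Ctx CTy} {S T U : LTy} {t t' : Tm Op LOp Γ (.lin S (.prod T U))} :
      Eqv t t' → Eqv (.lsnd t) (.lsnd t')
  | plam_congr {Γ : Ctx CTy} {A : CTy} {S T : LTy} {t t' : Tm Op LOp (Γ.snoc A) (.lin S T)} :
      Eqv t t' → Eqv (.plam t) (.plam t')
  | papp_congr {Γ : Ctx CTy} {A : CTy} {S T : LTy} {t t' : Tm Op LOp Γ (.lin S (.pow A T))}
      {s s' : Tm Op LOp Γ (.val A)} : Eqv t t' → Eqv s s' → Eqv (.papp t s) (.papp t' s')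
  | cpair_congr {Γ : Ctx CTy} {A : CTy} {S T : LTy} {t t' : Tm Op LOp Γ (.val A)}
      {s s' : Tm Op LOp Γ (.lin S T)} : Eqv t t' → Eqv s s' → Eqv (.cpair t s) (.cpair t' s')
  | cmatch_congr {Γ : Ctx CTy} {A : CTy} {S T U : LTy}
      {t t' : Tm Op LOp Γ (.lin S (.copow A T))} {s s' : Tm Op LOp (Γ.snoc A) (.lin T U)} :
      Eqv t t' → Eqv s s' → Eqv (.cmatch t s) (.cmatch t' s')
  | add_congr {Γ : Ctx CTy} {S T : LTy} {t t' s s' : Tm Op LOp Γ (.lin S T)} :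
      Eqv t t' → Eqv s s' → Eqv (.add t s) (.add t' s')
  -- `βη`-laws for Cartesian types
  | let_beta {Γ : Ctx CTy} {A : CTy} {J : Jdg} (t : Tm Op LOp Γ (.val A))
      (s : Tm Op LOp (Γ.snoc A) J) : Eqv (.letin t s) (s.inst t)
  | unit_eta {Γ : Ctx CTy} (t : Tm Op LOp Γ (.val .unit)) : Eqv t .unit
  | fst_beta {Γ : Ctx CTy} {A B : CTy} (t : Tm Op LOp Γ (.val A)) (s : Tm Op LOp Γ (.val B)) :
      Eqv (.fst (.pair t s)) t
  | snd_beta {Γ : Ctx CTy} {A B : CTy} (t : Tm Op LOp Γ (.val A)) (s : Tm Op LOp Γ (.val B)) :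
      Eqv (.snd (.pair t s)) s
  | pair_eta {Γ : Ctx CTy} {A B : CTy} (t : Tm Op LOp Γ (.val (.prod A B))) :
      Eqv t (.pair (.fst t) (.snd t))
  | fn_beta {Γ : Ctx CTy} {A B : CTy} (t : Tm Op LOp (Γ.snoc A) (.val B))
      (s : Tm Op LOp Γ (.val A)) : Eqv (.app (.lam t) s) (t.inst s)
  | fn_eta {Γ : Ctx CTy} {A B : CTy} (t : Tm Op LOp Γ (.val (.fn A B))) :
      Eqv t (.lam (.app (t.wk A) (.var .zero)))
  | lfun_beta {Γ : Ctx CTy} {S T U : LTy} (t : Tm Op LOp Γ (.lin T U))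
      (s : Tm Op LOp Γ (.lin S T)) : Eqv (.lfapp (.lfun t) s) (t.lsubst s)
  | lfun_eta {Γ : Ctx CTy} {S T : LTy} (t : Tm Op LOp Γ (.val (.lfun S T))) :
      Eqv t (.lfun (.lfapp t .lvar))
  -- `βη`-laws for linear types
  | llet_beta {Γ : Ctx CTy} {S T U : LTy} (t : Tm Op LOp Γ (.lin S T))
      (s : Tm Op LOp Γ (.lin T U)) : Eqv (.llet t s) (s.lsubst t)
  | lunit_eta {Γ : Ctx CTy} {S : LTy} (t : Tm Op LOp Γ (.lin S .unit)) : Eqv t .lunit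
  | lfst_beta {Γ : Ctx CTy} {S T U : LTy} (t : Tm Op LOp Γ (.lin S T))
      (s : Tm Op LOp Γ (.lin S U)) : Eqv (.lfst (.lpair t s)) t
  | lsnd_beta {Γ : Ctx CTy} {S T U : LTy} (t : Tm Op LOp Γ (.lin S T))
      (s : Tm Op LOp Γ (.lin S U)) : Eqv (.lsnd (.lpair t s)) s
  | lpair_eta {Γ : Ctx CTy} {S T U : LTy} (t : Tm Op LOp Γ (.lin S (.prod T U))) :
      Eqv t (.lpair (.lfst t) (.lsnd t))
  | pow_beta {Γ : Ctx CTy} {A : CTy} {S T : LTy} (t : Tm Op LOp (Γ.snoc A) (.lin S T))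
      (s : Tm Op LOp Γ (.val A)) : Eqv (.papp (.plam t) s) (t.inst s)
  | pow_eta {Γ : Ctx CTy} {A : CTy} {S T : LTy} (t : Tm Op LOp Γ (.lin S (.pow A T))) :
      Eqv t (.plam (.papp (t.wk A) (.var .zero)))
  | copow_beta {Γ : Ctx CTy} {A : CTy} {S T U : LTy} (t : Tm Op LOp Γ (.val A))
      (s : Tm Op LOp Γ (.lin S T)) (r : Tm Op LOp (Γ.snoc A) (.lin T U)) :
      Eqv (.cmatch (.cpair t s) r) ((r.inst t).lsubst s)
  | copow_eta {Γ : Ctx CTy} {A : CTy} {S T U : LTy} (s : Tm Op LOp Γ (.lin S (.copow A T)))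
      (t : Tm Op LOp Γ (.lin (.copow A T) U)) :
      Eqv (t.lsubst s) (.cmatch s ((t.wk A).lsubst (.cpair (.var .zero) .lvar)))
  -- commutative monoid laws
  | add_zero {Γ : Ctx CTy} {S T : LTy} (t : Tm Op LOp Γ (.lin S T)) : Eqv (.add t .zero) t
  | zero_add {Γ : Ctx CTy} {S T : LTy} (t : Tm Op LOp Γ (.lin S T)) : Eqv (.add .zero t) t
  | add_assoc {Γ : Ctx CTy} {S T : LTy} (t s r : Tm Op LOp Γ (.lin S T)) :
      Eqv (.add (.add t s) r) (.add t (.add s r))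
  | add_comm {Γ : Ctx CTy} {S T : LTy} (t s : Tm Op LOp Γ (.lin S T)) :
      Eqv (.add t s) (.add s t)
  -- homomorphism laws
  | lsubst_zero {Γ : Ctx CTy} {S T U : LTy} (t : Tm Op LOp Γ (.lin T U)) :
      Eqv (t.lsubst (.zero : Tm Op LOp Γ (.lin S T))) .zero
  | lsubst_add {Γ : Ctx CTy} {S T U : LTy} (t : Tm Op LOp Γ (.lin T U))
      (s r : Tm Op LOp Γ (.lin S T)) : Eqv (t.lsubst (.add s r)) (.add (t.lsubst s) (t.lsubst r))

theorem Eqv.subst {Γ Δ : Ctx CTy} {J : Jdg} {t s : Tm Op LOp Γ J} (h : Eqv t s)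
    (σ : Sub Op LOp Γ Δ) : Eqv (t.subst σ) (s.subst σ) := by
  induction h generalizing Δ with
  | refl t => exact .refl _
  | symm _ ih => exact .symm (ih σ)
  | trans _ _ ih₁ ih₂ => exact .trans (ih₁ σ) (ih₂ σ)
  | letin_congr _ _ ih₁ ih₂ => exact .letin_congr (ih₁ σ) (ih₂ _)
  | op_congr o _ ih => exact .op_congr o fun n i => ih n i σ
  | pair_congr _ _ ih₁ ih₂ => exact .pair_congr (ih₁ σ) (ih₂ σ)
  | fst_congr _ ih => exact .fst_congr (ih σ)
  | snd_congr _ ih => exact .snd_congr (ih σ)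
  | lam_congr _ ih => exact .lam_congr (ih _)
  | app_congr _ _ ih₁ ih₂ => exact .app_congr (ih₁ σ) (ih₂ σ)
  | lfun_congr _ ih => exact .lfun_congr (ih σ)
  | lfapp_congr _ _ ih₁ ih₂ => exact .lfapp_congr (ih₁ σ) (ih₂ σ)
  | llet_congr _ _ ih₁ ih₂ => exact .llet_congr (ih₁ σ) (ih₂ σ)
  | lop_congr o _ _ ih₁ ih₂ => exact .lop_congr o (fun n i => ih₁ n i σ) (ih₂ σ)
  | lpair_congr _ _ ih₁ ih₂ => exact .lpair_congr (ih₁ σ) (ih₂ σ)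
  | lfst_congr _ ih => exact .lfst_congr (ih σ)
  | lsnd_congr _ ih => exact .lsnd_congr (ih σ)
  | plam_congr _ ih => exact .plam_congr (ih _)
  | papp_congr _ _ ih₁ ih₂ => exact .papp_congr (ih₁ σ) (ih₂ σ)
  | cpair_congr _ _ ih₁ ih₂ => exact .cpair_congr (ih₁ σ) (ih₂ σ)
  | cmatch_congr _ _ ih₁ ih₂ => exact .cmatch_congr (ih₁ σ) (ih₂ _)
  | add_congr _ _ ih₁ ih₂ => exact .add_congr (ih₁ σ) (ih₂ σ)
  | let_beta t s => rw [inst_subst]; exact .let_beta _ _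
  | unit_eta t => exact .unit_eta _
  | fst_beta t s => exact .fst_beta _ _
  | snd_beta t s => exact .snd_beta _ _
  | pair_eta t => exact .pair_eta _
  | fn_beta t s => rw [inst_subst]; exact .fn_beta _ _
  | fn_eta t =>
    have h := Eqv.fn_eta (t.subst σ)
    rw [← wk_subst] at h
    exact h
  | lfun_beta t s => rw [lsubst_subst]; exact .lfun_beta _ _
  | lfun_eta t => exact .lfun_eta _
  | llet_beta t s => rw [lsubst_subst]; exact .llet_beta _ _
  | lunit_eta t => exact .lunit_eta _
  | lfst_beta t s => exact .lfst_beta _ _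
  | lsnd_beta t s => exact .lsnd_beta _ _
  | lpair_eta t => exact .lpair_eta _
  | pow_beta t s => rw [inst_subst]; exact .pow_beta _ _
  | pow_eta t =>
    have h := Eqv.pow_eta (t.subst σ)
    rw [← wk_subst] at h
    exact h
  | copow_beta t s r => rw [lsubst_subst, inst_subst]; exact .copow_beta _ _ _
  | @copow_eta _ A _ _ _ s t =>
    have h := Eqv.copow_eta (s.subst σ) (t.subst σ)
    rw [← wk_subst] at h
    rw [lsubst_subst]
    refine h.trans ?_
    simp only [Tm.subst, lsubst_subst]
    exact .refl _
  | add_zero t => exact .add_zero _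
  | zero_add t => exact .zero_add _
  | add_assoc t s r => exact .add_assoc _ _ _
  | add_comm t s => exact .add_comm _ _
  | lsubst_zero t => rw [lsubst_subst]; exact .lsubst_zero _
  | lsubst_add t s r =>
    simp only [Tm.subst, lsubst_subst]; exact .lsubst_add _ _ _

theorem Eqv.wk {Γ : Ctx CTy} {J : Jdg} {t s : Tm Op LOp Γ J} (h : Eqv t s) (B : CTy) :
    Eqv (t.wk B) (s.wk B) := by
  rw [wk_eq, wk_eq]; exact h.subst _

theorem Eqv.lsubst {Γ : Ctx CTy} {S T U : LTy} {t t' : Tm Op LOp Γ (.lin T U)}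
    {s s' : Tm Op LOp Γ (.lin S T)} (h : Eqv t t') (h' : Eqv s s') :
    Eqv (t.lsubst s) (t'.lsubst s') :=
  (Eqv.llet_beta s t).symm.trans ((Eqv.llet_congr h' h).trans (.llet_beta s' t'))

theorem Eqv.subst_right {Γ Δ : Ctx CTy} {J : Jdg} (t : Tm Op LOp Γ J) {σ τ : Sub Op LOp Γ Δ}
    (h : ∀ a x, Eqv (σ a x) (τ a x)) : Eqv (t.subst σ) (t.subst τ) := by
  have key : ∀ {Γ Δ : Ctx CTy} {σ τ : Sub Op LOp Γ Δ} (B : CTy), (∀ a x, Eqv (σ a x) (τ a x)) →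
      ∀ a x, Eqv (σ.lift B a x) (τ.lift B a x) := by
    intro Γ Δ σ τ B h a x
    cases x
    · exact .refl _
    · exact (h _ _).wk B
  induction t generalizing Δ with
  | var x => exact h _ x
  | letin _ _ ih₁ ih₂ => exact .letin_congr (ih₁ h) (ih₂ (key _ h))
  | op o _ ih => exact .op_congr o fun n i => ih n i h
  | unit => exact .refl _
  | pair _ _ ih₁ ih₂ => exact .pair_congr (ih₁ h) (ih₂ h)
  | fst _ ih => exact .fst_congr (ih h)
  | snd _ ih => exact .snd_congr (ih h)
  | lam _ ih => exact .lam_congr (ih (key _ h))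
  | app _ _ ih₁ ih₂ => exact .app_congr (ih₁ h) (ih₂ h)
  | lfun _ ih => exact .lfun_congr (ih h)
  | lfapp _ _ ih₁ ih₂ => exact .lfapp_congr (ih₁ h) (ih₂ h)
  | lvar => exact .refl _
  | llet _ _ ih₁ ih₂ => exact .llet_congr (ih₁ h) (ih₂ h)
  | lop o _ _ ih₁ ih₂ => exact .lop_congr o (fun n i => ih₁ n i h) (ih₂ h)
  | lunit => exact .refl _
  | lpair _ _ ih₁ ih₂ => exact .lpair_congr (ih₁ h) (ih₂ h)
  | lfst _ ih => exact .lfst_congr (ih h)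
  | lsnd _ ih => exact .lsnd_congr (ih h)
  | plam _ ih => exact .plam_congr (ih (key _ h))
  | papp _ _ ih₁ ih₂ => exact .papp_congr (ih₁ h) (ih₂ h)
  | cpair _ _ ih₁ ih₂ => exact .cpair_congr (ih₁ h) (ih₂ h)
  | cmatch _ _ ih₁ ih₂ => exact .cmatch_congr (ih₁ h) (ih₂ (key _ h))
  | zero => exact .refl _
  | add _ _ ih₁ ih₂ => exact .add_congr (ih₁ h) (ih₂ h)

/-- Terms up to `βη+`-equivalence. -/
def setoid (Op : Ctx ℕ → ℕ → Type u) (LOp : Ctx ℕ → Ctx ℕ → Ctx ℕ → Type v) (Γ : Ctx CTy)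
    (J : Jdg) : Setoid (Tm Op LOp Γ J) :=
  ⟨Eqv, Eqv.refl, Eqv.symm, Eqv.trans⟩

/-! ## The syntactic model of the target language -/

/-- The substitution of a term for the variable of a context with a single variable. -/
def Sub.one {A : CTy} {Δ : Ctx CTy} (t : Tm Op LOp Δ (.val A)) :
    Sub Op LOp (Ctx.nil.snoc A) Δ := (Sub.nil Δ).snoc t

/-- `s[t/x]` for a term `s` with a single Cartesian variable `x : A`. -/
def plug {A : CTy} {J : Jdg} {Δ : Ctx CTy} (s : Tm Op LOp (Ctx.nil.snoc A) J)
    (t : Tm Op LOp Δ (.val A)) : Tm Op LOp Δ J := s.subst (Sub.one t)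

theorem sub_ext {A : CTy} {Δ : Ctx CTy} {σ τ : Sub Op LOp (Ctx.nil.snoc A) Δ}
    (h : σ _ .zero = τ _ .zero) : σ = τ := by
  funext a x
  cases x with
  | zero => exact h
  | succ x => cases x

theorem Eqv.plug {A : CTy} {J : Jdg} {Δ : Ctx CTy} {s s' : Tm Op LOp (Ctx.nil.snoc A) J}
    {t t' : Tm Op LOp Δ (.val A)} (h : s.Eqv s') (h' : t.Eqv t') :
    (s.plug t).Eqv (s'.plug t') := by
  refine (h.subst _).trans (Eqv.subst_right s' fun a x => ?_)
  cases x with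
  | zero => exact h'
  | succ x => cases x

theorem plug_var {A : CTy} {J : Jdg} (t : Tm Op LOp (Ctx.nil.snoc A) J) :
    t.plug (.var .zero) = t :=
  (congrArg (fun σ => t.subst σ) (sub_ext (σ := Sub.one (.var .zero))
    (τ := fun _ x => .var x) rfl)).trans (subst_var t)

theorem plug_subst {A : CTy} {J : Jdg} {Γ Δ : Ctx CTy} (s : Tm Op LOp (Ctx.nil.snoc A) J)
    (t : Tm Op LOp Γ (.val A)) (σ : Sub Op LOp Γ Δ) :
    (s.plug t).subst σ = s.plug (t.subst σ) :=
  (subst_subst _ _ _).trans (congrArg (fun σ => s.subst σ) (sub_ext rfl))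

theorem plug_plug {A B : CTy} {J : Jdg} {Δ : Ctx CTy} (s : Tm Op LOp (Ctx.nil.snoc B) J)
    (t : Tm Op LOp (Ctx.nil.snoc A) (.val B)) (r : Tm Op LOp Δ (.val A)) :
    (s.plug t).plug r = s.plug (t.plug r) := plug_subst _ _ _

theorem plug_wk {A : CTy} {J : Jdg} {Γ : Ctx CTy} (s : Tm Op LOp (Ctx.nil.snoc A) J)
    (t : Tm Op LOp Γ (.val A)) (D : CTy) : (s.plug t).wk D = s.plug (t.wk D) :=
  (rename_subst _ _ _).trans (congrArg (fun σ => s.subst σ) (sub_ext rfl))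

theorem wk_eq_plug {A D : CTy} {J : Jdg} (s : Tm Op LOp (Ctx.nil.snoc A) J) :
    s.wk D = s.plug (.var (.succ .zero)) := by
  conv_lhs => rw [← plug_var s, plug_wk]
  rfl

/-- `βη+`-equivalence classes of terms with a single Cartesian variable `x : A`. -/
def Cls (Op : Ctx ℕ → ℕ → Type u) (LOp : Ctx ℕ → Ctx ℕ → Ctx ℕ → Type v) (A : CTy) (J : Jdg) :
    Type (max u v) := Quotient (setoid Op LOp (Ctx.nil.snoc A) J)

namespace Cls

/-- The class of a term. -/
def mk {A : CTy} {J : Jdg} (t : Tm Op LOp (Ctx.nil.snoc A) J) : Cls Op LOp A J := Quotient.mk _ t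

theorem sound {A : CTy} {J : Jdg} {t s : Tm Op LOp (Ctx.nil.snoc A) J} (h : t.Eqv s) :
    mk t = mk s := Quotient.sound h

theorem ind {A : CTy} {J : Jdg} {p : Cls Op LOp A J → Prop} (h : ∀ t, p (mk t))
    (f : Cls Op LOp A J) : p f := Quotient.ind h f

/-- The action on classes of an operation on terms that respects equivalence. -/
def map {A A' : CTy} {J J' : Jdg}
    (F : Tm Op LOp (Ctx.nil.snoc A) J → Tm Op LOp (Ctx.nil.snoc A') J')
    (h : ∀ t t', t.Eqv t' → (F t).Eqv (F t')) : Cls Op LOp A J → Cls Op LOp A' J' :=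
  Quot.map F h

/-- The action on classes of a binary operation on terms that respects equivalence. -/
def map₂ {A A' A'' : CTy} {J J' J'' : Jdg} (F : Tm Op LOp (Ctx.nil.snoc A) J →
    Tm Op LOp (Ctx.nil.snoc A') J' → Tm Op LOp (Ctx.nil.snoc A'') J'')
    (h : ∀ t t' s s', t.Eqv t' → s.Eqv s' → (F t s).Eqv (F t' s')) :
    Cls Op LOp A J → Cls Op LOp A' J' → Cls Op LOp A'' J'' :=
  Quot.map₂ F (fun t _ _ h' => h _ _ _ _ (.refl t) h') (fun _ _ s h' => h _ _ _ _ h' (.refl s))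

end Cls

/-- A term with the variable `z : D * A`, as a term with the variables `x : A` and `a : D`. -/
def split {D A : CTy} {J : Jdg} (f : Tm Op LOp (Ctx.nil.snoc (.prod D A)) J) :
    Tm Op LOp ((Ctx.nil.snoc A).snoc D) J :=
  f.plug (.pair (.var .zero) (.var (.succ .zero)))

theorem split_inst {D A : CTy} {J : Jdg} {Δ : Ctx CTy}
    (f : Tm Op LOp (Ctx.nil.snoc (.prod D A)) J) (t : Tm Op LOp Δ (.val A))
    (s : Tm Op LOp Δ (.val D)) :
    (f.split.subst ((Sub.one t).lift D)).inst s = f.plug (.pair s t) := by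
  have h : (f.split.subst ((Sub.one t).lift D)).inst s = f.plug (.pair s ((t.wk D).inst s)) := by
    simp only [inst, split, plug_subst]; rfl
  rw [h, wk_inst]

theorem plug_eta {D A : CTy} {J : Jdg} (f : Tm Op LOp (Ctx.nil.snoc (.prod D A)) J) :
    (f.plug (.pair (.fst (.var .zero)) (.snd (.var .zero)))).Eqv f := by
  have h := Eqv.plug (.refl f) (Eqv.pair_eta (Op := Op) (LOp := LOp)
    (Γ := Ctx.nil.snoc (.prod D A)) (.var .zero)).symm
  rwa [plug_var] at h

theorem split_snd {D A : CTy} {J : Jdg} (g : Tm Op LOp (Ctx.nil.snoc A) J) :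
    (split (D := D) (g.plug (.snd (.var .zero)))).Eqv (g.wk D) := by
  rw [wk_eq_plug, split, plug_plug]
  exact Eqv.plug (.refl g) (.snd_beta _ _)

theorem fn_beta' {D A B : CTy} (f : Tm Op LOp (Ctx.nil.snoc (.prod D A)) (.val B)) :
    (Tm.app (.snd (.pair (.fst (.var .zero)) ((lam f.split).plug (.snd (.var .zero)))))
      (.fst (.pair (.fst (.var .zero)) ((lam f.split).plug (.snd (.var .zero)))))).Eqv f := by
  refine (Eqv.app_congr (.snd_beta _ _) (.fst_beta _ _)).trans ((Eqv.fn_beta _ _).trans ?_)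
  rw [split_inst]
  exact plug_eta f

theorem fn_eta' {D A B : CTy} (g : Tm Op LOp (Ctx.nil.snoc A) (.val (.fn D B))) :
    (lam (split (.app (.snd (.pair (.fst (.var .zero)) (g.plug (.snd (.var .zero)))))
      (.fst (.pair (.fst (.var .zero)) (g.plug (.snd (.var .zero)))))))).Eqv g := by
  refine Eqv.trans (.lam_congr ?_) (Eqv.fn_eta g).symm
  exact Eqv.app_congr ((Eqv.snd_beta _ _).trans (split_snd g))
    ((Eqv.fst_beta _ _).trans (.fst_beta _ _))

theorem pow_beta' {D A : CTy} {S T : LTy} (f : Tm Op LOp (Ctx.nil.snoc (.prod D A)) (.lin S T)) :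
    (Tm.papp ((plam f.split).plug (.snd (.var .zero))) (.fst (.var .zero))).Eqv f := by
  refine (Eqv.pow_beta _ _).trans ?_
  rw [split_inst]
  exact plug_eta f

theorem pow_eta' {D A : CTy} {S T : LTy} (g : Tm Op LOp (Ctx.nil.snoc A) (.lin S (.pow D T))) :
    (plam (split (.papp (g.plug (.snd (.var .zero))) (.fst (.var .zero))))).Eqv g :=
  Eqv.trans (.plam_congr (Eqv.papp_congr (split_snd g) (.fst_beta _ _))) (Eqv.pow_eta g).symm

theorem copow_beta' {D A : CTy} {S T : LTy}
    (f : Tm Op LOp (Ctx.nil.snoc (.prod D A)) (.lin S T)) :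
    (Tm.cmatch (.cpair (.fst (.var .zero)) .lvar) (f.split.subst
      ((Sub.one (.snd (.var .zero))).lift D))).Eqv f := by
  refine (Eqv.copow_beta _ _ _).trans ?_
  rw [lsubst_lvar, split_inst]
  exact plug_eta f

theorem copow_eta' {D A : CTy} {S T : LTy}
    (g : Tm Op LOp (Ctx.nil.snoc A) (.lin (.copow D S) T)) :
    (Tm.cmatch .lvar (split ((g.plug (.snd (.var .zero))).lsubst
      (.cpair (.fst (.var .zero)) .lvar)))).Eqv g := by
  have h := (Eqv.copow_eta .lvar g).symm
  rw [lsubst_lvar] at h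
  refine Eqv.trans (.cmatch_congr (.refl _) ?_) h
  rw [split, plug, lsubst_subst]
  exact Eqv.lsubst (split_snd g) (.cpair_congr (.fst_beta _ _) (.refl _))

theorem lfun_beta' {A : CTy} {S T : LTy} (f : Tm Op LOp (Ctx.nil.snoc A) (.lin S T)) :
    (Tm.lfapp (.lfun f) .lvar).Eqv f := by
  refine (Eqv.lfun_beta f .lvar).trans ?_
  rw [lsubst_lvar]
  exact .refl _

end Tm

/-- The syntactic category of Cartesian types of the target language. -/
structure CSyn (Op : Ctx ℕ → ℕ → Type u) (LOp : Ctx ℕ → Ctx ℕ → Ctx ℕ → Type v) : Type where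
  ty : CTy

section CSyn

variable {Op : Ctx ℕ → ℕ → Type u} {LOp : Ctx ℕ → Ctx ℕ → Ctx ℕ → Type v}

/-- Morphisms `A ⟶ B` are the terms `x : A ⊢ t : B` up to `βη+`-equivalence. -/
instance : Category (CSyn Op LOp) where
  Hom A B := Tm.Cls Op LOp A.ty (.val B.ty)
  id A := .mk (.var .zero)
  comp f g := Tm.Cls.map₂ (fun t s => s.plug t) (fun _ _ _ _ h h' => h'.plug h) f g
  id_comp f := by
    induction f using Tm.Cls.ind with | h t => exact congrArg Tm.Cls.mk (Tm.plug_var t)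
  comp_id f := by induction f using Tm.Cls.ind with | h t => rfl
  assoc f g h := by
    induction f using Tm.Cls.ind with | h t =>
    induction g using Tm.Cls.ind with | h s =>
    induction h using Tm.Cls.ind with | h r =>
    exact congrArg Tm.Cls.mk (Tm.plug_plug r s t).symm

/-- The Cartesian closed structure of `CSyn`. -/
def CSyn.ccStr (Op : Ctx ℕ → ℕ → Type u) (LOp : Ctx ℕ → Ctx ℕ → Ctx ℕ → Type v) :
    CCStr (CSyn Op LOp) where
  one := ⟨.unit⟩
  bang A := Tm.Cls.mk .unit
  bang_uniq f g := by
    induction f using Tm.Cls.ind with | h t =>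
    induction g using Tm.Cls.ind with | h s =>
    exact Tm.Cls.sound ((Tm.Eqv.unit_eta t).trans (Tm.Eqv.unit_eta s).symm)
  prod A B := ⟨.prod A.ty B.ty⟩
  fst A B := Tm.Cls.mk (.fst (.var .zero))
  snd A B := Tm.Cls.mk (.snd (.var .zero))
  pair f g := Tm.Cls.map₂ Tm.pair (fun _ _ _ _ h h' => .pair_congr h h') f g
  pair_fst f g := by
    induction f using Tm.Cls.ind with | h t =>
    induction g using Tm.Cls.ind with | h s =>
    exact Tm.Cls.sound (.fst_beta t s)
  pair_snd f g := by
    induction f using Tm.Cls.ind with | h t =>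
    induction g using Tm.Cls.ind with | h s =>
    exact Tm.Cls.sound (.snd_beta t s)
  pair_eta f := by
    induction f using Tm.Cls.ind with | h t => exact Tm.Cls.sound (Tm.Eqv.pair_eta t).symm
  exp A B := ⟨.fn A.ty B.ty⟩
  ev A B := Tm.Cls.mk (.app (.snd (.var .zero)) (.fst (.var .zero)))
  curry f := Tm.Cls.map (fun t => .lam t.split) (fun _ _ h => .lam_congr (h.plug (.refl _))) f
  curry_beta f := by
    induction f using Tm.Cls.ind with | h t => exact Tm.Cls.sound (Tm.fn_beta' t)
  curry_eta g := by
    induction g using Tm.Cls.ind with | h t => exact Tm.Cls.sound (Tm.fn_eta' t)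

/-- The locally indexed category `LSyn : CSynᵒᵖ ⥤ Cat`: the objects of `LSyn A` are the linear
types, and its morphisms `S ⟶ T` are the terms `x : A; v : S ⊢ t : T` up to `βη+`-equivalence. The
composition of `t` and `s` is `s[t/v]`, that is, `let v = t in s`; reindexing is substitution for
the Cartesian variable. -/
def LSyn (Op : Ctx ℕ → ℕ → Type u) (LOp : Ctx ℕ → Ctx ℕ → Ctx ℕ → Type v) :
    LocIdx (CSyn Op LOp) where
  Obj := LTy
  Hom A S T := Tm.Cls Op LOp A.ty (.lin S T)
  id A S := .mk .lvar
  comp f g := Tm.Cls.map₂ (fun t s => s.lsubst t) (fun _ _ _ _ h h' => h'.lsubst h) f g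
  id_comp f := by
    induction f using Tm.Cls.ind with | h t => exact congrArg Tm.Cls.mk (Tm.lsubst_lvar t)
  comp_id f := by induction f using Tm.Cls.ind with | h t => rfl
  assoc f g h := by
    induction f using Tm.Cls.ind with | h t =>
    induction g using Tm.Cls.ind with | h s =>
    induction h using Tm.Cls.ind with | h r =>
    exact congrArg Tm.Cls.mk (Tm.lsubst_lsubst r s t).symm
  re a _ _ f := Tm.Cls.map₂ (fun t s => s.plug t) (fun _ _ _ _ h h' => h'.plug h) a f
  re_idm a S := by induction a using Tm.Cls.ind with | h t => rfl
  re_compm a _ _ _ f g := by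
    induction a using Tm.Cls.ind with | h r =>
    induction f using Tm.Cls.ind with | h t =>
    induction g using Tm.Cls.ind with | h s =>
    exact congrArg Tm.Cls.mk (Tm.lsubst_subst s t _)
  re_id f := by
    induction f using Tm.Cls.ind with | h t => exact congrArg Tm.Cls.mk (Tm.plug_var t)
  re_comp a b _ _ f := by
    induction a using Tm.Cls.ind with | h t =>
    induction b using Tm.Cls.ind with | h s =>
    induction f using Tm.Cls.ind with | h r =>
    exact congrArg Tm.Cls.mk (Tm.plug_plug r s t).symm

/-- The structure of `LSyn` as a model of the target language. -/
def LSyn.model (Op : Ctx ℕ → ℕ → Type u) (LOp : Ctx ℕ → Ctx ℕ → Ctx ℕ → Type v) :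
    Model (CSyn.ccStr Op LOp) (LSyn Op LOp) where
  zero A S T := Tm.Cls.mk .zero
  add f g := Tm.Cls.map₂ Tm.add (fun _ _ _ _ h h' => .add_congr h h') f g
  add_zero f := by
    induction f using Tm.Cls.ind with | h t => exact Tm.Cls.sound (.add_zero t)
  add_assoc f g h := by
    induction f using Tm.Cls.ind with | h t =>
    induction g using Tm.Cls.ind with | h s =>
    induction h using Tm.Cls.ind with | h r =>
    exact Tm.Cls.sound (.add_assoc t s r)
  add_comm f g := by
    induction f using Tm.Cls.ind with | h t =>
    induction g using Tm.Cls.ind with | h s =>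
    exact Tm.Cls.sound (.add_comm t s)
  comp_zero f := by induction f using Tm.Cls.ind with | h t => rfl
  zero_comp f := by
    induction f using Tm.Cls.ind with | h t => exact Tm.Cls.sound (.lsubst_zero t)
  comp_add f g h := by
    induction f using Tm.Cls.ind with | h t =>
    induction g using Tm.Cls.ind with | h s =>
    induction h using Tm.Cls.ind with | h r =>
    rfl
  add_comp f g h := by
    induction f using Tm.Cls.ind with | h t =>
    induction g using Tm.Cls.ind with | h s =>
    induction h using Tm.Cls.ind with | h r =>
    exact Tm.Cls.sound (.lsubst_add r t s)
  re_zero a S T := by induction a using Tm.Cls.ind with | h t => rfl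
  re_add a _ _ f g := by
    induction a using Tm.Cls.ind with | h t =>
    induction f using Tm.Cls.ind with | h s =>
    induction g using Tm.Cls.ind with | h r =>
    rfl
  one := LTy.unit
  one_uniq f g := by
    induction f using Tm.Cls.ind with | h t =>
    induction g using Tm.Cls.ind with | h s =>
    exact Tm.Cls.sound ((Tm.Eqv.lunit_eta t).trans (Tm.Eqv.lunit_eta s).symm)
  prod := LTy.prod
  fst A S T := Tm.Cls.mk (.lfst .lvar)
  snd A S T := Tm.Cls.mk (.lsnd .lvar)
  pair f g := Tm.Cls.map₂ Tm.lpair (fun _ _ _ _ h h' => .lpair_congr h h') f g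
  pair_fst f g := by
    induction f using Tm.Cls.ind with | h t =>
    induction g using Tm.Cls.ind with | h s =>
    exact Tm.Cls.sound (.lfst_beta t s)
  pair_snd f g := by
    induction f using Tm.Cls.ind with | h t =>
    induction g using Tm.Cls.ind with | h s =>
    exact Tm.Cls.sound (.lsnd_beta t s)
  pair_eta f := by
    induction f using Tm.Cls.ind with | h t => exact Tm.Cls.sound (Tm.Eqv.lpair_eta t).symm
  re_fst a S T := by induction a using Tm.Cls.ind with | h t => rfl
  re_snd a S T := by induction a using Tm.Cls.ind with | h t => rfl
  pow B T := LTy.pow B.ty T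
  pev B T := Tm.Cls.mk (.papp .lvar (.var .zero))
  pcurry f := Tm.Cls.map (fun t => .plam t.split) (fun _ _ h => .plam_congr (h.plug (.refl _))) f
  pow_beta f := by
    induction f using Tm.Cls.ind with | h t =>
    exact Tm.Cls.sound (Tm.pow_beta' t)
  pow_eta g := by
    induction g using Tm.Cls.ind with | h t =>
    exact Tm.Cls.sound (Tm.pow_eta' t)
  copow B T := LTy.copow B.ty T
  cin B S := Tm.Cls.mk (.cpair (.var .zero) .lvar)
  cmatch f := Tm.Cls.map (fun t => .cmatch .lvar t.split)
    (fun _ _ h => .cmatch_congr (.refl _) (h.plug (.refl _))) f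
  copow_beta f := by
    induction f using Tm.Cls.ind with | h t =>
    exact Tm.Cls.sound (Tm.copow_beta' t)
  copow_eta g := by
    induction g using Tm.Cls.ind with | h t =>
    exact Tm.Cls.sound (Tm.copow_eta' t)
  lolli S T := ⟨CTy.lfun S T⟩
  lev S T := Tm.Cls.mk (.lfapp (.var .zero) .lvar)
  lcurry f := Tm.Cls.map .lfun (fun _ _ h => .lfun_congr h) f
  lolli_beta f := by
    induction f using Tm.Cls.ind with | h t =>
    exact Tm.Cls.sound (Tm.lfun_beta' t)
  lolli_eta g := by
    induction g using Tm.Cls.ind with | h t => exact Tm.Cls.sound (Tm.Eqv.lfun_eta t).symm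

/-- `Σ_CSyn LSyn`, the target of forward-mode CHAD. -/
abbrev Fwd (Op : Ctx ℕ → ℕ → Type u) (LOp : Ctx ℕ → Ctx ℕ → Ctx ℕ → Type v) : Type :=
  Sig (LSyn Op LOp)

/-- `Σ_CSyn LSynᵒᵖ`, the target of reverse-mode CHAD. -/
abbrev Rev (Op : Ctx ℕ → ℕ → Type u) (LOp : Ctx ℕ → Ctx ℕ → Ctx ℕ → Type v) : Type :=
  SigOp (LSyn Op LOp)

instance : CartesianMonoidalCategory (Fwd Op LOp) := (LSyn.model Op LOp).sig.cartesian
instance : MonoidalClosed (Fwd Op LOp) := (LSyn.model Op LOp).sig.closed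
instance : CartesianMonoidalCategory (Rev Op LOp) := (LSyn.model Op LOp).sigOp.cartesian
instance : MonoidalClosed (Rev Op LOp) := (LSyn.model Op LOp).sigOp.closed

end CSyn

/-! ## The code transformations -/

mutual

/-- The type `D(A)₁` of forward-mode primals. -/
def STy.fwd₁ : STy → CTy
  | .real n => .real n
  | .unit => .unit
  | .prod A B => .prod A.fwd₁ B.fwd₁
  | .fn A B => .fn A.fwd₁ (.prod B.fwd₁ (.lfun A.fwd₂ B.fwd₂))

/-- The type `D(A)₂` of forward-mode tangents. -/
def STy.fwd₂ : STy → LTy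
  | .real n => .real n
  | .unit => .unit
  | .prod A B => .prod A.fwd₂ B.fwd₂
  | .fn A B => .pow A.fwd₁ B.fwd₂

end

mutual

/-- The type of reverse-mode primals. -/
def STy.rev₁ : STy → CTy
  | .real n => .real n
  | .unit => .unit
  | .prod A B => .prod A.rev₁ B.rev₁
  | .fn A B => .fn A.rev₁ (.prod B.rev₁ (.lfun B.rev₂ A.rev₂))

/-- The type of reverse-mode cotangents. -/
def STy.rev₂ : STy → LTy
  | .real n => .real n
  | .unit => .unit
  | .prod A B => .prod A.rev₂ B.rev₂
  | .fn A B => .copow A.rev₁ B.rev₂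

end

/-- The product of a list of types of the source language. -/
abbrev STy.nprod (Γ : Ctx STy) : STy := CHAD.nprod .unit .prod Γ

/-- The product of a list of Cartesian types. -/
abbrev CTy.nprod (Γ : Ctx CTy) : CTy := CHAD.nprod .unit .prod Γ

/-- The product of a list of linear types. -/
abbrev LTy.nprod (Γ : Ctx LTy) : LTy := CHAD.nprod .unit .prod Γ

/-- The `i`-th projection out of a product. -/
def STm.proj {Op : Ctx ℕ → ℕ → Type u} {Δ : Ctx STy} : {Γ : Ctx STy} → {A : STy} → Var Γ A →
    STm Op Δ (STy.nprod Γ) → STm Op Δ A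
  | .snoc .nil _, _, .zero, t => t
  | .snoc (.snoc _ _) _, _, .zero, t => .snd t
  | .snoc (.snoc _ _) _, _, .succ i, t => STm.proj i (.fst t)

/-- The morphism `A₁ * ⋯ * Aₙ ⟶ B` of `Syn` represented by `x₁ : A₁, …, xₙ : Aₙ ⊢ t : B`. -/
def STm.hom {Op : Ctx ℕ → ℕ → Type u} {Γ : Ctx STy} {A : STy} (t : STm Op Γ A) :
    (⟨STy.nprod Γ⟩ : Syn Op) ⟶ ⟨A⟩ :=
  Cls.mk (t.subst fun _ i => .proj i (.var .zero))

/-- The morphism represented by `x₁ : ℝ^{n₁}, …, xₖ : ℝ^{nₖ} ⊢ op(x₁, …, xₖ) : ℝ^m`. -/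
def opHom {Op : Ctx ℕ → ℕ → Type u} {ns : Ctx ℕ} {m : ℕ} (o : Op ns m) :
    (⟨STy.nprod (ns.map STy.real)⟩ : Syn Op) ⟶ ⟨.real m⟩ :=
  STm.hom (.op o fun _ i => .var (i.map STy.real))

/-- Extension of a renaming by a variable for the last variable. -/
def Ren.snoc {α : Type w} {Γ Δ : Ctx α} {b : α} (ρ : Ren Γ Δ) (y : Var Δ b) : Ren (Γ.snoc b) Δ
  | _, .zero => y
  | _, .succ x => ρ _ x

/-- The renaming of the variables of the context `f a₁, …, f aₙ` given by a list of variables. -/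
def Ren.ofMap {α : Type w} {β : Type w'} (f : α → β) {Δ : Ctx β} :
    (Γ : Ctx α) → (∀ a, Var Γ a → Var Δ (f a)) → Ren (Γ.map f) Δ
  | .nil, _ => fun _ x => nomatch x
  | .snoc Γ _, xs => Ren.snoc (Ren.ofMap f Γ fun _ i => xs _ (.succ i)) (xs _ .zero)

section

variable {Γ : Ctx CTy} {a b c d e f g h : CTy}

/-- The variable at position `k` from the right is `Var.vₖ`. -/
abbrev Var.v₀ : Var (Γ.snoc a) a := .zero
abbrev Var.v₁ : Var ((Γ.snoc a).snoc b) a := .succ .v₀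
abbrev Var.v₂ : Var (((Γ.snoc a).snoc b).snoc c) a := .succ .v₁
abbrev Var.v₃ : Var ((((Γ.snoc a).snoc b).snoc c).snoc d) a := .succ .v₂
abbrev Var.v₄ : Var (((((Γ.snoc a).snoc b).snoc c).snoc d).snoc e) a := .succ .v₃
abbrev Var.v₅ : Var ((((((Γ.snoc a).snoc b).snoc c).snoc d).snoc e).snoc f) a := .succ .v₄
abbrev Var.v₆ : Var (((((((Γ.snoc a).snoc b).snoc c).snoc d).snoc e).snoc f).snoc g) a :=
  .succ .v₅
abbrev Var.v₇ : Var ((((((((Γ.snoc a).snoc b).snoc c).snoc d).snoc e).snoc f).snoc g).snoc h) a :=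
  .succ .v₆

end

namespace Tm

variable {Op : Ctx ℕ → ℕ → Type u} {LOp : Ctx ℕ → Ctx ℕ → Ctx ℕ → Type v}

/-- The `i`-th projection out of a product of Cartesian types. -/
def proj {Δ : Ctx CTy} : {Γ : Ctx CTy} → {A : CTy} → Var Γ A →
    Tm Op LOp Δ (.val (CTy.nprod Γ)) → Tm Op LOp Δ (.val A)
  | .snoc .nil _, _, .zero, t => t
  | .snoc (.snoc _ _) _, _, .zero, t => .snd t
  | .snoc (.snoc _ _) _, _, .succ i, t => proj i (.fst t)

/-- The equivalence class represented by a term in the context `x₁ : A₁, …, xₙ : Aₙ`, with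
a single Cartesian variable of type `A₁ * ⋯ * Aₙ`. -/
def cls {Γ : Ctx CTy} {J : Jdg} (t : Tm Op LOp Γ J) : Cls Op LOp (CTy.nprod Γ) J :=
  Cls.mk (t.subst fun _ i => proj i (.var .zero))

section

variable {ι : Type} {Δ : Ctx CTy} {S T : LTy}

/-- The `i`-th projection out of a product of linear types. -/
def lproj (f : ι → LTy) : {Γ : Ctx ι} → {a : ι} → Var Γ a →
    Tm Op LOp Δ (.lin S (LTy.nprod (Γ.map f))) → Tm Op LOp Δ (.lin S (f a))
  | .snoc .nil _, _, .zero, t => t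
  | .snoc (.snoc _ _) _, _, .zero, t => .lsnd t
  | .snoc (.snoc _ _) _, _, .succ i, t => lproj f i (.lfst t)

/-- The tuple `⟨t₁, …, tₙ⟩`. -/
def ltuple (f : ι → LTy) : (Γ : Ctx ι) → (∀ a, Var Γ a → Tm Op LOp Δ (.lin S (f a))) →
    Tm Op LOp Δ (.lin S (LTy.nprod (Γ.map f)))
  | .nil, _ => .lunit
  | .snoc .nil _, ts => ts _ .zero
  | .snoc (.snoc _ _) _, ts => .lpair (ltuple f _ fun _ i => ts _ (.succ i)) (ts _ .zero)

/-- The `i`-th coprojection `⟨0, …, 0, t, 0, …, 0⟩`. -/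
def lcoproj (f : ι → LTy) : {Γ : Ctx ι} → {a : ι} → Var Γ a → Tm Op LOp Δ (.lin S (f a)) →
    Tm Op LOp Δ (.lin S (LTy.nprod (Γ.map f)))
  | .snoc .nil _, _, .zero, t => t
  | .snoc (.snoc Γ b) _, _, .zero, t => .lpair (ltuple f (.snoc Γ b) fun _ _ => .zero) t
  | .snoc (.snoc _ _) _, _, .succ i, t => .lpair (lcoproj f i t) .zero

/-- The sum `t₁ + ⋯ + tₙ`. -/
def lsum : (Γ : Ctx ι) → (∀ a, Var Γ a → Tm Op LOp Δ (.lin S T)) → Tm Op LOp Δ (.lin S T)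
  | .nil, _ => .zero
  | .snoc .nil _, ts => ts _ .zero
  | .snoc (.snoc _ _) _, ts => .add (lsum _ fun _ i => ts _ (.succ i)) (ts _ .zero)

/-- `⟨t, s⟩`, as a term of type `(f a₁ * ⋯ * f aₙ) * f a`; for `n = 0`, this is `s : f a`. -/
def ctxPair (f : ι → LTy) : (Γ : Ctx ι) → {a : ι} → Tm Op LOp Δ (.lin S (LTy.nprod (Γ.map f))) →
    Tm Op LOp Δ (.lin S (f a)) → Tm Op LOp Δ (.lin S (LTy.nprod ((Γ.snoc a).map f)))
  | .nil, _, _, s => s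
  | .snoc _ _, _, t, s => .lpair t s

/-- `fst t`, for `t` of type `(f a₁ * ⋯ * f aₙ) * f a`; for `n = 0`, this is `⟨⟩`. -/
def ctxFst (f : ι → LTy) : (Γ : Ctx ι) → {a : ι} →
    Tm Op LOp Δ (.lin S (LTy.nprod ((Γ.snoc a).map f))) →
    Tm Op LOp Δ (.lin S (LTy.nprod (Γ.map f)))
  | .nil, _, _ => .lunit
  | .snoc _ _, _, t => .lfst t

/-- `snd t`, for `t` of type `(f a₁ * ⋯ * f aₙ) * f a`; for `n = 0`, this is `t`. -/
def ctxSnd (f : ι → LTy) : (Γ : Ctx ι) → {a : ι} →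
    Tm Op LOp Δ (.lin S (LTy.nprod ((Γ.snoc a).map f))) → Tm Op LOp Δ (.lin S (f a))
  | .nil, _, t => t
  | .snoc _ _, _, t => .lsnd t

end

/-- `let ⟨x, y⟩ = t in s`, that is, `let z = t in let x = fst z in let y = snd z in s`. -/
def plet {Γ : Ctx CTy} {A B : CTy} {J : Jdg} (t : Tm Op LOp Γ (.val (.prod A B)))
    (s : Tm Op LOp (((Γ.snoc (.prod A B)).snoc A).snoc B) J) : Tm Op LOp Γ J :=
  .letin t (.letin (.fst (.var .v₀)) (.letin (.snd (.var .v₁)) s))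

/-- Weakening by the three variables bound by `plet`. -/
def wk₃ {Γ : Ctx CTy} {J : Jdg} {A B D : CTy} (t : Tm Op LOp Γ J) :
    Tm Op LOp (((Γ.snoc A).snoc B).snoc D) J := ((t.wk A).wk B).wk D

/-- A term in the context `Γ, x`, with `x` the second of the three variables bound by `plet`. -/
def wkLet {Γ : Ctx CTy} {J : Jdg} {A B D : CTy} (t : Tm Op LOp (Γ.snoc B) J) :
    Tm Op LOp (((Γ.snoc A).snoc B).snoc D) J :=
  t.rename (Ren.snoc (fun _ x => .succ (.succ (.succ x))) .v₁)

/-- The context of `s` in `let ⟨x₁, x₁'⟩ = t₁ in ⋯ let ⟨xₖ, xₖ'⟩ = tₖ in s`, with `xᵢ : ℝ^{nᵢ}` and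
`xᵢ' : f nᵢ`. -/
def letsCtx (f : ℕ → CTy) (Γ : Ctx CTy) : Ctx ℕ → Ctx CTy
  | .nil => Γ
  | .snoc ns n => (((letsCtx f Γ ns).snoc (.prod (.real n) (f n))).snoc (.real n)).snoc (f n)

/-- Weakening by the variables of `letsCtx`. -/
def letsRen (f : ℕ → CTy) (Γ : Ctx CTy) : (ns : Ctx ℕ) → Ren Γ (letsCtx f Γ ns)
  | .nil => fun _ x => x
  | .snoc ns _ => fun _ x => .succ (.succ (.succ (letsRen f Γ ns _ x)))

/-- The variable `xᵢ`. -/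
def letsVar (f : ℕ → CTy) (Γ : Ctx CTy) : {ns : Ctx ℕ} → {n : ℕ} → Var ns n →
    Var (letsCtx f Γ ns) (.real n)
  | _, _, .zero => .v₁
  | _, _, .succ i => .succ (.succ (.succ (letsVar f Γ i)))

/-- The variable `xᵢ'`. -/
def letsVar' (f : ℕ → CTy) (Γ : Ctx CTy) : {ns : Ctx ℕ} → {n : ℕ} → Var ns n →
    Var (letsCtx f Γ ns) (f n)
  | _, _, .zero => .v₀
  | _, _, .succ i => .succ (.succ (.succ (letsVar' f Γ i)))

/-- `let ⟨x₁, x₁'⟩ = t₁ in ⋯ let ⟨xₖ, xₖ'⟩ = tₖ in s`. -/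
def lets (f : ℕ → CTy) (Γ : Ctx CTy) {J : Jdg} : (ns : Ctx ℕ) →
    (∀ n, Var ns n → Tm Op LOp Γ (.val (.prod (.real n) (f n)))) →
    Tm Op LOp (letsCtx f Γ ns) J → Tm Op LOp Γ J
  | .nil, _, s => s
  | .snoc ns _, ts, s =>
    lets f Γ ns (fun _ i => ts _ (.succ i)) (plet ((ts _ .zero).rename (letsRen f Γ ns)) s)

end Tm

section Chad

variable {Op : Ctx ℕ → ℕ → Type u} {LOp : Ctx ℕ → Ctx ℕ → Ctx ℕ → Type v}

/-- Choices of terms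
`x₁ : ℝ^{n₁}, …, xₖ : ℝ^{nₖ}; v : ℝ^{n₁} * ⋯ * ℝ^{nₖ} ⊢ Dop(x₁, …, xₖ; v) : ℝ^m`. -/
abbrev Der (Op : Ctx ℕ → ℕ → Type u) (LOp : Ctx ℕ → Ctx ℕ → Ctx ℕ → Type v) : Type (max u v) :=
  ∀ (ns : Ctx ℕ) (m : ℕ), Op ns m →
    Tm Op LOp (ns.map .real) (.lin (LTy.nprod (ns.map .real)) (.real m))

/-- Choices of terms
`x₁ : ℝ^{n₁}, …, xₖ : ℝ^{nₖ}; v : ℝ^m ⊢ Dopᵀ(x₁, …, xₖ; v) : ℝ^{n₁} * ⋯ * ℝ^{nₖ}`. -/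
abbrev DerT (Op : Ctx ℕ → ℕ → Type u) (LOp : Ctx ℕ → Ctx ℕ → Ctx ℕ → Type v) : Type (max u v) :=
  ∀ (ns : Ctx ℕ) (m : ℕ), Op ns m →
    Tm Op LOp (ns.map .real) (.lin (.real m) (LTy.nprod (ns.map .real)))

/-- The forward-mode code transformation `D(Γ)₁ ⊢ D[t] : D(A)₁ * (D(Γ)₂ ⊸ D(A)₂)` of a term
`Γ ⊢ t : A`. -/
def STm.fwd (dop : Der Op LOp) : {Γ : Ctx STy} → {A : STy} → STm Op Γ A →
    Tm Op LOp (Γ.map STy.fwd₁)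
      (.val (.prod A.fwd₁ (.lfun (LTy.nprod (Γ.map STy.fwd₂)) A.fwd₂)))
  -- `⟨x, λ v. projₓ v⟩`
  | _, _, .var x => .pair (.var (x.map _)) (.lfun (.lproj _ x .lvar))
  -- `let ⟨x, x'⟩ = D[t] in let ⟨y, y'⟩ = D[s] in ⟨y, λ v. y' • ⟨v, x' • v⟩⟩`
  | Γ, _, .letin t s =>
    .plet (t.fwd dop) (.plet (s.fwd dop).wkLet (.pair (.var .v₁)
      (.lfun (.lfapp (.var .v₀) (.ctxPair _ Γ .lvar (.lfapp (.var .v₃) .lvar))))))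
  -- `let ⟨x₁, x₁'⟩ = D[t₁] in ⋯ ⟨op(x₁, …, xₖ), λ v. Dop(x₁, …, xₖ; ⟨x₁' • v, …, xₖ' • v⟩)⟩`
  | Γ, _, .op (ns := ns) (m := m) o ts =>
    .lets (fun n => .lfun (LTy.nprod (Γ.map STy.fwd₂)) (.real n)) _ ns
      (fun n i => (ts n i).fwd dop)
      (.pair (.op o fun _ i => .var (Tm.letsVar _ _ i))
        (.lfun (((dop ns m o).rename (Ren.ofMap _ ns fun _ i => Tm.letsVar _ _ i)).lsubst
          (.ltuple LTy.real ns fun _ i => .lfapp (.var (Tm.letsVar' _ _ i)) .lvar))))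
  -- `⟨⟨⟩, λ v. ⟨⟩⟩`
  | _, _, .unit => .pair .unit (.lfun .lunit)
  -- `let ⟨x, x'⟩ = D[t] in let ⟨y, y'⟩ = D[s] in ⟨⟨x, y⟩, λ v. ⟨x' • v, y' • v⟩⟩`
  | _, _, .pair t s =>
    .plet (t.fwd dop) (.plet (s.fwd dop).wk₃ (.pair (.pair (.var .v₄) (.var .v₁))
      (.lfun (.lpair (.lfapp (.var .v₃) .lvar) (.lfapp (.var .v₀) .lvar)))))
  -- `let ⟨x, x'⟩ = D[t] in ⟨fst x, λ v. fst (x' • v)⟩`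
  | _, _, .fst t =>
    .plet (t.fwd dop) (.pair (.fst (.var .v₁)) (.lfun (.lfst (.lfapp (.var .v₀) .lvar))))
  -- `let ⟨x, x'⟩ = D[t] in ⟨snd x, λ v. snd (x' • v)⟩`
  | _, _, .snd t =>
    .plet (t.fwd dop) (.pair (.snd (.var .v₁)) (.lfun (.lsnd (.lfapp (.var .v₀) .lvar))))
  -- `let y = λ x. D[t] in`
  -- `⟨λ x. let ⟨z, z'⟩ = y x in ⟨z, λ v. z' • ⟨0, v⟩⟩, λ v. λ x. snd (y x) • ⟨v, 0⟩⟩`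
  | Γ, _, .lam t =>
    .letin (.lam (t.fwd dop)) (.pair
      (.lam (.plet (.app (.var .v₁) (.var .v₀)) (.pair (.var .v₁)
        (.lfun (.lfapp (.var .v₀) (.ctxPair _ Γ .zero .lvar))))))
      (.lfun (.plam (.lfapp (.snd (.app (.var .v₁) (.var .v₀))) (.ctxPair _ Γ .lvar .zero)))))
  -- `let ⟨x, x'⟩ = D[t] in let ⟨y, y'⟩ = D[s] in let ⟨z, z'⟩ = x y in`
  -- `⟨z, λ v. (x' • v) y + z' • (y' • v)⟩`
  | _, _, .app t s =>
    .plet (t.fwd dop) (.plet (s.fwd dop).wk₃ (.plet (.app (.var .v₄) (.var .v₁))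
      (.pair (.var .v₁) (.lfun (.add (.papp (.lfapp (.var .v₆) .lvar) (.var .v₄))
        (.lfapp (.var .v₀) (.lfapp (.var .v₃) .lvar)))))))

/-- The reverse-mode code transformation of a term `Γ ⊢ t : A`. -/
def STm.rev (dopT : DerT Op LOp) : {Γ : Ctx STy} → {A : STy} → STm Op Γ A →
    Tm Op LOp (Γ.map STy.rev₁)
      (.val (.prod A.rev₁ (.lfun A.rev₂ (LTy.nprod (Γ.map STy.rev₂)))))
  -- `⟨x, λ v. coprojₓ v⟩`
  | _, _, .var x => .pair (.var (x.map _)) (.lfun (.lcoproj _ x .lvar))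
  -- `let ⟨x, x'⟩ = D[t] in let ⟨y, y'⟩ = D[s] in ⟨y, λ v. let v = y' • v in fst v + x' • snd v⟩`
  | Γ, _, .letin t s =>
    .plet (t.rev dopT) (.plet (s.rev dopT).wkLet (.pair (.var .v₁)
      (.lfun (.llet (.lfapp (.var .v₀) .lvar)
        (.add (.ctxFst _ Γ .lvar) (.lfapp (.var .v₃) (.ctxSnd _ Γ .lvar)))))))
  -- `let ⟨x₁, x₁'⟩ = D[t₁] in ⋯ ⟨op(x₁, …, xₖ),`
  -- `λ v. let v = Dopᵀ(x₁, …, xₖ; v) in x₁' • proj₁ v + ⋯ + xₖ' • projₖ v⟩`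
  | Γ, _, .op (ns := ns) (m := m) o ts =>
    .lets (fun n => .lfun (.real n) (LTy.nprod (Γ.map STy.rev₂))) _ ns
      (fun n i => (ts n i).rev dopT)
      (.pair (.op o fun _ i => .var (Tm.letsVar _ _ i))
        (.lfun (.llet ((dopT ns m o).rename (Ren.ofMap _ ns fun _ i => Tm.letsVar _ _ i))
          (.lsum ns fun _ i => .lfapp (.var (Tm.letsVar' _ _ i)) (.lproj LTy.real i .lvar)))))
  -- `⟨⟨⟩, λ v. 0⟩`
  | _, _, .unit => .pair .unit (.lfun .zero)
  -- `let ⟨x, x'⟩ = D[t] in let ⟨y, y'⟩ = D[s] in ⟨⟨x, y⟩, λ v. x' • fst v + y' • snd v⟩`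
  | _, _, .pair t s =>
    .plet (t.rev dopT) (.plet (s.rev dopT).wk₃ (.pair (.pair (.var .v₄) (.var .v₁))
      (.lfun (.add (.lfapp (.var .v₃) (.lfst .lvar)) (.lfapp (.var .v₀) (.lsnd .lvar))))))
  -- `let ⟨x, x'⟩ = D[t] in ⟨fst x, λ v. x' • ⟨v, 0⟩⟩`
  | _, _, .fst t =>
    .plet (t.rev dopT) (.pair (.fst (.var .v₁))
      (.lfun (.lfapp (.var .v₀) (.lpair .lvar .zero))))
  -- `let ⟨x, x'⟩ = D[t] in ⟨snd x, λ v. x' • ⟨0, v⟩⟩`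
  | _, _, .snd t =>
    .plet (t.rev dopT) (.pair (.snd (.var .v₁))
      (.lfun (.lfapp (.var .v₀) (.lpair .zero .lvar))))
  -- `let y = λ x. D[t] in ⟨λ x. let ⟨z, z'⟩ = y x in ⟨z, λ v. snd (z' • v)⟩,`
  -- `λ v. case v of !x ⊗ v → fst (snd (y x) • v)⟩`
  | Γ, _, .lam t =>
    .letin (.lam (t.rev dopT)) (.pair
      (.lam (.plet (.app (.var .v₁) (.var .v₀)) (.pair (.var .v₁)
        (.lfun (.ctxSnd _ Γ (.lfapp (.var .v₀) .lvar))))))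
      (.lfun (.cmatch .lvar
        (.ctxFst _ Γ (.lfapp (.snd (.app (.var .v₁) (.var .v₀))) .lvar)))))
  -- `let ⟨x, x'⟩ = D[t] in let ⟨y, y'⟩ = D[s] in let ⟨z, z'⟩ = x y in`
  -- `⟨z, λ v. x' • (!y ⊗ v) + y' • (z' • v)⟩`
  | _, _, .app t s =>
    .plet (t.rev dopT) (.plet (s.rev dopT).wk₃ (.plet (.app (.var .v₄) (.var .v₁))
      (.pair (.var .v₁) (.lfun (.add (.lfapp (.var .v₆) (.cpair (.var .v₄) .lvar))
        (.lfapp (.var .v₃) (.lfapp (.var .v₀) .lvar)))))))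

/-! ## The functors determined by base types and primitive operations -/

/-- The morphism `(D[t]₁, D[t]₂)` of `Σ_CSyn LSyn` represented by the code transformation of
`Γ ⊢ t : A`, where `D[t]₁` is `fst D[t]` and `D[t]₂` is `snd D[t] • v`. -/
def STm.fwdHom (dop : Der Op LOp) {Γ : Ctx STy} {A : STy} (t : STm Op Γ A) :
    (⟨⟨CTy.nprod (Γ.map STy.fwd₁)⟩, LTy.nprod (Γ.map STy.fwd₂)⟩ : Fwd Op LOp) ⟶
      ⟨⟨A.fwd₁⟩, A.fwd₂⟩ :=
  ⟨(Tm.fst (t.fwd dop)).cls, (Tm.lfapp (.snd (t.fwd dop)) .lvar).cls⟩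

/-- The morphism of `Σ_CSyn LSynᵒᵖ` represented by the code transformation of `Γ ⊢ t : A`. -/
def STm.revHom (dopT : DerT Op LOp) {Γ : Ctx STy} {A : STy} (t : STm Op Γ A) :
    (⟨⟨CTy.nprod (Γ.map STy.rev₁)⟩, LTy.nprod (Γ.map STy.rev₂)⟩ : Rev Op LOp) ⟶
      ⟨⟨A.rev₁⟩, A.rev₂⟩ :=
  ⟨(Tm.fst (t.rev dopT)).cls, (Tm.lfapp (.snd (t.rev dopT)) .lvar).cls⟩

/-- The morphism `(op, Dop)` of `Σ_CSyn LSyn`. -/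
def fwdOp (dop : Der Op LOp) {ns : Ctx ℕ} {m : ℕ} (o : Op ns m) :
    (⟨⟨CTy.nprod (ns.map CTy.real)⟩, LTy.nprod (ns.map LTy.real)⟩ : Fwd Op LOp) ⟶
      ⟨⟨.real m⟩, .real m⟩ :=
  ⟨(Tm.op o fun _ i => .var (i.map CTy.real)).cls, (dop ns m o).cls⟩

/-- The morphism `(op, Dopᵀ)` of `Σ_CSyn LSynᵒᵖ`. -/
def revOp (dopT : DerT Op LOp) {ns : Ctx ℕ} {m : ℕ} (o : Op ns m) :
    (⟨⟨CTy.nprod (ns.map CTy.real)⟩, LTy.nprod (ns.map LTy.real)⟩ : Rev Op LOp) ⟶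
      ⟨⟨.real m⟩, .real m⟩ :=
  ⟨(Tm.op o fun _ i => .var (i.map CTy.real)).cls, (dopT ns m o).cls⟩

open MonoidalCategory in
/-- `F` is a Cartesian closed functor that sends `ℝⁿ` to `R n` and the primitive operations `op`
to `d op`. -/
structure Extends {D : Type w} [Category.{w'} D] [CartesianMonoidalCategory D] [MonoidalClosed D]
    (R : ℕ → D)
    (d : ∀ (ns : Ctx ℕ) (m : ℕ), Op ns m → (nprod (𝟙_ D) (· ⊗ ·) (ns.map R) ⟶ R m))
    (F : Syn Op ⥤ D) : Prop where
  cartesianClosed : IsCartesianClosed F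
  real (n : ℕ) : F.obj ⟨.real n⟩ = R n
  op (ns : Ctx ℕ) (m : ℕ) (o : Op ns m) : SendsTo F (opHom o) (d ns m o)

/-- `F` is forward-mode CHAD: it is Cartesian closed and sends `ℝⁿ` to `(ℝⁿ, ℝⁿ)` and `op` to
`(op, Dop)`. -/
structure IsFwd (dop : Der Op LOp) (F : Syn Op ⥤ Fwd Op LOp) : Prop where
  cartesianClosed : IsCartesianClosed F
  real (n : ℕ) : F.obj ⟨.real n⟩ = ⟨⟨.real n⟩, .real n⟩
  op (ns : Ctx ℕ) (m : ℕ) (o : Op ns m) : SendsTo F (opHom o) (fwdOp dop o)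

/-- `F` is reverse-mode CHAD: it is Cartesian closed and sends `ℝⁿ` to `(ℝⁿ, ℝⁿ)` and `op` to
`(op, Dopᵀ)`. -/
structure IsRev (dopT : DerT Op LOp) (F : Syn Op ⥤ Rev Op LOp) : Prop where
  cartesianClosed : IsCartesianClosed F
  real (n : ℕ) : F.obj ⟨.real n⟩ = ⟨⟨.real n⟩, .real n⟩
  op (ns : Ctx ℕ) (m : ℕ) (o : Op ns m) : SendsTo F (opHom o) (revOp dopT o)

end Chad

end CHAD

open MonoidalCategory CHAD

/-!
The category `Syn` is the free Cartesian closed category on the base types and the primitive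
operations, and the code transformations compute the induced functors to `Σ_CSyn LSyn` and
`Σ_CSyn LSynᵒᵖ`.

*Universal property.* Let `S` be a Cartesian closed structure on a category `D`, and let base
types and operations be interpreted in `D`. A term `Γ ⊢ t : A` is interpreted relative to an
environment, that is, a family of morphisms `X ⟶ ⟦B⟧` with one member for each variable of `Γ`
(`Semantics.interp`). Products of contexts and their associativity never enter: a binder replaces
`X` by `⟦B⟧ × X`. By soundness (`Semantics.interp_eq`) this gives a functor `Syn ⥤ D`, which is
Cartesian closed and has the prescribed values (`Semantics.extends_functor`). Conversely, a
Cartesian closed functor `F` is itself an interpretation, and by induction on `t` it sends every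
substitution instance of `t` along a substitution `σ` to the interpretation of `t` in the
environment `F ∘ σ` (`Semantics.val_subst`). Hence `F` is determined by its values on base types
and operations (`Semantics.existsUnique_extends`).

*Code transformations.* A morphism `(X₁, X₂) ⟶ (Y₁, Y₂)` is a class of pairs of terms. An
environment in `Σ_CSyn LSyn` for `Γ` is therefore given by a substitution `τ` for the context of
primals together with one linear term `L` from `X₂` to the product of the tangent types. In
`Σ_CSyn LSynᵒᵖ` it is given by `τ` and a linear term `K` from the product of the cotangent types
to `X₂`. By induction on `t`, the interpretation of `t` in this environment is
`(fst u, (snd u) • L)`, respectively `(fst u, K[(snd u) • v])`, where `u` is the code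
transformation of `t` with `τ` substituted (`interp_fwdEnv`, `interp_revEnv`). The generality in
`τ`, `L` and `K` is what makes the induction pass under binders. In reverse mode it uses linearity
of `K`, which moves `K` through the sums and copower eliminations in the transformed code.
Projections as environment give the morphism represented by the code transformation
(`sendsTo_fwdHom`, `sendsTo_revHom`).

*Equivalence.* Equivalent terms represent the same morphism of `Syn`, so their transforms
represent the same morphism. A morphism represented by `u` determines `fst u` and `(snd u) • v` up
to equivalence (`Tm.Eqv.of_cls_eq`), and these determine `u` by the `η`-laws
(`Tm.Eqv.of_fst_of_lfapp_snd`).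
-/

namespace CHAD

/-! ### Finite products in a category with chosen products -/

namespace CCStr

variable {D : Type w} [Category.{w'} D] (S : CCStr D) {ι : Type} (R : ι → D)

/-- The tuple `⟨f₁, …, fₙ⟩`. -/
def tuple {X : D} : (Γ : Ctx ι) → (∀ a, Var Γ a → (X ⟶ R a)) →
    (X ⟶ nprod S.one S.prod (Γ.map R))
  | .nil, _ => S.bang X
  | .snoc .nil _, fs => fs _ .zero
  | .snoc (.snoc _ _) _, fs => S.pair (tuple _ fun _ i => fs _ (.succ i)) (fs _ .zero)

/-- The `i`-th projection out of a finite product. -/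
def nproj : {Γ : Ctx ι} → {a : ι} → Var Γ a → (nprod S.one S.prod (Γ.map R) ⟶ R a)
  | .snoc .nil _, _, .zero => 𝟙 _
  | .snoc (.snoc _ _) _, _, .zero => S.snd _ _
  | .snoc (.snoc _ _) _, _, .succ i => S.fst _ _ ≫ nproj i

theorem comp_tuple {X Y : D} (e : Y ⟶ X) (Γ : Ctx ι) (fs : ∀ a, Var Γ a → (X ⟶ R a)) :
    e ≫ S.tuple R Γ fs = S.tuple R Γ fun _ i => e ≫ fs _ i := by
  induction Γ with
  | nil => exact S.bang_uniq _ _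
  | snoc Γ a ih =>
    cases Γ with
    | nil => rfl
    | snoc Γ b => exact (S.comp_pair _ _ _).trans (congrArg (S.pair · _) (ih _))

theorem tuple_nproj {X : D} (Γ : Ctx ι) (h : X ⟶ nprod S.one S.prod (Γ.map R)) :
    S.tuple R Γ (fun _ i => h ≫ S.nproj R i) = h := by
  induction Γ with
  | nil => exact S.bang_uniq _ _
  | snoc Γ a ih =>
    cases Γ with
    | nil => exact Category.comp_id h
    | snoc Γ b =>
      refine Eq.trans (congrArg (S.pair · _) (Eq.trans ?_ (ih (h ≫ S.fst _ _)))) (S.pair_eta h)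
      congr 1
      funext c i
      exact (Category.assoc _ _ _).symm

/-- Morphisms into an exponential agree if their uncurryings do. -/
theorem curry_ext {A X B : D} {f g : X ⟶ S.exp A B}
    (h : S.pair (S.fst A X) (S.snd A X ≫ f) ≫ S.ev A B =
      S.pair (S.fst A X) (S.snd A X ≫ g) ≫ S.ev A B) : f = g := by
  rw [← S.curry_eta f, ← S.curry_eta g, h]

theorem pair_curry_ev {A X Y B : D} (f : S.prod A X ⟶ B) (a : Y ⟶ A) (x : Y ⟶ X) :
    S.pair a (x ≫ S.curry f) ≫ S.ev A B = S.pair a x ≫ f := by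
  conv_rhs => rw [← S.curry_beta f, ← Category.assoc, S.comp_pair, S.pair_fst, ← Category.assoc,
    S.pair_snd]

theorem comp_curry {A X Y B : D} (e : Y ⟶ X) (f : S.prod A X ⟶ B) :
    e ≫ S.curry f = S.curry (S.pair (S.fst A Y) (S.snd A Y ≫ e) ≫ f) := by
  apply S.curry_ext
  rw [← Category.assoc, S.pair_curry_ev, S.curry_beta]

end CCStr

/-! ### Interpretations of the source language -/

/-- An interpretation of the types and the primitive operations of the source language in a
category with chosen products and exponentials. The structure is preserved up to equality of
objects, rather than by definition of `obj`, so that `obj` can be given by any convenient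
formula. -/
structure Semantics (Op : Ctx ℕ → ℕ → Type u) {D : Type w} [Category.{w'} D] (S : CCStr D) where
  obj : STy → D
  obj_unit : obj .unit = S.one
  obj_prod (A B : STy) : obj (.prod A B) = S.prod (obj A) (obj B)
  obj_fn (A B : STy) : obj (.fn A B) = S.exp (obj A) (obj B)
  op (ns : Ctx ℕ) (m : ℕ) : Op ns m →
    (nprod S.one S.prod (ns.map fun n => obj (.real n)) ⟶ obj (.real m))

namespace Semantics

variable {Op : Ctx ℕ → ℕ → Type u} {D : Type w} [Category.{w'} D] {S : CCStr D}
  (M : Semantics Op S)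

/-- Environments: families of morphisms `X ⟶ ⟦A⟧`, one for each variable `x : A` of `Γ`. -/
abbrev Env (X : D) (Γ : Ctx STy) : Type w' := ∀ A, Var Γ A → (X ⟶ M.obj A)

/-- Extension of an environment by a value of the last variable. -/
def Env.snoc {M : Semantics Op S} {X : D} {Γ : Ctx STy} {B : STy} (ρ : M.Env X Γ)
    (f : X ⟶ M.obj B) : M.Env X (Γ.snoc B)
  | _, .zero => f
  | _, .succ x => ρ _ x

/-- Precomposition of an environment with a morphism. -/
def Env.comp {M : Semantics Op S} {X Y : D} {Γ : Ctx STy} (e : Y ⟶ X) (ρ : M.Env X Γ) :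
    M.Env Y Γ := fun _ x => e ≫ ρ _ x

/-- An environment, extended under a binder. -/
def Env.lift {M : Semantics Op S} {X : D} {Γ : Ctx STy} (ρ : M.Env X Γ) (B : STy) :
    M.Env (S.prod (M.obj B) X) (Γ.snoc B) := (ρ.comp (S.snd _ _)).snoc (S.fst _ _)

/-- The interpretation `⟦t⟧ρ : X ⟶ ⟦A⟧` of a term `Γ ⊢ t : A` in an environment. Products of
contexts do not occur: a variable is interpreted by the morphism which the environment assigns
to it. -/
def interp : {Γ : Ctx STy} → {A : STy} → {X : D} → M.Env X Γ → STm Op Γ A → (X ⟶ M.obj A)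
  | _, _, _, ρ, .var x => ρ _ x
  | _, _, _, ρ, .letin t s => interp (ρ.snoc (interp ρ t)) s
  | _, _, _, ρ, .op o ts =>
    S.tuple (fun n => M.obj (.real n)) _ (fun n i => interp ρ (ts n i)) ≫ M.op _ _ o
  | _, _, X, _, .unit => S.bang X ≫ eqToHom M.obj_unit.symm
  | _, _, _, ρ, .pair t s => S.pair (interp ρ t) (interp ρ s) ≫ eqToHom (M.obj_prod _ _).symm
  | _, _, _, ρ, .fst t => interp ρ t ≫ eqToHom (M.obj_prod _ _) ≫ S.fst _ _
  | _, _, _, ρ, .snd t => interp ρ t ≫ eqToHom (M.obj_prod _ _) ≫ S.snd _ _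
  | _, _, _, ρ, .lam t => S.curry (interp (ρ.lift _) t) ≫ eqToHom (M.obj_fn _ _).symm
  | _, _, _, ρ, .app t s => S.pair (interp ρ s) (interp ρ t ≫ eqToHom (M.obj_fn _ _)) ≫ S.ev _ _

theorem Env.comp_snoc {M : Semantics Op S} {X Y : D} {Γ : Ctx STy} {B : STy} (e : Y ⟶ X)
    (ρ : M.Env X Γ) (f : X ⟶ M.obj B) : Env.comp e (ρ.snoc f) = (Env.comp e ρ).snoc (e ≫ f) := by
  funext A x; cases x <;> rfl

theorem Env.comp_lift {M : Semantics Op S} {X Y : D} {Γ : Ctx STy} (e : Y ⟶ X)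
    (ρ : M.Env X Γ) (B : STy) :
    (Env.comp e ρ).lift B =
      Env.comp (S.pair (S.fst (M.obj B) Y) (S.snd (M.obj B) Y ≫ e)) (ρ.lift B) := by
  funext A x
  cases x
  · exact (S.pair_fst _ _).symm
  · simp only [Env.lift, Env.snoc, Env.comp]
    rw [← Category.assoc _ (S.snd _ _), S.pair_snd, Category.assoc]

/-- Naturality of the interpretation in the stage `X` of the environment. -/
theorem comp_interp {Γ : Ctx STy} {A : STy} {X Y : D} (e : Y ⟶ X) (ρ : M.Env X Γ)
    (t : STm Op Γ A) : e ≫ M.interp ρ t = M.interp (ρ.comp e) t := by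
  induction t generalizing X Y with
  | var x => rfl
  | letin t s iht ihs => simp only [interp, ihs, Env.comp_snoc, iht]
  | op o ts ih => simp only [interp, ← Category.assoc, S.comp_tuple, ih]
  | unit => simp only [interp, ← Category.assoc, S.bang_uniq (e ≫ S.bang _) (S.bang _)]
  | pair t s iht ihs => simp only [interp, ← Category.assoc, S.comp_pair, iht, ihs]
  | fst t ih => simp only [interp, ← Category.assoc, ih]
  | snd t ih => simp only [interp, ← Category.assoc, ih]
  | lam t ih => simp only [interp, ← Category.assoc, S.comp_curry, ih, Env.comp_lift]
  | app t s iht ihs => simp only [interp, ← Category.assoc, S.comp_pair, iht, ihs]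

theorem interp_rename {Γ Δ : Ctx STy} {A : STy} {X : D} (t : STm Op Γ A) (r : Ren Γ Δ)
    (ρ : M.Env X Δ) : M.interp ρ (t.rename r) = M.interp (fun _ x => ρ _ (r _ x)) t := by
  have key : ∀ {Γ Δ : Ctx STy} {X : D} (r : Ren Γ Δ) (ρ : M.Env X Δ) (B : STy) (f : X ⟶ M.obj B),
      (fun A x => ρ.snoc f A (r.lift B A x)) = Env.snoc (M := M) (fun _ x => ρ _ (r _ x)) f := by
    intros; funext A x; cases x <;> rfl
  induction t generalizing Δ X with
  | var x => rfl
  | letin t s iht ihs => simp only [interp, STm.rename, ihs, iht, key]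
  | op o ts ih => simp only [interp, STm.rename, ih]
  | unit => rfl
  | pair t s iht ihs => simp only [interp, STm.rename, iht, ihs]
  | fst t ih => simp only [interp, STm.rename, ih]
  | snd t ih => simp only [interp, STm.rename, ih]
  | lam t ih => simp only [interp, STm.rename, ih, Env.lift, key]; rfl
  | app t s iht ihs => simp only [interp, STm.rename, iht, ihs]

theorem interp_wk {Γ : Ctx STy} {A B : STy} {X : D} (t : STm Op Γ A) (ρ : M.Env X Γ)
    (f : X ⟶ M.obj B) : M.interp (ρ.snoc f) (t.wk B) = M.interp ρ t :=
  M.interp_rename t _ _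

theorem interp_subst {Γ Δ : Ctx STy} {A : STy} {X : D} (t : STm Op Γ A) (σ : STm.Sub Op Γ Δ)
    (ρ : M.Env X Δ) : M.interp ρ (t.subst σ) = M.interp (fun _ x => M.interp ρ (σ _ x)) t := by
  have key : ∀ {Γ Δ : Ctx STy} {X : D} (σ : STm.Sub Op Γ Δ) (ρ : M.Env X Δ) (B : STy)
      (f : X ⟶ M.obj B), (fun A x => M.interp (ρ.snoc f) (σ.lift B A x)) =
        Env.snoc (M := M) (fun _ x => M.interp ρ (σ _ x)) f := by
    intros
    funext A x
    cases x with
    | zero => rfl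
    | succ x => exact M.interp_wk _ _ _
  induction t generalizing Δ X with
  | var x => rfl
  | letin t s iht ihs => simp only [interp, STm.subst, ihs, iht, key]
  | op o ts ih => simp only [interp, STm.subst, ih]
  | unit => rfl
  | pair t s iht ihs => simp only [interp, STm.subst, iht, ihs]
  | fst t ih => simp only [interp, STm.subst, ih]
  | snd t ih => simp only [interp, STm.subst, ih]
  | lam t ih =>
    simp only [interp, STm.subst, ih, Env.lift, key]
    congr 3
    funext A x
    cases x
    · rfl
    · exact (M.comp_interp _ _ _).symm
  | app t s iht ihs => simp only [interp, STm.subst, iht, ihs]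

theorem interp_inst {Γ : Ctx STy} {A B : STy} {X : D} (s : STm Op (Γ.snoc A) B) (t : STm Op Γ A)
    (ρ : M.Env X Γ) : M.interp ρ (s.inst t) = M.interp (ρ.snoc (M.interp ρ t)) s := by
  refine (M.interp_subst _ _ _).trans (congrArg (fun ρ => M.interp ρ s) ?_)
  funext C x
  cases x <;> rfl

/-- Instantiating the variable of a binder turns `Env.lift` into `Env.snoc`. -/
theorem pair_interp_lift {Γ : Ctx STy} {A B : STy} {X : D} (ρ : M.Env X Γ) (f : X ⟶ M.obj A)
    (t : STm Op (Γ.snoc A) B) :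
    S.pair f (𝟙 X) ≫ M.interp (ρ.lift A) t = M.interp (ρ.snoc f) t := by
  refine (M.comp_interp _ _ _).trans (congrArg (fun ρ => M.interp ρ t) ?_)
  funext C x
  cases x with
  | zero => exact S.pair_fst _ _
  | succ x =>
    refine (Category.assoc _ _ _).symm.trans ?_
    rw [S.pair_snd]
    exact Category.id_comp _

/-- Soundness: interpretations respect `βη`-equivalence. -/
theorem interp_eq {Γ : Ctx STy} {A : STy} {t s : STm Op Γ A} (h : t.Eqv s) {X : D}
    (ρ : M.Env X Γ) : M.interp ρ t = M.interp ρ s := by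
  induction h generalizing X with
  | refl t => rfl
  | symm _ ih => exact (ih ρ).symm
  | trans _ _ ih₁ ih₂ => exact (ih₁ ρ).trans (ih₂ ρ)
  | letin_congr _ _ ih₁ ih₂ => simp only [interp, ih₁, ih₂]
  | op_congr o _ ih => simp only [interp, ih]
  | pair_congr _ _ ih₁ ih₂ => simp only [interp, ih₁, ih₂]
  | fst_congr _ ih => simp only [interp, ih]
  | snd_congr _ ih => simp only [interp, ih]
  | lam_congr _ ih => simp only [interp, ih]
  | app_congr _ _ ih₁ ih₂ => simp only [interp, ih₁, ih₂]
  | let_beta t s => exact (M.interp_inst _ _ _).symm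
  | unit_eta t =>
    rw [← cancel_mono (eqToHom M.obj_unit)]
    exact S.bang_uniq _ _
  | fst_beta t s => simp [interp, S.pair_fst]
  | snd_beta t s => simp [interp, S.pair_snd]
  | pair_eta t =>
    simp only [interp]
    rw [← Category.assoc, ← Category.assoc (M.interp ρ t) _ (S.snd _ _), S.pair_eta]
    simp
  | fn_beta t s =>
    simp only [interp, interp_inst, ← pair_interp_lift, Category.assoc, eqToHom_trans, eqToHom_refl,
      Category.comp_id]
    rw [← Category.id_comp (S.curry _), S.pair_curry_ev]
  | fn_eta t =>
    rw [← cancel_mono (eqToHom (M.obj_fn _ _))]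
    simp only [interp, Env.lift, interp_wk, Category.assoc, eqToHom_trans, eqToHom_refl,
      Category.comp_id]
    rw [← M.comp_interp, Category.assoc]
    exact (S.curry_eta _).symm

/-- The environment for a context with a single variable, as in morphisms of `Syn`. -/
def Env.one {M : Semantics Op S} {X : D} {A : STy} (f : X ⟶ M.obj A) : M.Env X (Ctx.nil.snoc A) :=
  Env.snoc (fun _ x => nomatch x) f

theorem Env.one_ext {M : Semantics Op S} {X : D} {A : STy} {ρ ρ' : M.Env X (Ctx.nil.snoc A)}
    (h : ρ _ .zero = ρ' _ .zero) : ρ = ρ' := by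
  funext B x
  cases x with
  | zero => exact h
  | succ x => cases x

/-- The functor given by an interpretation. -/
def functor : Syn Op ⥤ D where
  obj A := M.obj A.ty
  map {A B} f := Quot.lift (fun t => M.interp (Env.one (𝟙 (M.obj A.ty))) t)
    (fun _ _ h => M.interp_eq h _) f
  map_id A := rfl
  map_comp f g := by
    induction f using STm.Cls.ind with | h t =>
    induction g using STm.Cls.ind with | h s =>
    refine (M.interp_subst s _ _).trans (Eq.trans ?_ (M.comp_interp _ _ _).symm)
    exact congrArg (fun ρ => M.interp ρ s) (Env.one_ext (Category.comp_id _).symm)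

theorem functor_map_mk {A B : STy} (t : STm Op (Ctx.nil.snoc A) B) :
    M.functor.map (X := ⟨A⟩) (Y := ⟨B⟩) (STm.Cls.mk t) = M.interp (Env.one (𝟙 (M.obj A))) t := rfl

/-- The interpretation of the product of a list of types. -/
theorem obj_nprod : (Γ : Ctx STy) →
    M.obj (STy.nprod Γ) = nprod S.one S.prod (Γ.map M.obj)
  | .nil => M.obj_unit
  | .snoc .nil _ => rfl
  | .snoc (.snoc Γ b) _ =>
    (M.obj_prod _ _).trans (congrArg (fun X => S.prod X _) (obj_nprod (.snoc Γ b)))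

theorem obj_nprod_real : (ns : Ctx ℕ) →
    M.obj (STy.nprod (ns.map STy.real)) = nprod S.one S.prod (ns.map fun n => M.obj (.real n))
  | .nil => M.obj_unit
  | .snoc .nil _ => rfl
  | .snoc (.snoc ns b) _ =>
    (M.obj_prod _ _).trans (congrArg (fun X => S.prod X _) (obj_nprod_real (.snoc ns b)))

end Semantics

/-- Projections commute with transport along an equality of the first factors. -/
theorem CCStr.fst_congr {D : Type w} [Category.{w'} D] (S : CCStr D) {P X X' Y : D} (h : X = X')
    (p : P = S.prod X Y) (p' : P = S.prod X' Y) :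
    (eqToHom p ≫ S.fst X Y) ≫ eqToHom h = eqToHom p' ≫ S.fst X' Y := by
  subst h; simp

theorem CCStr.snd_congr {D : Type w} [Category.{w'} D] (S : CCStr D) {P X X' Y : D} (h : X = X')
    (p : P = S.prod X Y) (p' : P = S.prod X' Y) :
    eqToHom p ≫ S.snd X Y = eqToHom p' ≫ S.snd X' Y := by
  subst h; simp

namespace Semantics

variable {Op : Ctx ℕ → ℕ → Type u} {D : Type w} [Category.{w'} D] {S : CCStr D}
  (M : Semantics Op S)

/-- The `i`-th projection of the language is interpreted by the `i`-th projection of `D`. -/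
theorem interp_proj {Δ : Ctx STy} {X : D} (ρ : M.Env X Δ) : {Γ : Ctx STy} → {A : STy} →
    (i : Var Γ A) → (t : STm Op Δ (STy.nprod Γ)) →
    M.interp ρ (.proj i t) = M.interp ρ t ≫ eqToHom (M.obj_nprod Γ) ≫ S.nproj M.obj i
  | .snoc .nil _, _, .zero, t => by
    refine (Category.comp_id _).symm.trans (congrArg (M.interp ρ t ≫ ·) ?_)
    exact (Category.id_comp _).symm
  | .snoc (.snoc Γ b) _, _, .zero, t =>
    congrArg (M.interp ρ t ≫ ·) (S.snd_congr (M.obj_nprod (Γ.snoc b)) _ _)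
  | .snoc (.snoc Γ b) _, _, .succ i, t => by
    refine (interp_proj ρ i (.fst t)).trans (Eq.trans (Category.assoc _ _ _) ?_)
    refine congrArg (M.interp ρ t ≫ ·) ?_
    refine Eq.trans (Category.assoc _ _ _).symm (Eq.trans ?_ (Category.assoc _ _ _))
    exact congrArg (· ≫ S.nproj _ i) (S.fst_congr (M.obj_nprod (Γ.snoc b)) _ _)

/-- The case of `interp_proj` for a product of base types. The types `STy.nprod (ns.map STy.real)`
are interpreted by iterated products indexed by `ns` itself, which `Semantics.op` refers to. -/
theorem interp_proj_real {Δ : Ctx STy} {X : D} (ρ : M.Env X Δ) : {ns : Ctx ℕ} → {n : ℕ} →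
    (i : Var ns n) → (t : STm Op Δ (STy.nprod (ns.map STy.real))) →
    M.interp ρ (.proj (i.map STy.real) t) =
      M.interp ρ t ≫ eqToHom (M.obj_nprod_real ns) ≫ S.nproj (fun n => M.obj (.real n)) i
  | .snoc .nil _, _, .zero, t => by
    refine (Category.comp_id _).symm.trans (congrArg (M.interp ρ t ≫ ·) ?_)
    exact (Category.id_comp _).symm
  | .snoc (.snoc Γ b) _, _, .zero, t =>
    congrArg (M.interp ρ t ≫ ·) (S.snd_congr (M.obj_nprod_real (Γ.snoc b)) _ _)
  | .snoc (.snoc Γ b) _, _, .succ i, t => by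
    refine (interp_proj_real ρ i (.fst t)).trans (Eq.trans (Category.assoc _ _ _) ?_)
    refine congrArg (M.interp ρ t ≫ ·) ?_
    refine Eq.trans (Category.assoc _ _ _).symm (Eq.trans ?_ (Category.assoc _ _ _))
    exact congrArg (· ≫ S.nproj _ i) (S.fst_congr (M.obj_nprod_real (Γ.snoc b)) _ _)

/-- The functor given by an interpretation sends `op` to the interpretation of `op`. -/
theorem functor_map_opHom {ns : Ctx ℕ} {m : ℕ} (o : Op ns m) :
    M.functor.map (opHom o) = eqToHom (M.obj_nprod_real ns) ≫ M.op ns m o := by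
  refine (M.functor_map_mk _).trans ?_
  refine congrArg (· ≫ M.op ns m o) ?_
  conv_rhs => rw [← S.tuple_nproj _ ns (eqToHom _)]
  congr 1
  funext n i
  exact (M.interp_proj_real _ _ _).trans (Category.id_comp _)

end Semantics

end CHAD

namespace CHAD

/-! ### Cartesian closed functors out of `Syn` -/

section

variable {C : Type u} [Category.{v} C] {D : Type w} [Category.{w'} D]

theorem SendsTo.eq {F : C ⥤ D} {X Y : C} {f : X ⟶ Y} {X' Y' : D} {g : X' ⟶ Y'}
    (h : SendsTo F f g) (hX : F.obj X = X') (hY : F.obj Y = Y') :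
    F.map f = eqToHom hX ≫ g ≫ eqToHom hY.symm := h.choose_spec.choose_spec

/-- The morphism to which a functor sends `f`, up to equality of objects, is unique. -/
theorem SendsTo.unique {F : C ⥤ D} {X Y : C} {f : X ⟶ Y} {X' Y' : D} {g g' : X' ⟶ Y'}
    (h : SendsTo F f g) (h' : SendsTo F f g') : g = g' := by
  obtain ⟨hX, hY, e⟩ := h
  obtain ⟨_, _, e'⟩ := h'
  subst hX hY
  simpa using e.symm.trans e'

theorem sendsTo_eqToHom_comp {F : C ⥤ D} {X Y : C} {f : X ⟶ Y} {X' X'' Y' : D} {g : X' ⟶ Y'}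
    (h : X'' = X') : SendsTo F f (eqToHom h ≫ g) ↔ SendsTo F f g := by
  subst h; rw [eqToHom_refl, Category.id_comp]

theorem sendsTo_of_eqToHom_comp {F : C ⥤ D} {X Y : C} {f : X ⟶ Y} {X' : D} {g : X' ⟶ F.obj Y}
    (hX : F.obj X = X') (h : eqToHom hX.symm ≫ F.map f = g) : SendsTo F f g := by
  subst hX
  exact ⟨rfl, rfl, by simpa using h⟩

theorem CCStr.pair_eqToHom_left (S : CCStr D) {X Y Y' Z P : D} (f : X ⟶ Y) (g : X ⟶ Z) (h : Y = Y')
    (p : S.prod Y Z = P) (p' : S.prod Y' Z = P) :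
    S.pair f g ≫ eqToHom p = S.pair (f ≫ eqToHom h) g ≫ eqToHom p' := by
  subst h p; simp

theorem CCStr.pair_eqToHom_right (S : CCStr D) {X Y Z Z' P : D} (f : X ⟶ Y) (g : X ⟶ Z)
    (h : Z = Z') (p : S.prod Y Z = P) (p' : S.prod Y Z' = P) :
    S.pair f g ≫ eqToHom p = S.pair f (g ≫ eqToHom h) ≫ eqToHom p' := by
  subst h p; simp

theorem CCStr.pair_fst_snd (S : CCStr D) (X Y : D) : S.pair (S.fst X Y) (S.snd X Y) = 𝟙 _ := by
  simpa using S.pair_eta (𝟙 (S.prod X Y))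

/-- The evaluation of the monoidal closed structure given by `S` is that of `S`. -/
theorem CCStr.closed_ev (S : CCStr D) (X Y : D) :
    letI := S.cartesian
    letI := S.closed
    (ihom.ev X).app Y = S.ev X Y := by
  change S.pair (S.fst X _) (S.snd X _ ≫ 𝟙 _) ≫ S.ev X Y = S.ev X Y
  rw [Category.comp_id, S.pair_fst_snd, Category.id_comp]

end

namespace STm

variable {Op : Ctx ℕ → ℕ → Type u}

/-- The tuple `⟨t₁, …, tₙ⟩` of terms of base types. -/
def tuple {Δ : Ctx STy} : (ns : Ctx ℕ) → (∀ n, Var ns n → STm Op Δ (.real n)) →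
    STm Op Δ (STy.nprod (ns.map STy.real))
  | .nil, _ => .unit
  | .snoc .nil _, ts => ts _ .zero
  | .snoc (.snoc _ _) _, ts => .pair (tuple _ fun _ i => ts _ (.succ i)) (ts _ .zero)

theorem Eqv.proj {Δ Γ : Ctx STy} {A : STy} (i : Var Γ A) {t s : STm Op Δ (STy.nprod Γ)}
    (h : t.Eqv s) : (STm.proj i t).Eqv (STm.proj i s) := by
  induction Γ with
  | nil => cases i
  | snoc Γ B ih =>
    cases Γ with
    | nil =>
      cases i with
      | zero => exact h
      | succ i => cases i
    | snoc Γ D =>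
      cases i with
      | zero => exact .snd_congr h
      | succ i => exact ih i (.fst_congr h)

theorem proj_tuple {Δ : Ctx STy} {ns : Ctx ℕ} {n : ℕ} (i : Var ns n)
    (ts : ∀ n, Var ns n → STm Op Δ (.real n)) :
    (STm.proj (i.map STy.real) (tuple ns ts)).Eqv (ts n i) := by
  induction ns with
  | nil => cases i
  | snoc ns m ih =>
    cases ns with
    | nil =>
      cases i with
      | zero => exact .refl _
      | succ i => cases i
    | snoc ns k =>
      cases i with
      | zero => exact .snd_beta _ _
      | succ i => exact (Eqv.proj (i.map STy.real) (.fst_beta _ _)).trans (ih i _)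

theorem proj_subst {Δ Θ Γ : Ctx STy} {A : STy} (i : Var Γ A) (t : STm Op Δ (STy.nprod Γ))
    (σ : Sub Op Δ Θ) : (STm.proj i t).subst σ = .proj i (t.subst σ) := by
  induction Γ with
  | nil => cases i
  | snoc Γ B ih =>
    cases Γ with
    | nil =>
      cases i with
      | zero => rfl
      | succ i => cases i
    | snoc Γ D =>
      cases i with
      | zero => rfl
      | succ i => exact ih i (.fst t)

/-- Every application of a primitive operation factors through `opHom`. -/
theorem op_eqv {Δ : Ctx STy} {ns : Ctx ℕ} {m : ℕ} (o : Op ns m)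
    (ts : ∀ n, Var ns n → STm Op Δ (.real n)) :
    ((STm.op o fun _ i => .proj (i.map STy.real) (.var .zero)).plug (tuple ns ts)).Eqv
      (.op o ts) := by
  refine Eqv.op_congr o fun n i => ?_
  change ((STm.proj _ _).subst _).Eqv _
  rw [proj_subst]
  exact proj_tuple i ts

theorem subst_lift_inst {Γ Δ : Ctx STy} {A B : STy} (s : STm Op (Γ.snoc A) B) (σ : Sub Op Γ Δ)
    (t : STm Op Δ A) : (s.subst (σ.lift A)).inst t = s.subst (σ.snoc t) := by
  rw [inst, subst_subst]
  congr 1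
  funext C x
  cases x with
  | zero => rfl
  | succ x => exact wk_inst _ _

end STm

namespace Semantics

variable {Op : Ctx ℕ → ℕ → Type u} {D : Type w} [Category.{w'} D] {S : CCStr D}

/-- The functor given by an interpretation is Cartesian closed and extends the interpretation of
the base types and the primitive operations. -/
theorem extends_functor (M : Semantics Op S) :
    letI := S.cartesian
    letI := S.closed
    Extends (fun n => M.obj (.real n)) M.op M.functor := by
  let := S.cartesian
  let := S.closed
  refine ⟨⟨M.obj_unit, fun A B => M.obj_prod _ _, fun A B => ⟨M.obj_prod _ _, rfl, ?_⟩,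
    fun A B => ⟨M.obj_prod _ _, rfl, ?_⟩, fun A B => M.obj_fn _ _, fun A B =>
    ⟨(M.obj_prod _ _).trans (congrArg (S.prod _) (M.obj_fn _ _)), rfl, ?_⟩⟩, fun n => rfl,
    fun ns m o => ⟨M.obj_nprod_real ns, rfl, ?_⟩⟩
  · rw [eqToHom_refl, Category.comp_id]
    exact Category.id_comp _
  · rw [eqToHom_refl, Category.comp_id]
    exact Category.id_comp _
  · -- evaluation in `Syn` is `snd z` applied to `fst z`, for the variable `z`
    rw [eqToHom_refl, Category.comp_id]
    erw [S.closed_ev, (Syn.ccStr Op).closed_ev]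
    refine (M.functor_map_mk _).trans ?_
    simp only [interp, Env.one, Env.snoc, Category.id_comp]
    refine congrArg (· ≫ S.ev _ _) ?_
    refine Eq.trans (Category.comp_id _).symm (Eq.trans (S.pair_eqToHom_right _ _
      (M.obj_fn A.ty B.ty) (congrArg (S.prod _) (M.obj_fn A.ty B.ty)) rfl).symm ?_)
    rw [← S.comp_pair, S.pair_fst_snd, Category.comp_id, eqToHom_trans]
    rfl
  · exact (M.functor_map_opHom o).trans (congrArg (eqToHom _ ≫ ·) (Category.comp_id _).symm)

section

variable {R : ℕ → D} {d : ∀ (ns : Ctx ℕ) (m : ℕ), Op ns m →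
  (nprod S.one S.prod (ns.map R) ⟶ R m)} {F : Syn Op ⥤ D}

/-- The interpretation given by a Cartesian closed functor. -/
def ofExtends (hF : letI := S.cartesian; letI := S.closed; Extends R d F) : Semantics Op S where
  obj A := F.obj ⟨A⟩
  obj_unit := by let := S.cartesian; let := S.closed; exact hF.cartesianClosed.one
  obj_prod A B := by let := S.cartesian; let := S.closed; exact hF.cartesianClosed.prod ⟨A⟩ ⟨B⟩
  obj_fn A B := by let := S.cartesian; let := S.closed; exact hF.cartesianClosed.exp ⟨A⟩ ⟨B⟩
  op ns m o :=
    have hR : ∀ n, F.obj ⟨.real n⟩ = R n := by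
      let := S.cartesian; let := S.closed; exact hF.real
    -- `d` refers to the objects `R n`, which agree with `F (ℝⁿ)` only propositionally
    eqToHom (by rw [funext hR]) ≫ d ns m o ≫ eqToHom (hR m).symm

variable (hF : letI := S.cartesian; letI := S.closed; Extends R d F)

/-- The value of `F` at the morphism represented by a term `x : A ⊢ t : B`. -/
def val {A B : STy} (t : STm Op (Ctx.nil.snoc A) B) :
    (ofExtends hF).obj A ⟶ (ofExtends hF).obj B :=
  F.map (X := ⟨A⟩) (Y := ⟨B⟩) (STm.Cls.mk t)

theorem val_eq {A B : STy} {t s : STm Op (Ctx.nil.snoc A) B} (h : t.Eqv s) :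
    val hF t = val hF s := congrArg (F.map (X := ⟨A⟩) (Y := ⟨B⟩)) (STm.Cls.sound h)

theorem val_var (A : STy) : val hF (.var .zero) = 𝟙 ((ofExtends hF).obj A) := F.map_id _

theorem val_plug {A B C : STy} (s : STm Op (Ctx.nil.snoc B) C) (t : STm Op (Ctx.nil.snoc A) B) :
    val hF (s.plug t) = val hF t ≫ val hF s :=
  F.map_comp (X := ⟨A⟩) (Y := ⟨B⟩) (Z := ⟨C⟩) (STm.Cls.mk t) (STm.Cls.mk s)

theorem val_fst {A B Δ : STy} (t : STm Op (Ctx.nil.snoc Δ) (.prod A B)) :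
    val hF (.fst t) = val hF t ≫ eqToHom ((ofExtends hF).obj_prod A B) ≫ S.fst _ _ := by
  let := S.cartesian
  let := S.closed
  refine (val_plug hF (.fst (.var .zero)) t).trans (congrArg (val hF t ≫ ·) ?_)
  refine ((hF.cartesianClosed.fst ⟨A⟩ ⟨B⟩).eq ((ofExtends hF).obj_prod A B) rfl).trans ?_
  exact congrArg (eqToHom _ ≫ ·) (Category.comp_id _)

theorem val_snd {A B Δ : STy} (t : STm Op (Ctx.nil.snoc Δ) (.prod A B)) :
    val hF (.snd t) = val hF t ≫ eqToHom ((ofExtends hF).obj_prod A B) ≫ S.snd _ _ := by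
  let := S.cartesian
  let := S.closed
  refine (val_plug hF (.snd (.var .zero)) t).trans (congrArg (val hF t ≫ ·) ?_)
  refine ((hF.cartesianClosed.snd ⟨A⟩ ⟨B⟩).eq ((ofExtends hF).obj_prod A B) rfl).trans ?_
  exact congrArg (eqToHom _ ≫ ·) (Category.comp_id _)

theorem val_pair {A B Δ : STy} (t : STm Op (Ctx.nil.snoc Δ) A) (s : STm Op (Ctx.nil.snoc Δ) B) :
    val hF (.pair t s) =
      S.pair (val hF t) (val hF s) ≫ eqToHom ((ofExtends hF).obj_prod A B).symm := by
  rw [← cancel_mono (eqToHom ((ofExtends hF).obj_prod A B))]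
  simp only [Category.assoc, eqToHom_trans, eqToHom_refl, Category.comp_id]
  refine S.hom_ext ?_ ?_
  · rw [S.pair_fst, Category.assoc, ← val_fst, val_eq hF (.fst_beta t s)]
  · rw [S.pair_snd, Category.assoc, ← val_snd, val_eq hF (.snd_beta t s)]

theorem val_app {A B Δ : STy} (t : STm Op (Ctx.nil.snoc Δ) (.fn A B))
    (s : STm Op (Ctx.nil.snoc Δ) A) :
    val hF (.app t s) =
      S.pair (val hF s) (val hF t ≫ eqToHom ((ofExtends hF).obj_fn A B)) ≫ S.ev _ _ := by
  let := S.cartesian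
  let := S.closed
  have hev : val hF (.app (.snd (.var .zero)) (.fst (.var .zero))) =
      eqToHom (((ofExtends hF).obj_prod A (.fn A B)).trans
        (congrArg (S.prod _) ((ofExtends hF).obj_fn A B))) ≫ S.ev _ _ := by
    have h := hF.cartesianClosed.ev ⟨A⟩ ⟨B⟩
    erw [S.closed_ev, (Syn.ccStr Op).closed_ev] at h
    refine (h.eq (((ofExtends hF).obj_prod A (.fn A B)).trans
        (congrArg (S.prod _) ((ofExtends hF).obj_fn A B))) rfl).trans ?_
    exact congrArg (eqToHom _ ≫ ·) (Category.comp_id _)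
  rw [← val_eq hF (.app_congr (.snd_beta s t) (.fst_beta s t))]
  refine (val_plug hF (.app (.snd (.var .zero)) (.fst (.var .zero))) (.pair s t)).trans ?_
  rw [hev, val_pair]
  refine Eq.trans ?_ (congrArg (· ≫ S.ev _ _) (Eq.trans (S.pair_eqToHom_right _ _
    ((ofExtends hF).obj_fn A B) (congrArg (S.prod _) ((ofExtends hF).obj_fn A B)) rfl)
    (Category.comp_id _)))
  simp only [Category.assoc, eqToHom_trans_assoc]

/-- `F` commutes with `curry`, because it commutes with evaluation and `curry` is unique. -/
theorem val_curry {A B Δ : STy} (t : STm Op (Ctx.nil.snoc (.prod A Δ)) B) :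
    val hF t.curry = S.curry (eqToHom ((ofExtends hF).obj_prod A Δ).symm ≫ val hF t) ≫
        eqToHom ((ofExtends hF).obj_fn A B).symm := by
  rw [← cancel_mono (eqToHom ((ofExtends hF).obj_fn A B))]
  simp only [Category.assoc, eqToHom_trans, eqToHom_refl, Category.comp_id]
  refine S.curry_ext ?_
  have e : (STm.app (t.curry.plug (.snd (.var .zero))) (.fst (.var .zero))).Eqv t :=
    (STm.Eqv.app_congr (.snd_beta _ _) (.fst_beta _ _)).symm.trans (STm.curry_beta t)
  rw [S.curry_beta, ← val_eq hF e, val_app, val_plug, val_fst, val_snd, val_var,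
    ← Category.assoc (eqToHom _) (S.pair _ _), S.comp_pair]
  simp

theorem val_tuple {Δ : STy} : (ns : Ctx ℕ) →
    (ts : ∀ n, Var ns n → STm Op (Ctx.nil.snoc Δ) (.real n)) →
    val hF (STm.tuple ns ts) ≫ eqToHom ((ofExtends hF).obj_nprod_real ns) =
      S.tuple (fun n => (ofExtends hF).obj (.real n)) ns fun n i => val hF (ts n i)
  | .nil, _ => S.bang_uniq _ _
  | .snoc .nil _, _ => Category.comp_id _
  | .snoc (.snoc ns n) m, ts => by
    refine (congrArg (· ≫ _) (val_pair hF _ _)).trans ?_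
    refine (Category.assoc _ _ _).trans ((congrArg (S.pair _ _ ≫ ·) (eqToHom_trans _ _)).trans ?_)
    refine (S.pair_eqToHom_left _ _ ((ofExtends hF).obj_nprod_real (ns.snoc n)) _ rfl).trans ?_
    refine (Category.comp_id _).trans (congrArg (S.pair · _) ?_)
    exact val_tuple (ns.snoc n) _

theorem val_op {Δ : STy} {ns : Ctx ℕ} {m : ℕ} (o : Op ns m)
    (ts : ∀ n, Var ns n → STm Op (Ctx.nil.snoc Δ) (.real n)) :
    val hF (.op o ts) = S.tuple (fun n => (ofExtends hF).obj (.real n)) ns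
      (fun n i => val hF (ts n i)) ≫ (ofExtends hF).op ns m o := by
  let := S.cartesian
  let := S.closed
  rw [← val_eq hF (STm.op_eqv o ts), ← val_tuple hF, val_plug, Category.assoc]
  refine congrArg (val hF _ ≫ ·) ?_
  have h : nprod S.one S.prod (ns.map fun n => F.obj ⟨.real n⟩) =
      nprod S.one S.prod (ns.map R) := by rw [funext hF.real]
  refine ((hF.op ns m o).eq (((ofExtends hF).obj_nprod_real ns).trans h) (hF.real m)).trans ?_
  rw [← eqToHom_trans _ h, Category.assoc]
  rfl

/-- A Cartesian closed functor is determined by its values on the base types and the primitive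
operations: on substitution instances of `t`, it is given by the interpretation of `t`. -/
theorem val_subst {Γ : Ctx STy} {A Δ : STy} (t : STm Op Γ A)
    (σ : STm.Sub Op Γ (Ctx.nil.snoc Δ)) :
    val hF (t.subst σ) = (ofExtends hF).interp (fun B x => val hF (σ B x)) t := by
  induction t generalizing Δ with
  | var x => rfl
  | letin t s iht ihs =>
    -- the let-binding is eliminated by `β`, as `σ` may take arbitrary terms as values
    have e : ((STm.letin t s).subst σ).Eqv (s.subst (σ.snoc (t.subst σ))) := by
      rw [← STm.subst_lift_inst]
      exact .let_beta _ _
    rw [val_eq hF e, ihs, interp, ← iht]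
    congr 1
    funext B x
    cases x <;> rfl
  | op o ts ih => simp only [STm.subst, val_op, interp, ih]
  | unit =>
    rw [← cancel_mono (eqToHom (ofExtends hF).obj_unit)]
    exact S.bang_uniq _ _
  | pair t s iht ihs => simp only [STm.subst, val_pair, interp, iht, ihs]
  | fst t ih => simp only [STm.subst, val_fst, interp, ih]
  | snd t ih => simp only [STm.subst, val_snd, interp, ih]
  | app t s iht ihs => simp only [STm.subst, val_app, interp, iht, ihs]
  | @lam Γ A B t ih =>
    -- `Γ, A` is mapped to the context `z : A * Δ` by projections, to express `λ` by `curry`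
    let σ' : STm.Sub Op (Γ.snoc A) (Ctx.nil.snoc (.prod A Δ)) :=
      STm.Sub.snoc (fun _ x => (σ _ x).plug (.snd (.var .zero))) (.fst (.var .zero))
    have e : ((STm.lam t).subst σ).Eqv (t.subst σ').curry := by
      refine .lam_congr ?_
      rw [STm.plug, STm.subst_subst]
      refine STm.Eqv.subst_right t fun C x => ?_
      cases x with
      | zero => exact (STm.Eqv.fst_beta _ _).symm
      | succ x =>
        change ((σ _ x).wk A).Eqv (((σ _ x).plug _).plug _)
        rw [STm.plug_plug, ← STm.plug_var (σ _ x), STm.plug_wk, STm.plug_var]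
        exact STm.Eqv.plug (.refl _) (.symm (.snd_beta _ _))
    rw [val_eq hF e, val_curry, ih, interp, comp_interp]
    refine congrArg (fun ρ => S.curry ((ofExtends hF).interp ρ t) ≫ _) ?_
    funext C x
    rw [Env.comp, ← cancel_epi (eqToHom ((ofExtends hF).obj_prod A Δ)), eqToHom_trans_assoc,
      eqToHom_refl, Category.id_comp]
    cases x with
    | zero => exact (val_fst hF _).trans (by rw [val_var, Category.id_comp]; rfl)
    | succ x =>
      refine (val_plug hF (σ C x) (.snd (.var .zero))).trans ?_
      rw [val_snd, val_var, Category.id_comp, Category.assoc]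
      rfl

/-- A Cartesian closed functor is the functor given by the interpretation it defines. -/
theorem eq_functor : F = (ofExtends hF).functor := by
  refine CategoryTheory.Functor.ext (fun _ => rfl) fun A B f => ?_
  induction f using STm.Cls.ind with | h t =>
  refine Eq.trans ?_ ((Category.id_comp _).trans (Category.comp_id _)).symm
  refine Eq.trans ?_ ((val_subst hF t fun _ x => .var x).trans ?_)
  · rw [STm.subst_var]; rfl
  · exact congrArg (fun ρ => (ofExtends hF).interp ρ t) (Env.one_ext (F.map_id A))

end

/-- An interpretation is determined by its values on base types and primitive operations. -/
theorem ext_op {M M' : Semantics Op S} (hR : ∀ n, M.obj (.real n) = M'.obj (.real n))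
    (hop : ∀ (ns : Ctx ℕ) (m : ℕ) (o : Op ns m), M.op ns m o =
      eqToHom (by rw [funext hR]) ≫ M'.op ns m o ≫ eqToHom (hR m).symm) : M = M' := by
  have h : M.obj = M'.obj := by
    funext A
    induction A with
    | real n => exact hR n
    | unit => exact M.obj_unit.trans M'.obj_unit.symm
    | prod A B hA hB => rw [M.obj_prod, M'.obj_prod, hA, hB]
    | fn A B hA hB => rw [M.obj_fn, M'.obj_fn, hA, hB]
  obtain ⟨obj, _, _, _, op⟩ := M
  obtain ⟨obj', _, _, _, op'⟩ := M'
  obtain rfl : obj = obj' := h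
  congr 1
  funext ns m o
  simpa using hop ns m o

/-- The interpretation of types determined by the interpretation of the base types. -/
def free.obj (S : CCStr D) (R : ℕ → D) : STy → D
  | .real n => R n
  | .unit => S.one
  | .prod A B => S.prod (free.obj S R A) (free.obj S R B)
  | .fn A B => S.exp (free.obj S R A) (free.obj S R B)

/-- The interpretation with given values on base types and primitive operations. -/
def free (R : ℕ → D) (d : ∀ (ns : Ctx ℕ) (m : ℕ), Op ns m →
    (nprod S.one S.prod (ns.map R) ⟶ R m)) : Semantics Op S where
  obj := free.obj S R
  obj_unit := rfl
  obj_prod _ _ := rfl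
  obj_fn _ _ := rfl
  op := d

/-- The universal property of `Syn`. -/
theorem existsUnique_extends (S : CCStr D) (R : ℕ → D) (d : ∀ (ns : Ctx ℕ) (m : ℕ), Op ns m →
    (nprod S.one S.prod (ns.map R) ⟶ R m)) :
    letI := S.cartesian
    letI := S.closed
    ∃! F : Syn Op ⥤ D, Extends R d F := by
  refine ⟨(free R d).functor, (free R d).extends_functor, fun F hF => ?_⟩
  rw [eq_functor hF]
  let := S.cartesian
  let := S.closed
  exact congrArg functor (ext_op hF.real fun ns m o => rfl)

end Semantics

end CHAD

namespace CHAD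

/-! ### Substitution in terms of the target language -/

/-- Every position in `f a₁, …, f aₙ` is the image of a position in `a₁, …, aₙ`. -/
theorem Var.map_ind {α : Type w} {β : Type w'} {f : α → β} {Γ : Ctx α}
    {P : ∀ b, Var (Γ.map f) b → Prop} (h : ∀ a (i : Var Γ a), P (f a) (i.map f)) (b : β)
    (x : Var (Γ.map f) b) : P b x := by
  induction Γ with
  | nil => cases x
  | snoc Γ a ih =>
    cases x with
    | zero => exact h a .zero
    | succ x => exact ih (P := fun b x => P b x.succ) (fun a i => h a i.succ) x

theorem Ren.ofMap_map {α : Type w} {β : Type w'} (f : α → β) {Δ : Ctx β} {Γ : Ctx α}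
    (xs : ∀ a, Var Γ a → Var Δ (f a)) {a : α} (i : Var Γ a) :
    Ren.ofMap f Γ xs _ (i.map f) = xs a i := by
  induction i with
  | zero => rfl
  | succ i ih => exact ih _

namespace Tm

variable {Op : Ctx ℕ → ℕ → Type u} {LOp : Ctx ℕ → Ctx ℕ → Ctx ℕ → Type v}

theorem Eqv.of_eq {Γ : Ctx CTy} {J : Jdg} {t s : Tm Op LOp Γ J} (h : t = s) : t.Eqv s :=
  h ▸ .refl t

theorem subst_lift_inst {Γ Δ : Ctx CTy} {A : CTy} {J : Jdg} (s : Tm Op LOp (Γ.snoc A) J)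
    (σ : Sub Op LOp Γ Δ) (t : Tm Op LOp Δ (.val A)) :
    (s.subst (σ.lift A)).inst t = s.subst (σ.snoc t) := by
  rw [inst, subst_subst]
  congr 1
  funext C x
  cases x with
  | zero => rfl
  | succ x => exact wk_inst _ _

/-- A substituted let-binding is equivalent to the substitution extended by the bound term. -/
theorem letin_subst_eqv {Γ Δ : Ctx CTy} {A : CTy} {J : Jdg} (t : Tm Op LOp Γ (.val A))
    (s : Tm Op LOp (Γ.snoc A) J) (σ : Sub Op LOp Γ Δ) :
    ((letin t s).subst σ).Eqv (s.subst (σ.snoc (t.subst σ))) := by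
  rw [← subst_lift_inst]
  exact .let_beta _ _

/-- The substitution effected by `let ⟨x, y⟩ = u in _`. -/
def Sub.plet {Γ Δ : Ctx CTy} {A B : CTy} (σ : Sub Op LOp Γ Δ) (u : Tm Op LOp Δ (.val (.prod A B))) :
    Sub Op LOp (((Γ.snoc (.prod A B)).snoc A).snoc B) Δ :=
  ((σ.snoc u).snoc (.fst u)).snoc (.snd u)

theorem plet_subst_eqv {Γ Δ : Ctx CTy} {A B : CTy} {J : Jdg} (t : Tm Op LOp Γ (.val (.prod A B)))
    (s : Tm Op LOp (((Γ.snoc (.prod A B)).snoc A).snoc B) J) (σ : Sub Op LOp Γ Δ) :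
    ((plet t s).subst σ).Eqv (s.subst (σ.plet (t.subst σ))) :=
  (letin_subst_eqv _ _ _).trans ((letin_subst_eqv _ _ _).trans (letin_subst_eqv _ _ _))

theorem wk₃_subst {Γ Δ : Ctx CTy} {A B : CTy} {J : Jdg} (t : Tm Op LOp Γ J) (σ : Sub Op LOp Γ Δ)
    (u : Tm Op LOp Δ (.val (.prod A B))) : t.wk₃.subst (σ.plet u) = t.subst σ :=
  (subst_rename _ _ _).trans ((subst_rename _ _ _).trans (subst_rename _ _ _))

theorem wkLet_subst {Γ Δ : Ctx CTy} {A B : CTy} {J : Jdg} (t : Tm Op LOp (Γ.snoc A) J)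
    (σ : Sub Op LOp Γ Δ) (u : Tm Op LOp Δ (.val (.prod A B))) :
    t.wkLet.subst (σ.plet u) = t.subst (σ.snoc (.fst u)) := by
  rw [wkLet, subst_rename]
  congr 1
  funext C x
  cases x <;> rfl

/-- The substitution effected by `let ⟨x₁, x₁'⟩ = u₁ in ⋯ let ⟨xₖ, xₖ'⟩ = uₖ in _`. -/
def letsSub (f : ℕ → CTy) {Γ Δ : Ctx CTy} (σ : Sub Op LOp Γ Δ) : (ns : Ctx ℕ) →
    (∀ n, Var ns n → Tm Op LOp Δ (.val (.prod (.real n) (f n)))) →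
    Sub Op LOp (letsCtx f Γ ns) Δ
  | .nil, _ => σ
  | .snoc ns _, us => (letsSub f σ ns fun _ i => us _ (.succ i)).plet (us _ .zero)

section

variable (f : ℕ → CTy) {Γ Δ : Ctx CTy} (σ : Sub Op LOp Γ Δ)

theorem letsSub_ren {ns : Ctx ℕ} (us : ∀ n, Var ns n → Tm Op LOp Δ (.val (.prod (.real n) (f n))))
    {A : CTy} (x : Var Γ A) : letsSub f σ ns us A (letsRen f Γ ns A x) = σ A x := by
  induction ns with
  | nil => rfl
  | snoc ns n ih => exact ih _

theorem letsSub_var {ns : Ctx ℕ} (us : ∀ n, Var ns n → Tm Op LOp Δ (.val (.prod (.real n) (f n))))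
    {n : ℕ} (i : Var ns n) : letsSub f σ ns us _ (letsVar f Γ i) = .fst (us n i) := by
  induction i with
  | zero => rfl
  | succ i ih => exact ih _

theorem letsSub_var' {ns : Ctx ℕ} (us : ∀ n, Var ns n → Tm Op LOp Δ (.val (.prod (.real n) (f n))))
    {n : ℕ} (i : Var ns n) : letsSub f σ ns us _ (letsVar' f Γ i) = .snd (us n i) := by
  induction i with
  | zero => rfl
  | succ i ih => exact ih _

theorem lets_subst_eqv {J : Jdg} (ns : Ctx ℕ)
    (ts : ∀ n, Var ns n → Tm Op LOp Γ (.val (.prod (.real n) (f n))))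
    (s : Tm Op LOp (letsCtx f Γ ns) J) :
    ((lets f Γ ns ts s).subst σ).Eqv (s.subst (letsSub f σ ns fun n i => (ts n i).subst σ)) := by
  induction ns with
  | nil => exact .refl _
  | snoc ns n ih =>
    refine (ih _ _).trans ((plet_subst_eqv _ _ _).trans ?_)
    rw [subst_rename]
    simp only [letsSub_ren]
    exact .refl _

end

theorem app_lam_wk {Γ : Ctx CTy} {A B : CTy} (s : Tm Op LOp (Γ.snoc A) (.val B)) :
    (app ((lam s).wk A) (.var .zero)).Eqv s := by
  refine (Eqv.fn_beta _ _).trans ?_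
  rw [inst, subst_rename]
  conv_rhs => rw [← subst_var s]
  refine Eqv.subst_right s fun C x => ?_
  cases x <;> exact .refl _

/-- A substitution by terms in a variable of type `A`, extended under a binder of type `D` to one by
terms in a variable of type `D * A`. -/
def Sub.liftProd {Γ : Ctx CTy} {A : CTy} (σ : Sub Op LOp Γ (Ctx.nil.snoc A)) (D : CTy) :
    Sub Op LOp (Γ.snoc D) (Ctx.nil.snoc (.prod D A)) :=
  Sub.snoc (fun _ x => (σ _ x).plug (.snd (.var .zero))) (.fst (.var .zero))

/-- For a body `t` under a binder of type `D`, `liftProd` followed by splitting the product variable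
is the usual extension of `σ` under the binder. -/
theorem subst_split {Γ : Ctx CTy} {A D : CTy} {J : Jdg} (t : Tm Op LOp (Γ.snoc D) J)
    (σ : Sub Op LOp Γ (Ctx.nil.snoc A)) :
    (split (t.subst (σ.liftProd D))).Eqv (t.subst (σ.lift D)) := by
  rw [split, plug, subst_subst]
  refine Eqv.subst_right t fun C x => ?_
  cases x with
  | zero => exact .fst_beta _ _
  | succ x => exact split_snd _

/-! ### Tuples and projections of the target language -/

/-- The tuple `⟨t₁, …, tₙ⟩` of Cartesian terms. -/
def ctuple {Δ : Ctx CTy} : (Γ : Ctx CTy) → Sub Op LOp Γ Δ → Tm Op LOp Δ (.val (CTy.nprod Γ))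
  | .nil, _ => .unit
  | .snoc .nil _, ts => ts _ .zero
  | .snoc (.snoc _ _) _, ts => .pair (ctuple _ fun _ i => ts _ (.succ i)) (ts _ .zero)

/-- The substitution for the variables of the context `f a₁, …, f aₙ` given by a list of terms. -/
def Sub.ofMap {ι : Type} (f : ι → CTy) {Δ : Ctx CTy} : (Γ : Ctx ι) →
    (∀ a, Var Γ a → Tm Op LOp Δ (.val (f a))) → Sub Op LOp (Γ.map f) Δ
  | .nil, _ => Sub.nil Δ
  | .snoc Γ _, ts => Sub.snoc (Sub.ofMap f Γ fun _ i => ts _ (.succ i)) (ts _ .zero)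

theorem Sub.ofMap_map {ι : Type} (f : ι → CTy) {Δ : Ctx CTy} {Γ : Ctx ι}
    (ts : ∀ a, Var Γ a → Tm Op LOp Δ (.val (f a))) {a : ι} (i : Var Γ a) :
    Sub.ofMap f Γ ts _ (i.map f) = ts a i := by
  induction i with
  | zero => rfl
  | succ i ih => exact ih _

theorem Eqv.proj {Δ : Ctx CTy} {Γ : Ctx CTy} {A : CTy} (i : Var Γ A)
    {t s : Tm Op LOp Δ (.val (CTy.nprod Γ))} (h : t.Eqv s) : (Tm.proj i t).Eqv (Tm.proj i s) := by
  induction Γ with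
  | nil => cases i
  | snoc Γ B ih =>
    cases Γ with
    | nil =>
      cases i with
      | zero => exact h
      | succ i => cases i
    | snoc Γ D =>
      cases i with
      | zero => exact .snd_congr h
      | succ i => exact ih i (.fst_congr h)

theorem proj_subst {Δ Θ Γ : Ctx CTy} {A : CTy} (i : Var Γ A)
    (t : Tm Op LOp Δ (.val (CTy.nprod Γ))) (σ : Sub Op LOp Δ Θ) :
    (Tm.proj i t).subst σ = .proj i (t.subst σ) := by
  induction Γ with
  | nil => cases i
  | snoc Γ B ih =>
    cases Γ with
    | nil =>
      cases i with
      | zero => rfl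
      | succ i => cases i
    | snoc Γ D =>
      cases i with
      | zero => rfl
      | succ i => exact ih i (.fst t)

theorem proj_ctuple {Δ Γ : Ctx CTy} {A : CTy} (i : Var Γ A) (σ : Sub Op LOp Γ Δ) :
    (Tm.proj i (ctuple Γ σ)).Eqv (σ A i) := by
  induction Γ with
  | nil => cases i
  | snoc Γ B ih =>
    cases Γ with
    | nil =>
      cases i with
      | zero => exact .refl _
      | succ i => cases i
    | snoc Γ D =>
      cases i with
      | zero => exact .snd_beta _ _
      | succ i => exact (Eqv.proj i (.fst_beta _ _)).trans (ih i _)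

/-- Substitution of a tuple in the representative of `cls t`. -/
theorem subst_proj_plug {Δ Γ : Ctx CTy} {J : Jdg} (t : Tm Op LOp Γ J) (σ : Sub Op LOp Γ Δ) :
    ((t.subst fun _ i => proj i (.var .zero)).plug (ctuple Γ σ)).Eqv (t.subst σ) := by
  refine (Eqv.of_eq (subst_subst _ _ _)).trans (Eqv.subst_right t fun A i => ?_)
  exact (Eqv.of_eq (proj_subst _ _ _)).trans (proj_ctuple i σ)

/-- `cls` reflects equivalence. -/
theorem Eqv.of_cls_eq {Γ : Ctx CTy} {J : Jdg} {t s : Tm Op LOp Γ J} (h : t.cls = s.cls) :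
    t.Eqv s := by
  have key : ∀ t : Tm Op LOp Γ J, Eqv _ t := fun t =>
    (subst_proj_plug t fun _ x => .var x).trans (by rw [subst_var]; exact .refl _)
  exact (key t).symm.trans ((Eqv.plug (Quotient.exact h) (.refl _)).trans (key s))

theorem lfst_zero {Γ : Ctx CTy} {S T U : LTy} :
    (Tm.lfst (.zero : Tm Op LOp Γ (.lin S (.prod T U)))).Eqv .zero :=
  Eqv.lsubst_zero (.lfst .lvar : Tm Op LOp Γ (.lin (.prod T U) T))

theorem lsnd_zero {Γ : Ctx CTy} {S T U : LTy} :
    (Tm.lsnd (.zero : Tm Op LOp Γ (.lin S (.prod T U)))).Eqv .zero :=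
  Eqv.lsubst_zero (.lsnd .lvar : Tm Op LOp Γ (.lin (.prod T U) U))

section

variable {ι : Type} (f : ι → LTy) {Δ Θ : Ctx CTy} {R S T : LTy}

theorem Eqv.lproj {Γ : Ctx ι} {a : ι} (i : Var Γ a)
    {t s : Tm Op LOp Δ (.lin S (LTy.nprod (Γ.map f)))} (h : t.Eqv s) :
    (Tm.lproj f i t).Eqv (Tm.lproj f i s) := by
  induction Γ with
  | nil => cases i
  | snoc Γ B ih =>
    cases Γ with
    | nil =>
      cases i with
      | zero => exact h
      | succ i => cases i
    | snoc Γ D =>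
      cases i with
      | zero => exact .lsnd_congr h
      | succ i => exact ih i (.lfst_congr h)

theorem lproj_subst {Γ : Ctx ι} {a : ι} (i : Var Γ a)
    (t : Tm Op LOp Δ (.lin S (LTy.nprod (Γ.map f)))) (σ : Sub Op LOp Δ Θ) :
    (lproj f i t).subst σ = lproj f i (t.subst σ) := by
  induction Γ with
  | nil => cases i
  | snoc Γ B ih =>
    cases Γ with
    | nil =>
      cases i with
      | zero => rfl
      | succ i => cases i
    | snoc Γ D =>
      cases i with
      | zero => rfl
      | succ i => exact ih i (.lfst t)

theorem lproj_lsubst {Γ : Ctx ι} {a : ι} (i : Var Γ a)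
    (t : Tm Op LOp Δ (.lin S (LTy.nprod (Γ.map f)))) (s : Tm Op LOp Δ (.lin R S)) :
    (lproj f i t).lsubst s = lproj f i (t.lsubst s) := by
  induction Γ with
  | nil => cases i
  | snoc Γ B ih =>
    cases Γ with
    | nil =>
      cases i with
      | zero => rfl
      | succ i => cases i
    | snoc Γ D =>
      cases i with
      | zero => rfl
      | succ i => exact ih i (.lfst t)

theorem ltuple_subst (Γ : Ctx ι) (ts : ∀ a, Var Γ a → Tm Op LOp Δ (.lin S (f a)))
    (σ : Sub Op LOp Δ Θ) : (ltuple f Γ ts).subst σ = ltuple f Γ fun a i => (ts a i).subst σ := by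
  induction Γ with
  | nil => rfl
  | snoc Γ b ih =>
    cases Γ with
    | nil => rfl
    | snoc Γ d => exact congrArg (Tm.lpair · _) (ih _)

theorem ltuple_lsubst (Γ : Ctx ι) (ts : ∀ a, Var Γ a → Tm Op LOp Δ (.lin S (f a)))
    (s : Tm Op LOp Δ (.lin R S)) :
    (ltuple f Γ ts).lsubst s = ltuple f Γ fun a i => (ts a i).lsubst s := by
  induction Γ with
  | nil => rfl
  | snoc Γ b ih =>
    cases Γ with
    | nil => rfl
    | snoc Γ d => exact congrArg (Tm.lpair · _) (ih _)

theorem ctxPair_subst (Γ : Ctx ι) {a : ι} (t : Tm Op LOp Δ (.lin S (LTy.nprod (Γ.map f))))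
    (s : Tm Op LOp Δ (.lin S (f a))) (σ : Sub Op LOp Δ Θ) :
    (ctxPair f Γ t s).subst σ = ctxPair f Γ (t.subst σ) (s.subst σ) := by
  cases Γ <;> rfl

theorem ctxPair_lsubst (Γ : Ctx ι) {a : ι} (t : Tm Op LOp Δ (.lin S (LTy.nprod (Γ.map f))))
    (s : Tm Op LOp Δ (.lin S (f a))) (r : Tm Op LOp Δ (.lin R S)) :
    (ctxPair f Γ t s).lsubst r = ctxPair f Γ (t.lsubst r) (s.lsubst r) := by
  cases Γ <;> rfl

theorem Eqv.ctxPair (Γ : Ctx ι) {a : ι} {t t' : Tm Op LOp Δ (.lin S (LTy.nprod (Γ.map f)))}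
    {s s' : Tm Op LOp Δ (.lin S (f a))} (h : t.Eqv t') (h' : s.Eqv s') :
    (Tm.ctxPair f Γ t s).Eqv (Tm.ctxPair f Γ t' s') := by
  cases Γ with
  | nil => exact h'
  | snoc => exact .lpair_congr h h'

theorem lproj_zero_ctxPair (Γ : Ctx ι) {a : ι} (t : Tm Op LOp Δ (.lin S (LTy.nprod (Γ.map f))))
    (s : Tm Op LOp Δ (.lin S (f a))) :
    (lproj f (.zero : Var (Γ.snoc a) a) (ctxPair f Γ t s)).Eqv s := by
  cases Γ with
  | nil => exact .refl _
  | snoc => exact .lsnd_beta _ _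

theorem lproj_succ_ctxPair {Γ : Ctx ι} {a b : ι} (i : Var Γ b)
    (t : Tm Op LOp Δ (.lin S (LTy.nprod (Γ.map f)))) (s : Tm Op LOp Δ (.lin S (f a))) :
    (lproj f (.succ i : Var (Γ.snoc a) b) (ctxPair f Γ t s)).Eqv (lproj f i t) := by
  cases Γ with
  | nil => cases i
  | snoc => exact Eqv.lproj f i (.lfst_beta _ _)

theorem ctxFst_subst (Γ : Ctx ι) {a : ι}
    (t : Tm Op LOp Δ (.lin S (LTy.nprod ((Γ.snoc a).map f)))) (σ : Sub Op LOp Δ Θ) :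
    (ctxFst f Γ t).subst σ = ctxFst f Γ (t.subst σ) := by
  cases Γ <;> rfl

theorem ctxFst_lsubst (Γ : Ctx ι) {a : ι}
    (t : Tm Op LOp Δ (.lin S (LTy.nprod ((Γ.snoc a).map f)))) (r : Tm Op LOp Δ (.lin R S)) :
    (ctxFst f Γ t).lsubst r = ctxFst f Γ (t.lsubst r) := by
  cases Γ <;> rfl

theorem Eqv.ctxFst (Γ : Ctx ι) {a : ι} {t t' : Tm Op LOp Δ (.lin S (LTy.nprod ((Γ.snoc a).map f)))}
    (h : t.Eqv t') : (Tm.ctxFst f Γ t).Eqv (Tm.ctxFst f Γ t') := by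
  cases Γ with
  | nil => exact .refl _
  | snoc => exact .lfst_congr h

theorem ctxSnd_subst (Γ : Ctx ι) {a : ι}
    (t : Tm Op LOp Δ (.lin S (LTy.nprod ((Γ.snoc a).map f)))) (σ : Sub Op LOp Δ Θ) :
    (ctxSnd f Γ t).subst σ = ctxSnd f Γ (t.subst σ) := by
  cases Γ <;> rfl

theorem ctxSnd_lsubst (Γ : Ctx ι) {a : ι}
    (t : Tm Op LOp Δ (.lin S (LTy.nprod ((Γ.snoc a).map f)))) (r : Tm Op LOp Δ (.lin R S)) :
    (ctxSnd f Γ t).lsubst r = ctxSnd f Γ (t.lsubst r) := by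
  cases Γ <;> rfl

theorem Eqv.ctxSnd (Γ : Ctx ι) {a : ι} {t t' : Tm Op LOp Δ (.lin S (LTy.nprod ((Γ.snoc a).map f)))}
    (h : t.Eqv t') : (Tm.ctxSnd f Γ t).Eqv (Tm.ctxSnd f Γ t') := by
  cases Γ with
  | nil => exact h
  | snoc => exact .lsnd_congr h

/-- A tuple of zeros is zero. -/
theorem ltuple_zero (Γ : Ctx ι) :
    (ltuple f Γ fun _ _ => (.zero : Tm Op LOp Δ (.lin S _))).Eqv .zero := by
  induction Γ with
  | nil => exact (Eqv.lunit_eta .zero).symm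
  | snoc Γ b ih =>
    cases Γ with
    | nil => exact .refl _
    | snoc Γ d =>
      -- a pair of zeros has the same components as zero
      refine Eqv.trans (.lpair_congr ?_ ?_) (Eqv.lpair_eta .zero).symm
      · exact ih.trans lfst_zero.symm
      · exact lsnd_zero.symm

theorem lcoproj_subst {Γ : Ctx ι} {a : ι} (i : Var Γ a) (t : Tm Op LOp Δ (.lin S (f a)))
    (σ : Sub Op LOp Δ Θ) : (lcoproj f i t).subst σ = lcoproj f i (t.subst σ) := by
  induction Γ with
  | nil => cases i
  | snoc Γ B ih =>
    cases Γ with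
    | nil =>
      cases i with
      | zero => rfl
      | succ i => cases i
    | snoc Γ D =>
      cases i with
      | zero => exact congrArg (Tm.lpair · _) (ltuple_subst _ _ _ _)
      | succ i => exact congrArg (Tm.lpair · _) (ih i)

theorem ctxFst_lcoproj_zero (Γ : Ctx ι) {a : ι} (t : Tm Op LOp Δ (.lin S (f a))) :
    (ctxFst f Γ (lcoproj f (.zero : Var (Γ.snoc a) a) t)).Eqv .zero := by
  cases Γ with
  | nil => exact (Eqv.lunit_eta .zero).symm
  | snoc Γ b => exact (Eqv.lfst_beta _ _).trans (ltuple_zero f _)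

theorem ctxSnd_lcoproj_zero (Γ : Ctx ι) {a : ι} (t : Tm Op LOp Δ (.lin S (f a))) :
    (ctxSnd f Γ (lcoproj f (.zero : Var (Γ.snoc a) a) t)).Eqv t := by
  cases Γ with
  | nil => exact .refl _
  | snoc Γ b => exact .lsnd_beta _ _

theorem ctxFst_lcoproj_succ {Γ : Ctx ι} {a b : ι} (i : Var Γ b) (t : Tm Op LOp Δ (.lin S (f b))) :
    (ctxFst f Γ (lcoproj f (.succ i : Var (Γ.snoc a) b) t)).Eqv (lcoproj f i t) := by
  cases Γ with
  | nil => cases i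
  | snoc Γ b => exact .lfst_beta _ _

theorem ctxSnd_lcoproj_succ {Γ : Ctx ι} {a b : ι} (i : Var Γ b) (t : Tm Op LOp Δ (.lin S (f b))) :
    (ctxSnd f Γ (lcoproj f (.succ i : Var (Γ.snoc a) b) t)).Eqv .zero := by
  cases Γ with
  | nil => cases i
  | snoc Γ b => exact .lsnd_beta _ _

theorem lsum_subst (Γ : Ctx ι) (ts : ∀ a, Var Γ a → Tm Op LOp Δ (.lin S T))
    (σ : Sub Op LOp Δ Θ) : (lsum Γ ts).subst σ = lsum Γ fun a i => (ts a i).subst σ := by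
  induction Γ with
  | nil => rfl
  | snoc Γ b ih =>
    cases Γ with
    | nil => rfl
    | snoc Γ d => exact congrArg (Tm.add · _) (ih _)

theorem lsum_lsubst (Γ : Ctx ι) (ts : ∀ a, Var Γ a → Tm Op LOp Δ (.lin S T))
    (s : Tm Op LOp Δ (.lin R S)) :
    (lsum Γ ts).lsubst s = lsum Γ fun a i => (ts a i).lsubst s := by
  induction Γ with
  | nil => rfl
  | snoc Γ b ih =>
    cases Γ with
    | nil => rfl
    | snoc Γ d => exact congrArg (Tm.add · _) (ih _)

/-- Linear terms preserve finite sums. -/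
theorem lsubst_lsum (Γ : Ctx ι) (ts : ∀ a, Var Γ a → Tm Op LOp Δ (.lin R S))
    (s : Tm Op LOp Δ (.lin S T)) :
    (s.lsubst (lsum Γ ts)).Eqv (lsum Γ fun a i => s.lsubst (ts a i)) := by
  induction Γ with
  | nil => exact .lsubst_zero s
  | snoc Γ b ih =>
    cases Γ with
    | nil => exact .refl _
    | snoc Γ d => exact (Eqv.lsubst_add _ _ _).trans (.add_congr (ih _) (.refl _))

end

/-! ### Equivalences for the clauses of the code transformations -/

/-- A pair of a value and a linear function is determined by the value and by the application of
the linear function to the linear variable. -/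
theorem Eqv.of_fst_of_lfapp_snd {Γ : Ctx CTy} {A : CTy} {S T : LTy}
    {t s : Tm Op LOp Γ (.val (.prod A (.lfun S T)))} (h₁ : (Tm.fst t).Eqv (.fst s))
    (h₂ : (Tm.lfapp (.snd t) .lvar).Eqv (.lfapp (.snd s) .lvar)) : t.Eqv s :=
  (Tm.Eqv.pair_eta t).trans ((Tm.Eqv.pair_congr h₁ ((Tm.Eqv.lfun_eta _).trans
    ((Tm.Eqv.lfun_congr h₂).trans (Tm.Eqv.lfun_eta _).symm))).trans (Tm.Eqv.pair_eta s).symm)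

/-- `letsSub`, restricted along the renaming that picks out the primals `x₁, …, xₖ`. -/
theorem letsSub_comp_ofMap (f : ℕ → CTy) {Γ Δ : Ctx CTy} (σ : Tm.Sub Op LOp Γ Δ) {ns : Ctx ℕ}
    (us : ∀ n, Var ns n → Tm Op LOp Δ (.val (.prod (.real n) (f n)))) :
    (fun A x => letsSub f σ ns us A (Ren.ofMap CTy.real ns (fun _ i => letsVar f Γ i) A x)) =
      Sub.ofMap CTy.real ns fun n i => .fst (us n i) := by
  funext A x
  refine Var.map_ind (P := fun A x => letsSub f σ ns us A
    (Ren.ofMap CTy.real ns (fun _ i => letsVar f Γ i) A x) =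
      Sub.ofMap CTy.real ns (fun n i => .fst (us n i)) A x) (fun n i => ?_) A x
  rw [Ren.ofMap_map, Sub.ofMap_map, letsSub_var]

/-- Linear terms commute with the elimination of copowers. -/
theorem lsubst_cmatch {Γ : Ctx CTy} {A : CTy} {S T U : LTy} (k : Tm Op LOp Γ (.lin T U))
    (r : Tm Op LOp (Γ.snoc A) (.lin S T)) :
    (k.lsubst (.cmatch .lvar r)).Eqv (.cmatch .lvar ((k.wk A).lsubst r)) := by
  have h := Eqv.copow_eta .lvar (k.lsubst (.cmatch .lvar r))
  rw [lsubst_lvar, lsubst_wk, lsubst_lsubst] at h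
  refine h.trans (.cmatch_congr (.refl _) (.lsubst (.refl _) ?_))
  refine (Eqv.copow_beta (.var .zero) .lvar (r.rename ((Ren.wk A).lift A))).trans (.of_eq ?_)
  rw [lsubst_lvar, inst, subst_rename]
  conv_rhs => rw [← subst_var r]
  congr 1
  funext C x
  cases x <;> rfl

/-- The tangents of a context extended by a variable, restricted to the tangent of that variable:
the tangents of the other variables vanish by linearity of `L`. -/
theorem split_ctxPair_left {ι : Type} (f : ι → LTy) (Γ : Ctx ι) {a : ι} {D X₁ : CTy} {X₂ : LTy}
    (L : Tm Op LOp (Ctx.nil.snoc X₁) (.lin X₂ (LTy.nprod (Γ.map f)))) :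
    (split ((ctxPair f Γ ((L.plug (.snd (.var .zero))).lsubst (.lsnd .lvar))
      (.lfst .lvar : Tm Op LOp (Ctx.nil.snoc (.prod D X₁)) (.lin (.prod (f a) X₂) (f a)))).lsubst
        (.lpair .lvar .zero))).Eqv (ctxPair f Γ .zero .lvar) := by
  rw [ctxPair_lsubst, split, plug, ctxPair_subst, lsubst_lsubst]
  exact Eqv.ctxPair f Γ (Eqv.subst ((Eqv.lsubst (.refl _) (.lsnd_beta _ _)).trans
    (.lsubst_zero _)) _) (.lfst_beta _ _)

/-- The tangents of a context extended by a variable, restricted to the tangents of the other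
variables. -/
theorem split_ctxPair_right {ι : Type} (f : ι → LTy) (Γ : Ctx ι) {a : ι} {D X₁ : CTy} {X₂ : LTy}
    (L : Tm Op LOp (Ctx.nil.snoc X₁) (.lin X₂ (LTy.nprod (Γ.map f)))) :
    (split ((ctxPair f Γ ((L.plug (.snd (.var .zero))).lsubst (.lsnd .lvar))
      (.lfst .lvar : Tm Op LOp (Ctx.nil.snoc (.prod D X₁)) (.lin (.prod (f a) X₂) (f a)))).lsubst
        (.lpair .zero .lvar))).Eqv (ctxPair f Γ (L.wk D) .zero) := by
  rw [ctxPair_lsubst, split, plug, ctxPair_subst, lsubst_lsubst]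
  refine Eqv.ctxPair f Γ ((Eqv.subst ((Eqv.lsubst (.refl _) (.lsnd_beta _ _)).trans
    (.of_eq (lsubst_lvar _))) _).trans (split_snd L)) (.lfst_beta _ _)

section

variable {ι : Type} (f : ι → LTy) (Γ : Ctx ι) {a : ι} {D X₁ : CTy} {X₂ S : LTy}
  (K : Tm Op LOp (Ctx.nil.snoc X₁) (.lin (LTy.nprod (Γ.map f)) X₂))
  (Z : Tm Op LOp (Ctx.nil.snoc (.prod D X₁)) (.lin S (LTy.nprod ((Γ.snoc a).map f))))

theorem lfst_add_lpair {Γ : Ctx CTy} {S T U : LTy} (t t' : Tm Op LOp Γ (.lin S T))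
    (s s' : Tm Op LOp Γ (.lin S U)) : (lfst (add (lpair t s) (lpair t' s'))).Eqv (add t t') :=
  (Eqv.lsubst_add (.lfst .lvar) (lpair t s) (lpair t' s')).trans
    (Eqv.add_congr (.lfst_beta t s) (.lfst_beta t' s'))

theorem lsnd_add_lpair {Γ : Ctx CTy} {S T U : LTy} (t t' : Tm Op LOp Γ (.lin S T))
    (s s' : Tm Op LOp Γ (.lin S U)) : (lsnd (add (lpair t s) (lpair t' s'))).Eqv (add s s') :=
  (Eqv.lsubst_add (.lsnd .lvar) (lpair t s) (lpair t' s')).trans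
    (Eqv.add_congr (.lsnd_beta t s) (.lsnd_beta t' s'))

/-- The cotangent of the innermost variable of an extended context, as the first component of the
cotangents of the product in `Sub.liftProd`. -/
theorem split_lfst :
    (split (.lfst ((add (lpair .zero ((K.plug (.snd (.var .zero))).lsubst (ctxFst f Γ .lvar)))
      (lpair (ctxSnd f Γ .lvar) .zero)).lsubst Z))).Eqv (ctxSnd f Γ (split Z)) := by
  have h := (lfst_add_lpair .zero (ctxSnd f Γ .lvar)
    ((K.plug (.snd (.var (.zero : Var (Ctx.nil.snoc (CTy.prod D X₁)) _)))).lsubst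
      (ctxFst f Γ (a := a) .lvar)) .zero).trans (.zero_add _)
  refine Eqv.trans (Eqv.subst (Eqv.lsubst h (.refl Z)) _) (.of_eq ?_)
  rw [ctxSnd_lsubst, ctxSnd_subst]
  rfl

/-- The cotangents of the other variables of an extended context, as the second component of the
cotangents of the product in `Sub.liftProd`. -/
theorem split_lsnd :
    (split (.lsnd ((add (lpair .zero ((K.plug (.snd (.var .zero))).lsubst (ctxFst f Γ .lvar)))
      (lpair (ctxSnd f Γ .lvar) .zero)).lsubst Z))).Eqv
        ((K.wk D).lsubst (ctxFst f Γ (split Z))) := by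
  have h := (lsnd_add_lpair .zero (ctxSnd f Γ .lvar)
    ((K.plug (.snd (.var (.zero : Var (Ctx.nil.snoc (CTy.prod D X₁)) _)))).lsubst
      (ctxFst f Γ (a := a) .lvar)) .zero).trans (.add_zero _)
  refine Eqv.trans (Eqv.subst (Eqv.lsubst h (.refl Z)) _) ?_
  rw [lsubst_lsubst, ctxFst_lsubst, plug, lsubst_subst, ctxFst_subst]
  exact .lsubst (split_snd K) (.refl _)

end

end Tm

end CHAD

namespace CHAD

variable {Op : Ctx ℕ → ℕ → Type u} {LOp : Ctx ℕ → Ctx ℕ → Ctx ℕ → Type v}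

/-! ### Forward mode -/

/-- The morphism of `Σ_CSyn LSyn` represented by a pair of terms. -/
def Fwd.mk {X₁ Y₁ : CTy} {X₂ Y₂ : LTy} (a : Tm Op LOp (Ctx.nil.snoc X₁) (.val Y₁))
    (b : Tm Op LOp (Ctx.nil.snoc X₁) (.lin X₂ Y₂)) : (⟨⟨X₁⟩, X₂⟩ : Fwd Op LOp) ⟶ ⟨⟨Y₁⟩, Y₂⟩ :=
  ⟨Tm.Cls.mk a, Tm.Cls.mk b⟩

theorem Fwd.mk_eq {X₁ Y₁ : CTy} {X₂ Y₂ : LTy} {a a' : Tm Op LOp (Ctx.nil.snoc X₁) (.val Y₁)}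
    {b b' : Tm Op LOp (Ctx.nil.snoc X₁) (.lin X₂ Y₂)} (h : a.Eqv a') (h' : b.Eqv b') :
    Fwd.mk a b = Fwd.mk a' b' := by
  rw [Fwd.mk, Fwd.mk, Tm.Cls.sound h, Tm.Cls.sound h']

/-- The Cartesian closed structure of `Σ_CSyn LSyn`. -/
abbrev Fwd.ccStr (Op : Ctx ℕ → ℕ → Type u) (LOp : Ctx ℕ → Ctx ℕ → Ctx ℕ → Type v) :
    CCStr (Fwd Op LOp) := (LSyn.model Op LOp).sig

/-- Finite products in `Σ_CSyn LSyn` are componentwise. -/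
theorem Fwd.nprod_eq {ι : Type} (f₁ : ι → CTy) (f₂ : ι → LTy) : (Γ : Ctx ι) →
    nprod (Fwd.ccStr Op LOp).one (Fwd.ccStr Op LOp).prod (Γ.map fun a => ⟨⟨f₁ a⟩, f₂ a⟩) =
      ⟨⟨CTy.nprod (Γ.map f₁)⟩, LTy.nprod (Γ.map f₂)⟩
  | .nil => rfl
  | .snoc .nil _ => rfl
  | .snoc (.snoc Γ b) a => congrArg (fun X => (Fwd.ccStr Op LOp).prod X ⟨⟨f₁ a⟩, f₂ a⟩)
      (Fwd.nprod_eq f₁ f₂ (.snoc Γ b))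

/-- Tuples in `Σ_CSyn LSyn` are componentwise. -/
theorem Fwd.tuple_eq {ι : Type} (f₁ : ι → CTy) (f₂ : ι → LTy) {X₁ : CTy} {X₂ : LTy} :
    (Γ : Ctx ι) → (as : ∀ a, Var Γ a → Tm Op LOp (Ctx.nil.snoc X₁) (.val (f₁ a))) →
    (bs : ∀ a, Var Γ a → Tm Op LOp (Ctx.nil.snoc X₁) (.lin X₂ (f₂ a))) →
    (Fwd.ccStr Op LOp).tuple (fun a => ⟨⟨f₁ a⟩, f₂ a⟩) Γ (fun a i => Fwd.mk (as a i) (bs a i)) ≫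
        eqToHom (Fwd.nprod_eq f₁ f₂ Γ) =
      Fwd.mk (.ctuple _ (.ofMap f₁ Γ as)) (.ltuple f₂ Γ bs)
  | .nil, _, _ => (Fwd.ccStr Op LOp).bang_uniq _ _
  | .snoc .nil _, _, _ => Category.comp_id _
  | .snoc (.snoc Γ b) _, _, _ =>
    ((Fwd.ccStr Op LOp).pair_eqToHom_left _ _ (Fwd.nprod_eq f₁ f₂ (.snoc Γ b)) _ rfl).trans
      ((Category.comp_id _).trans (congrArg ((Fwd.ccStr Op LOp).pair · _)
        (Fwd.tuple_eq f₁ f₂ (.snoc Γ b) _ _)))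

/-- Projections in `Σ_CSyn LSyn` are componentwise. -/
theorem Fwd.nproj_eq {ι : Type} (f₁ : ι → CTy) (f₂ : ι → LTy) {X₁ : CTy} {X₂ : LTy} :
    {Γ : Ctx ι} → {a : ι} → (i : Var Γ a) →
    (t : Tm Op LOp (Ctx.nil.snoc X₁) (.val (CTy.nprod (Γ.map f₁)))) →
    (s : Tm Op LOp (Ctx.nil.snoc X₁) (.lin X₂ (LTy.nprod (Γ.map f₂)))) →
    Fwd.mk t s ≫ eqToHom (Fwd.nprod_eq f₁ f₂ Γ).symm ≫ (Fwd.ccStr Op LOp).nproj _ i =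
      Fwd.mk (.proj (i.map f₁) t) (.lproj f₂ i s)
  | .snoc .nil _, _, .zero, t, s =>
    (congrArg (Fwd.mk t s ≫ ·) (Category.id_comp _)).trans (Category.comp_id (Fwd.mk t s))
  | .snoc (.snoc Γ b) a, _, .zero, t, s => by
    have h := (Fwd.ccStr Op LOp).snd_congr (Y := ⟨⟨f₁ a⟩, f₂ a⟩) (Fwd.nprod_eq f₁ f₂ (.snoc Γ b))
      (Fwd.nprod_eq f₁ f₂ (.snoc (.snoc Γ b) a)).symm rfl
    exact congrArg (Fwd.mk t s ≫ ·) (h.trans (Category.id_comp _))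
  | .snoc (.snoc Γ b) a, _, .succ i, t, s => by
    have h := (Fwd.ccStr Op LOp).fst_congr (Y := ⟨⟨f₁ a⟩, f₂ a⟩)
      (Fwd.nprod_eq f₁ f₂ (.snoc Γ b)).symm rfl
      (Fwd.nprod_eq f₁ f₂ (.snoc (.snoc Γ b) a)).symm
    refine Eq.trans ?_ (Fwd.nproj_eq f₁ f₂ i (.fst t) (.lfst s))
    refine Eq.trans (congrArg (Fwd.mk t s ≫ ·) ((Category.assoc _ _ _).symm.trans
      (congrArg (· ≫ (Fwd.ccStr Op LOp).nproj _ i) (h.symm.trans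
        (congrArg (· ≫ eqToHom _) (Category.id_comp _)))))) ?_
    refine (congrArg (Fwd.mk t s ≫ ·) (Category.assoc _ _ _)).trans ?_
    exact (Category.assoc (Fwd.mk t s) ((Fwd.ccStr Op LOp).fst ⟨⟨CTy.nprod ((Γ.snoc b).map f₁)⟩,
      LTy.nprod ((Γ.snoc b).map f₂)⟩ ⟨⟨f₁ a⟩, f₂ a⟩) _).symm

/-- Currying of represented morphisms; it has the shape of the clause for `λ`. -/
theorem Fwd.curry_mk {A₁ X₁ B₁ : CTy} {A₂ X₂ B₂ : LTy}
    (a : Tm Op LOp (Ctx.nil.snoc (.prod A₁ X₁)) (.val B₁))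
    (b : Tm Op LOp (Ctx.nil.snoc (.prod A₁ X₁)) (.lin (.prod A₂ X₂) B₂)) :
    (Fwd.ccStr Op LOp).curry (A := ⟨⟨A₁⟩, A₂⟩) (X := ⟨⟨X₁⟩, X₂⟩) (B := ⟨⟨B₁⟩, B₂⟩) (Fwd.mk a b) =
      Fwd.mk (.lam (.split (.pair a (.lfun (b.lsubst (.lpair .lvar .zero))))))
        (.plam (.split (b.lsubst (.lpair .zero .lvar)))) := rfl

/-- Application of represented morphisms; it has the shape of the clause for application. -/
theorem Fwd.pair_mk_ev {A₁ X₁ B₁ : CTy} {A₂ X₂ B₂ : LTy}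
    (a : Tm Op LOp (Ctx.nil.snoc X₁) (.val A₁)) (a' : Tm Op LOp (Ctx.nil.snoc X₁) (.lin X₂ A₂))
    (f : Tm Op LOp (Ctx.nil.snoc X₁) (.val (.fn A₁ (.prod B₁ (.lfun A₂ B₂)))))
    (f' : Tm Op LOp (Ctx.nil.snoc X₁) (.lin X₂ (.pow A₁ B₂))) :
    (Fwd.ccStr Op LOp).pair (X := ⟨⟨X₁⟩, X₂⟩) (Y := ⟨⟨A₁⟩, A₂⟩) (Fwd.mk a a') (Fwd.mk f f') ≫
        (Fwd.ccStr Op LOp).ev ⟨⟨A₁⟩, A₂⟩ ⟨⟨B₁⟩, B₂⟩ =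
      Fwd.mk (.fst (.app f a)) (.add (.papp f' a) (.lfapp (.snd (.app f a)) a')) := by
  have h := Tm.Eqv.app_congr (Tm.Eqv.snd_beta a f) (Tm.Eqv.fst_beta a f)
  refine Fwd.mk_eq (Tm.Eqv.fst_congr h) (Tm.Eqv.trans (.add_comm _ _) (.add_congr ?_ ?_))
  · exact .papp_congr (.lsnd_beta _ _) (.fst_beta _ _)
  · exact .lfapp_congr (.snd_congr h) (.lfst_beta _ _)

/-- The interpretation of the source language in `Σ_CSyn LSyn` by the types of the forward-mode
code transformation. -/
def fwdSem (dop : Der Op LOp) : Semantics Op (Fwd.ccStr Op LOp) where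
  obj A := ⟨⟨A.fwd₁⟩, A.fwd₂⟩
  obj_unit := rfl
  obj_prod _ _ := rfl
  obj_fn _ _ := rfl
  op ns _ o := eqToHom (Fwd.nprod_eq CTy.real LTy.real ns) ≫ fwdOp dop o

variable (dop : Der Op LOp)

section

variable {X₁ : CTy} {X₂ : LTy}

/-- The environment given by a substitution `τ` for the primals and a tuple `L` of tangents. -/
def fwdEnv {Γ : Ctx STy} (τ : Tm.Sub Op LOp (Γ.map STy.fwd₁) (Ctx.nil.snoc X₁))
    (L : Tm Op LOp (Ctx.nil.snoc X₁) (.lin X₂ (LTy.nprod (Γ.map STy.fwd₂)))) :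
    (fwdSem dop).Env ⟨⟨X₁⟩, X₂⟩ Γ :=
  fun _ x => Fwd.mk (τ _ (x.map _)) (.lproj _ x L)

/-- The morphism represented by a term of type `A₁ * (Y ⊸ A₂)`, such as the code transformation
of a term, and a term of type `Y`. -/
def Fwd.ofCode {A₁ : CTy} {Y A₂ : LTy}
    (u : Tm Op LOp (Ctx.nil.snoc X₁) (.val (.prod A₁ (.lfun Y A₂))))
    (L : Tm Op LOp (Ctx.nil.snoc X₁) (.lin X₂ Y)) : (⟨⟨X₁⟩, X₂⟩ : Fwd Op LOp) ⟶ ⟨⟨A₁⟩, A₂⟩ :=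
  Fwd.mk (.fst u) (.lfapp (.snd u) L)

/-- A code transformation of the form `⟨a, λv. b⟩` represents the pair of `a` and `b[L/v]`. -/
theorem Fwd.ofCode_eq {A₁ : CTy} {Y A₂ : LTy}
    {u : Tm Op LOp (Ctx.nil.snoc X₁) (.val (.prod A₁ (.lfun Y A₂)))}
    {a : Tm Op LOp (Ctx.nil.snoc X₁) (.val A₁)} {b : Tm Op LOp (Ctx.nil.snoc X₁) (.lin Y A₂)}
    (h : u.Eqv (.pair a (.lfun b))) (L : Tm Op LOp (Ctx.nil.snoc X₁) (.lin X₂ Y)) :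
    Fwd.ofCode u L = Fwd.mk a (b.lsubst L) :=
  Fwd.mk_eq ((Tm.Eqv.fst_congr h).trans (.fst_beta _ _))
    ((Tm.Eqv.lfapp_congr ((Tm.Eqv.snd_congr h).trans (.snd_beta _ _)) (.refl _)).trans
      (.lfun_beta _ _))

/-- A value of a further variable extends the tuple of tangents by its tangent. -/
theorem fwdEnv_snoc {Γ : Ctx STy} {A : STy}
    (τ : Tm.Sub Op LOp (Γ.map STy.fwd₁) (Ctx.nil.snoc X₁))
    (L : Tm Op LOp (Ctx.nil.snoc X₁) (.lin X₂ (LTy.nprod (Γ.map STy.fwd₂))))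
    (a : Tm Op LOp (Ctx.nil.snoc X₁) (.val A.fwd₁))
    (b : Tm Op LOp (Ctx.nil.snoc X₁) (.lin X₂ A.fwd₂)) :
    (fwdEnv dop τ L).snoc (Fwd.mk a b) =
      fwdEnv dop (Γ := Γ.snoc A) (τ.snoc a) (.ctxPair _ Γ L b) := by
  funext B x
  cases x with
  | zero => exact Fwd.mk_eq (.refl _) (Tm.lproj_zero_ctxPair _ _ _ _).symm
  | succ x => exact Fwd.mk_eq (.refl _) (Tm.lproj_succ_ctxPair _ x _ _).symm

/-- Under a binder, the primals and the tangents of the bound variable are the first components of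
the extended stage. -/
theorem fwdEnv_lift {Γ : Ctx STy} (A : STy)
    (τ : Tm.Sub Op LOp (Γ.map STy.fwd₁) (Ctx.nil.snoc X₁))
    (L : Tm Op LOp (Ctx.nil.snoc X₁) (.lin X₂ (LTy.nprod (Γ.map STy.fwd₂)))) :
    (fwdEnv dop τ L).lift A =
      fwdEnv dop (Γ := Γ.snoc A) (X₁ := .prod A.fwd₁ X₁) (X₂ := .prod A.fwd₂ X₂)
        (τ.liftProd A.fwd₁)
        (.ctxPair _ Γ ((L.plug (.snd (.var .zero))).lsubst (.lsnd .lvar)) (.lfst .lvar)) := by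
  refine Eq.trans ?_ (fwdEnv_snoc dop _ _ _ _)
  refine congrArg (fun ρ => Semantics.Env.snoc ρ _) ?_
  funext B x
  refine Fwd.mk_eq (.refl _) (Tm.Eqv.of_eq ?_)
  exact (congrArg (Tm.lsubst · _) (Tm.lproj_subst _ x _ _)).trans (Tm.lproj_lsubst _ x _ _)

end

/-- The forward-mode code transformation computes the interpretation in `Σ_CSyn LSyn`. -/
theorem interp_fwdEnv {Γ : Ctx STy} {A : STy} (t : STm Op Γ A) {X₁ : CTy} {X₂ : LTy}
    (τ : Tm.Sub Op LOp (Γ.map STy.fwd₁) (Ctx.nil.snoc X₁))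
    (L : Tm Op LOp (Ctx.nil.snoc X₁) (.lin X₂ (LTy.nprod (Γ.map STy.fwd₂)))) :
    (fwdSem dop).interp (fwdEnv dop τ L) t = Fwd.ofCode ((t.fwd dop).subst τ) L := by
  induction t generalizing X₁ X₂ with
  | @var Γ A x =>
    refine Eq.trans ?_ (Fwd.ofCode_eq (.refl _) L).symm
    refine Fwd.mk_eq (.refl _) (.of_eq ?_)
    have h : (Tm.lproj STy.fwd₂ x .lvar).subst τ = Tm.lproj STy.fwd₂ x .lvar :=
      Tm.lproj_subst STy.fwd₂ x .lvar τ
    exact ((congrArg (Tm.lsubst · L) h).trans (Tm.lproj_lsubst STy.fwd₂ x .lvar L)).symm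
  | @letin Γ A B t s iht ihs =>
    rw [Semantics.interp, iht, Fwd.ofCode, fwdEnv_snoc]
    refine (ihs _ _).trans (Eq.trans ?_ (Fwd.ofCode_eq ((Tm.plet_subst_eqv _ _ _).trans
      (Tm.plet_subst_eqv _ _ _)) L).symm)
    have h := Tm.ctxPair_lsubst STy.fwd₂ Γ .lvar (.lfapp (.snd ((t.fwd dop).subst τ)) .lvar) L
    refine Fwd.mk_eq (.of_eq (congrArg Tm.fst (Tm.wkLet_subst (s.fwd dop) τ _).symm)) (.of_eq ?_)
    refine congrArg₂ Tm.lfapp (congrArg Tm.snd (Tm.wkLet_subst (s.fwd dop) τ _).symm)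
      (h.symm.trans ?_)
    refine congrArg (Tm.lsubst · L) (Eq.symm (Eq.trans (Tm.ctxPair_subst STy.fwd₂ Γ (a := A)
      .lvar (.lfapp (.var .v₃) .lvar) _) ?_))
    rfl
  | @op Γ ns m o ts ih =>
    -- the transforms of the arguments, to which the code binds the pairs of `xᵢ` and its derivative
    let u n (i : Var ns n) := ((ts n i).fwd dop).subst τ
    have hu : (fun n i => (fwdSem dop).interp (fwdEnv dop τ L) (ts n i)) =
        fun n i => Fwd.mk (.fst (u n i)) (.lfapp (.snd (u n i)) L) :=
      funext fun n => funext fun i => ih n i τ L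
    rw [Semantics.interp, hu]
    refine Eq.trans ?_ (Fwd.ofCode_eq (Tm.lets_subst_eqv _ _ _ _ _) L).symm
    refine (Category.assoc _ _ _).symm.trans ((congrArg (· ≫ fwdOp dop o)
      (Fwd.tuple_eq CTy.real LTy.real ns _ _)).trans ?_)
    refine Fwd.mk_eq ((Tm.subst_proj_plug _ _).trans (.of_eq ?_))
      ((Tm.Eqv.lsubst (Tm.subst_proj_plug _ _) (.refl _)).trans (.of_eq ?_))
    · refine congrArg (Tm.op o) (funext fun n => funext fun i => ?_)
      exact (Tm.Sub.ofMap_map _ _ i).trans (Tm.letsSub_var _ _ _ i).symm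
    · refine Eq.symm ((congrArg (Tm.lsubst · L) ((Tm.lsubst_subst _ _ _).trans
        (congrArg₂ Tm.lsubst ((Tm.subst_rename _ _ _).trans (congrArg (Tm.subst · _)
          (Tm.letsSub_comp_ofMap _ _ _))) (Tm.ltuple_subst _ _ _ _)))).trans
        ((Tm.lsubst_lsubst _ _ _).trans (congrArg (Tm.lsubst _)
          ((Tm.ltuple_lsubst _ _ _ _).trans ?_))))
      refine congrArg (Tm.ltuple LTy.real ns) (funext fun n => funext fun i => ?_)
      exact congrArg (Tm.lfapp · L) (Tm.letsSub_var' _ _ _ i)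
  | unit =>
    refine Eq.trans ?_ (Fwd.ofCode_eq (.refl _) L).symm
    exact (Category.comp_id _).trans (Fwd.mk_eq (.refl _) (.lunit_eta _))
  | pair t s iht ihs =>
    rw [Semantics.interp, iht, ihs]
    refine Eq.trans ?_ (Fwd.ofCode_eq ((Tm.plet_subst_eqv _ _ _).trans
      (Tm.plet_subst_eqv _ _ _)) L).symm
    rw [Tm.wk₃_subst]
    exact Category.comp_id _
  | fst t ih =>
    rw [Semantics.interp, ih]
    refine Eq.trans ?_ (Fwd.ofCode_eq (Tm.plet_subst_eqv _ _ _) L).symm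
    exact congrArg (_ ≫ ·) (Category.id_comp _)
  | snd t ih =>
    rw [Semantics.interp, ih]
    refine Eq.trans ?_ (Fwd.ofCode_eq (Tm.plet_subst_eqv _ _ _) L).symm
    exact congrArg (_ ≫ ·) (Category.id_comp _)
  | @lam Γ A B t ih =>
    rw [Semantics.interp, fwdEnv_lift]
    refine Eq.trans ?_ (Fwd.ofCode_eq (Tm.letin_subst_eqv _ _ _) L).symm
    refine (Category.comp_id _).trans ((congrArg (Fwd.ccStr Op LOp).curry (ih _ _)).trans ?_)
    refine (Fwd.curry_mk _ _).trans ?_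
    -- `hU` replaces the product variable, which encodes the environment under the binder, by two
    -- variables; by `hW`, the result is the application `y x` that occurs in the code
    have hU := Tm.subst_split (t.fwd dop) τ
    have hW := Tm.app_lam_wk ((t.fwd dop).subst (τ.lift A.fwd₁))
    refine Fwd.mk_eq (.lam_congr ?_) (.plam_congr ?_)
    · -- the derivative with respect to the bound variable
      refine Tm.Eqv.trans ?_ (Tm.plet_subst_eqv _ _ _).symm
      refine .pair_congr (.fst_congr (hU.trans hW.symm)) (.lfun_congr ?_)
      refine .lfapp_congr (.snd_congr (hU.trans hW.symm)) ?_
      refine (Tm.split_ctxPair_left STy.fwd₂ Γ L).trans (.of_eq ?_)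
      exact Eq.symm (Eq.trans (Tm.ctxPair_subst STy.fwd₂ Γ (a := A) .zero .lvar _) rfl)
    · -- the derivative with respect to the variables of `Γ`
      refine .lfapp_congr (.snd_congr (hU.trans hW.symm)) ?_
      refine (Tm.split_ctxPair_right STy.fwd₂ Γ L).trans (.of_eq ?_)
      refine (Tm.ctxPair_lsubst STy.fwd₂ Γ .lvar .zero (L.wk A.fwd₁)).symm.trans ?_
      refine congrArg (Tm.lsubst · _) (Eq.symm (Eq.trans
        (Tm.ctxPair_subst STy.fwd₂ Γ (a := A) .lvar .zero _) ?_))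
      rfl
  | app t s iht ihs =>
    rw [Semantics.interp, iht, ihs]
    refine Eq.trans ?_ (Fwd.ofCode_eq ((Tm.plet_subst_eqv _ _ _).trans
      ((Tm.plet_subst_eqv _ _ _).trans (Tm.plet_subst_eqv _ _ _))) L).symm
    rw [Tm.wk₃_subst]
    refine Eq.trans ?_ (Fwd.pair_mk_ev _ _ _ _)
    exact congrArg (fun f => (Fwd.ccStr Op LOp).pair _ f ≫ _) (Category.comp_id _)

/-- The forward-mode functors are the Cartesian closed extensions of the base types and operations
of `fwdSem`; `op` is only transported along `Fwd.nprod_eq`. -/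
theorem isFwd_iff (F : Syn Op ⥤ Fwd Op LOp) :
    IsFwd dop F ↔ Extends (fun n => (fwdSem dop).obj (.real n)) (fwdSem dop).op F :=
  ⟨fun h => ⟨h.cartesianClosed, h.real, fun ns m o => (sendsTo_eqToHom_comp _).2 (h.op ns m o)⟩,
    fun h => ⟨h.cartesianClosed, h.real, fun ns m o => (sendsTo_eqToHom_comp _).1 (h.op ns m o)⟩⟩

theorem existsUnique_isFwd : ∃! F : Syn Op ⥤ Fwd Op LOp, IsFwd dop F := by
  simp only [isFwd_iff]
  exact Semantics.existsUnique_extends (Fwd.ccStr Op LOp) _ _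

theorem IsFwd.eq_functor {F : Syn Op ⥤ Fwd Op LOp} (hF : IsFwd dop F) :
    F = (fwdSem dop).functor :=
  (existsUnique_isFwd dop).unique hF ((isFwd_iff dop _).2 (fwdSem dop).extends_functor)

/-- The morphism represented by the code transformation of `t` is the interpretation of `t`. -/
theorem sendsTo_fwdHom {Γ : Ctx STy} {A : STy} (t : STm Op Γ A) :
    SendsTo (fwdSem dop).functor t.hom (t.fwdHom dop) := by
  have hX : (fwdSem dop).obj (STy.nprod Γ) = ⟨⟨CTy.nprod (Γ.map STy.fwd₁)⟩,
      LTy.nprod (Γ.map STy.fwd₂)⟩ :=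
    ((fwdSem dop).obj_nprod Γ).trans (Fwd.nprod_eq STy.fwd₁ STy.fwd₂ Γ)
  refine sendsTo_of_eqToHom_comp hX ?_
  refine (congrArg (eqToHom hX.symm ≫ ·) ((fwdSem dop).interp_subst t _ _)).trans ?_
  refine ((fwdSem dop).comp_interp _ _ _).trans ?_
  have hρ : Semantics.Env.comp (eqToHom hX.symm) (fun A (i : Var Γ A) => (fwdSem dop).interp
      (Semantics.Env.one (𝟙 _)) (.proj i (.var .zero))) =
      fwdEnv dop (X₁ := CTy.nprod (Γ.map STy.fwd₁)) (X₂ := LTy.nprod (Γ.map STy.fwd₂))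
        (fun _ i => .proj i (.var .zero)) .lvar := by
    funext A i
    refine Eq.trans ?_ (Fwd.nproj_eq STy.fwd₁ STy.fwd₂ i (.var .zero) .lvar)
    refine Eq.trans ?_ (Category.id_comp _).symm
    refine (congrArg (eqToHom hX.symm ≫ ·) (((fwdSem dop).interp_proj _ _ _).trans
      (Category.id_comp _))).trans ?_
    refine (Category.assoc _ _ _).symm.trans (congrArg (· ≫ _) ?_)
    exact eqToHom_trans _ _
  refine (congrArg (fun ρ => (fwdSem dop).interp ρ t) hρ).trans ?_
  exact interp_fwdEnv dop t _ _

/-- The forward-mode code transformation respects equivalence, since the interpretation of a term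
determines its code transformation up to equivalence. -/
theorem STm.Eqv.fwd {Γ : Ctx STy} {A : STy} {t s : STm Op Γ A} (h : t.Eqv s) :
    (t.fwd dop).Eqv (s.fwd dop) := by
  have hom : t.hom = s.hom := STm.Cls.sound (h.subst _)
  have key : t.fwdHom dop = s.fwdHom dop :=
    (sendsTo_fwdHom dop t).unique (hom ▸ sendsTo_fwdHom dop s)
  have h₁ : (Tm.fst (t.fwd dop)).Eqv (.fst (s.fwd dop)) :=
    .of_cls_eq (congrArg Sig.Hom.fst key)
  have h₂ : (Tm.lfapp (.snd (t.fwd dop)) .lvar).Eqv (.lfapp (.snd (s.fwd dop)) .lvar) :=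
    .of_cls_eq (congrArg Sig.Hom.snd key)
  exact Tm.Eqv.of_fst_of_lfapp_snd h₁ h₂

end CHAD

namespace CHAD

variable {Op : Ctx ℕ → ℕ → Type u} {LOp : Ctx ℕ → Ctx ℕ → Ctx ℕ → Type v}

/-! ### Reverse mode -/

/-- The morphism of `Σ_CSyn LSynᵒᵖ` represented by a pair of terms. -/
def Rev.mk {X₁ Y₁ : CTy} {X₂ Y₂ : LTy} (a : Tm Op LOp (Ctx.nil.snoc X₁) (.val Y₁))
    (b : Tm Op LOp (Ctx.nil.snoc X₁) (.lin Y₂ X₂)) : (⟨⟨X₁⟩, X₂⟩ : Rev Op LOp) ⟶ ⟨⟨Y₁⟩, Y₂⟩ :=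
  ⟨Tm.Cls.mk a, Tm.Cls.mk b⟩

theorem Rev.mk_eq {X₁ Y₁ : CTy} {X₂ Y₂ : LTy} {a a' : Tm Op LOp (Ctx.nil.snoc X₁) (.val Y₁)}
    {b b' : Tm Op LOp (Ctx.nil.snoc X₁) (.lin Y₂ X₂)} (h : a.Eqv a') (h' : b.Eqv b') :
    Rev.mk a b = Rev.mk a' b' := by
  rw [Rev.mk, Rev.mk, Tm.Cls.sound h, Tm.Cls.sound h']

/-- The Cartesian closed structure of `Σ_CSyn LSynᵒᵖ`. -/
abbrev Rev.ccStr (Op : Ctx ℕ → ℕ → Type u) (LOp : Ctx ℕ → Ctx ℕ → Ctx ℕ → Type v) :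
    CCStr (Rev Op LOp) := (LSyn.model Op LOp).sigOp

/-- Finite products in `Σ_CSyn LSynᵒᵖ` are componentwise. -/
theorem Rev.nprod_eq {ι : Type} (f₁ : ι → CTy) (f₂ : ι → LTy) : (Γ : Ctx ι) →
    nprod (Rev.ccStr Op LOp).one (Rev.ccStr Op LOp).prod (Γ.map fun a => ⟨⟨f₁ a⟩, f₂ a⟩) =
      ⟨⟨CTy.nprod (Γ.map f₁)⟩, LTy.nprod (Γ.map f₂)⟩
  | .nil => rfl
  | .snoc .nil _ => rfl
  | .snoc (.snoc Γ b) a => congrArg (fun X => (Rev.ccStr Op LOp).prod X ⟨⟨f₁ a⟩, f₂ a⟩)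
      (Rev.nprod_eq f₁ f₂ (.snoc Γ b))

/-- Tuples in `Σ_CSyn LSynᵒᵖ`: since the products of linear types are biproducts, the linear
components are summed. -/
theorem Rev.tuple_eq {ι : Type} (f₁ : ι → CTy) (f₂ : ι → LTy) {X₁ : CTy} {X₂ : LTy} :
    (Γ : Ctx ι) → (as : ∀ a, Var Γ a → Tm Op LOp (Ctx.nil.snoc X₁) (.val (f₁ a))) →
    (bs : ∀ a, Var Γ a → Tm Op LOp (Ctx.nil.snoc X₁) (.lin (f₂ a) X₂)) →
    (Rev.ccStr Op LOp).tuple (fun a => ⟨⟨f₁ a⟩, f₂ a⟩) Γ (fun a i => Rev.mk (as a i) (bs a i)) ≫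
        eqToHom (Rev.nprod_eq f₁ f₂ Γ) =
      Rev.mk (.ctuple _ (.ofMap f₁ Γ as)) (.lsum Γ fun a i => (bs a i).lsubst (.lproj f₂ i .lvar))
  | .nil, _, _ => (Rev.ccStr Op LOp).bang_uniq _ _
  | .snoc .nil _, _, _ => (Category.comp_id _).trans
      (Rev.mk_eq (.refl _) (.of_eq (Tm.lsubst_lvar _).symm))
  | .snoc (.snoc Γ b) _, as, bs => by
    refine ((Rev.ccStr Op LOp).pair_eqToHom_left _ _ (Rev.nprod_eq f₁ f₂ (.snoc Γ b)) _ rfl).trans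
      ((Category.comp_id _).trans ((congrArg ((Rev.ccStr Op LOp).pair · _)
        (Rev.tuple_eq f₁ f₂ (.snoc Γ b) _ _)).trans ?_))
    refine Rev.mk_eq (.refl _) (.of_eq (congrArg (Tm.add · _) ?_))
    refine (Tm.lsum_lsubst (.snoc Γ b) _ _).trans (congrArg (Tm.lsum (.snoc Γ b))
      (funext fun c => funext fun i => ?_))
    exact (Tm.lsubst_lsubst _ _ _).trans (congrArg (Tm.lsubst _) (Tm.lproj_lsubst f₂ i _ _))

/-- Projections in `Σ_CSyn LSynᵒᵖ`: the linear components are the coprojections `⟨0, …, v, …, 0⟩`.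
-/
theorem Rev.nproj_eq {ι : Type} (f₁ : ι → CTy) (f₂ : ι → LTy) {X₁ : CTy} {X₂ : LTy} :
    {Γ : Ctx ι} → {a : ι} → (i : Var Γ a) →
    (t : Tm Op LOp (Ctx.nil.snoc X₁) (.val (CTy.nprod (Γ.map f₁)))) →
    (s : Tm Op LOp (Ctx.nil.snoc X₁) (.lin (LTy.nprod (Γ.map f₂)) X₂)) →
    Rev.mk t s ≫ eqToHom (Rev.nprod_eq f₁ f₂ Γ).symm ≫ (Rev.ccStr Op LOp).nproj _ i =
      Rev.mk (.proj (i.map f₁) t) (s.lsubst (.lcoproj f₂ i .lvar))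
  | .snoc .nil _, _, .zero, t, s =>
    ((congrArg (Rev.mk t s ≫ ·) (Category.id_comp _)).trans (Category.comp_id (Rev.mk t s))).trans
      (Rev.mk_eq (.refl _) (.of_eq (Tm.lsubst_lvar s).symm))
  | .snoc (.snoc Γ b) a, _, .zero, t, s => by
    have h := (Rev.ccStr Op LOp).snd_congr (Y := ⟨⟨f₁ a⟩, f₂ a⟩) (Rev.nprod_eq f₁ f₂ (.snoc Γ b))
      (Rev.nprod_eq f₁ f₂ (.snoc (.snoc Γ b) a)).symm rfl
    refine (congrArg (Rev.mk t s ≫ ·) (h.trans (Category.id_comp _))).trans ?_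
    exact Rev.mk_eq (.refl _)
      (.lsubst (.refl s) (.lpair_congr (Tm.ltuple_zero f₂ _).symm (.refl _)))
  | .snoc (.snoc Γ b) a, _, .succ i, t, s => by
    have h := (Rev.ccStr Op LOp).fst_congr (Y := ⟨⟨f₁ a⟩, f₂ a⟩)
      (Rev.nprod_eq f₁ f₂ (.snoc Γ b)).symm rfl
      (Rev.nprod_eq f₁ f₂ (.snoc (.snoc Γ b) a)).symm
    refine Eq.trans ?_ ((Rev.nproj_eq f₁ f₂ i (.fst t) (s.lsubst (.lpair .lvar .zero))).trans
      (Rev.mk_eq (.refl _) (.of_eq (Tm.lsubst_lsubst _ _ _))))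
    refine Eq.trans (congrArg (Rev.mk t s ≫ ·) ((Category.assoc _ _ _).symm.trans
      (congrArg (· ≫ (Rev.ccStr Op LOp).nproj _ i) (h.symm.trans
        (congrArg (· ≫ eqToHom _) (Category.id_comp _)))))) ?_
    refine (congrArg (Rev.mk t s ≫ ·) (Category.assoc _ _ _)).trans ?_
    exact (Category.assoc (Rev.mk t s) ((Rev.ccStr Op LOp).fst ⟨⟨CTy.nprod ((Γ.snoc b).map f₁)⟩,
      LTy.nprod ((Γ.snoc b).map f₂)⟩ ⟨⟨f₁ a⟩, f₂ a⟩) _).symm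

/-- Currying of represented morphisms; it has the shape of the clause for `λ`. -/
theorem Rev.curry_mk {A₁ X₁ B₁ : CTy} {A₂ X₂ B₂ : LTy}
    (a : Tm Op LOp (Ctx.nil.snoc (.prod A₁ X₁)) (.val B₁))
    (b : Tm Op LOp (Ctx.nil.snoc (.prod A₁ X₁)) (.lin B₂ (.prod A₂ X₂))) :
    (Rev.ccStr Op LOp).curry (A := ⟨⟨A₁⟩, A₂⟩) (X := ⟨⟨X₁⟩, X₂⟩) (B := ⟨⟨B₁⟩, B₂⟩) (Rev.mk a b) =
      Rev.mk (.lam (.split (.pair a (.lfun (.lfst b))))) (.cmatch .lvar (.split (.lsnd b))) := rfl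

/-- Application of represented morphisms; it has the shape of the clause for application. -/
theorem Rev.pair_mk_ev {A₁ X₁ B₁ : CTy} {A₂ X₂ B₂ : LTy}
    (a : Tm Op LOp (Ctx.nil.snoc X₁) (.val A₁)) (a' : Tm Op LOp (Ctx.nil.snoc X₁) (.lin A₂ X₂))
    (f : Tm Op LOp (Ctx.nil.snoc X₁) (.val (.fn A₁ (.prod B₁ (.lfun B₂ A₂)))))
    (f' : Tm Op LOp (Ctx.nil.snoc X₁) (.lin (.copow A₁ B₂) X₂)) :
    (Rev.ccStr Op LOp).pair (X := ⟨⟨X₁⟩, X₂⟩) (Y := ⟨⟨A₁⟩, A₂⟩) (Rev.mk a a') (Rev.mk f f') ≫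
        (Rev.ccStr Op LOp).ev ⟨⟨A₁⟩, A₂⟩ ⟨⟨B₁⟩, B₂⟩ =
      Rev.mk (.fst (.app f a)) (.add (f'.lsubst (.cpair a .lvar))
        (a'.lsubst (.lfapp (.snd (.app f a)) .lvar))) := by
  have h := Tm.Eqv.app_congr (Tm.Eqv.snd_beta a f) (Tm.Eqv.fst_beta a f)
  refine Rev.mk_eq (Tm.Eqv.fst_congr h) (Tm.Eqv.trans (.add_comm _ _) (.add_congr ?_ ?_))
  · refine (Tm.Eqv.of_eq (Tm.lsubst_lsubst f' _ _)).trans (.lsubst (.refl _) ?_)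
    exact (Tm.Eqv.lsnd_beta _ _).trans (.cpair_congr (.fst_beta _ _) (.refl _))
  · refine (Tm.Eqv.of_eq (Tm.lsubst_lsubst a' _ _)).trans (.lsubst (.refl _) ?_)
    exact (Tm.Eqv.lfst_beta _ _).trans (.lfapp_congr (.snd_congr h) (.refl _))

/-- The interpretation of the source language in `Σ_CSyn LSynᵒᵖ` by the types of the reverse-mode
code transformation. -/
def revSem (dopT : DerT Op LOp) : Semantics Op (Rev.ccStr Op LOp) where
  obj A := ⟨⟨A.rev₁⟩, A.rev₂⟩
  obj_unit := rfl
  obj_prod _ _ := rfl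
  obj_fn _ _ := rfl
  op ns _ o := eqToHom (Rev.nprod_eq CTy.real LTy.real ns) ≫ revOp dopT o

variable (dopT : DerT Op LOp)

section

variable {X₁ : CTy} {X₂ : LTy}

/-- The environment given by a substitution `τ` for the primals and a linear term `K` from the
tuples of cotangents. -/
def revEnv {Γ : Ctx STy} (τ : Tm.Sub Op LOp (Γ.map STy.rev₁) (Ctx.nil.snoc X₁))
    (K : Tm Op LOp (Ctx.nil.snoc X₁) (.lin (LTy.nprod (Γ.map STy.rev₂)) X₂)) :
    (revSem dopT).Env ⟨⟨X₁⟩, X₂⟩ Γ :=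
  fun _ x => Rev.mk (τ _ (x.map _)) (K.lsubst (.lcoproj _ x .lvar))

/-- The morphism represented by a term of type `A₁ * (A₂ ⊸ Y)`, such as the code transformation
of a term, and a linear term on `Y`. -/
def Rev.ofCode {A₁ : CTy} {Y A₂ : LTy}
    (u : Tm Op LOp (Ctx.nil.snoc X₁) (.val (.prod A₁ (.lfun A₂ Y))))
    (K : Tm Op LOp (Ctx.nil.snoc X₁) (.lin Y X₂)) : (⟨⟨X₁⟩, X₂⟩ : Rev Op LOp) ⟶ ⟨⟨A₁⟩, A₂⟩ :=
  Rev.mk (.fst u) (K.lsubst (.lfapp (.snd u) .lvar))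

/-- A code transformation of the form `⟨a, λv. b⟩` represents the pair of `a` and `K[b/v]`. -/
theorem Rev.ofCode_eq {A₁ : CTy} {Y A₂ : LTy}
    {u : Tm Op LOp (Ctx.nil.snoc X₁) (.val (.prod A₁ (.lfun A₂ Y)))}
    {a : Tm Op LOp (Ctx.nil.snoc X₁) (.val A₁)} {b : Tm Op LOp (Ctx.nil.snoc X₁) (.lin A₂ Y)}
    (h : u.Eqv (.pair a (.lfun b))) (K : Tm Op LOp (Ctx.nil.snoc X₁) (.lin Y X₂)) :
    Rev.ofCode u K = Rev.mk a (K.lsubst b) :=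
  Rev.mk_eq ((Tm.Eqv.fst_congr h).trans (.fst_beta _ _))
    (.lsubst (.refl K) ((Tm.Eqv.lfapp_congr ((Tm.Eqv.snd_congr h).trans (.snd_beta _ _))
      (.refl _)).trans ((Tm.Eqv.lfun_beta _ _).trans (.of_eq (Tm.lsubst_lvar b)))))

/-- For a further variable, the contribution of its cotangent is added to that of the others. -/
theorem revEnv_snoc {Γ : Ctx STy} {A : STy}
    (τ : Tm.Sub Op LOp (Γ.map STy.rev₁) (Ctx.nil.snoc X₁))
    (K : Tm Op LOp (Ctx.nil.snoc X₁) (.lin (LTy.nprod (Γ.map STy.rev₂)) X₂))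
    (a : Tm Op LOp (Ctx.nil.snoc X₁) (.val A.rev₁))
    (b : Tm Op LOp (Ctx.nil.snoc X₁) (.lin A.rev₂ X₂)) :
    (revEnv dopT τ K).snoc (Rev.mk a b) =
      revEnv dopT (Γ := Γ.snoc A) (τ.snoc a) (.add (K.lsubst (.ctxFst STy.rev₂ Γ (a := A) .lvar))
        (b.lsubst (.ctxSnd STy.rev₂ Γ .lvar))) := by
  have key : ∀ {B : STy} (x : Var (Γ.snoc A) B),
      ((Tm.add (K.lsubst (.ctxFst STy.rev₂ Γ (a := A) .lvar))
        (b.lsubst (.ctxSnd STy.rev₂ Γ .lvar))).lsubst (.lcoproj STy.rev₂ x .lvar)).Eqv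
      (.add (K.lsubst (.ctxFst STy.rev₂ Γ (.lcoproj STy.rev₂ x .lvar)))
        (b.lsubst (.ctxSnd STy.rev₂ Γ (.lcoproj STy.rev₂ x .lvar)))) := fun x =>
    .of_eq (congrArg₂ Tm.add
      ((Tm.lsubst_lsubst _ _ _).trans (congrArg (Tm.lsubst K) (Tm.ctxFst_lsubst STy.rev₂ Γ _ _)))
      ((Tm.lsubst_lsubst _ _ _).trans (congrArg (Tm.lsubst b) (Tm.ctxSnd_lsubst STy.rev₂ Γ _ _))))
  funext B x
  cases x with
  | zero =>
    refine Rev.mk_eq (.refl _) (Tm.Eqv.symm ((key .zero).trans ?_))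
    refine (Tm.Eqv.add_congr
      ((Tm.Eqv.lsubst (.refl K) (Tm.ctxFst_lcoproj_zero STy.rev₂ Γ .lvar)).trans (.lsubst_zero K))
      ((Tm.Eqv.lsubst (.refl b) (Tm.ctxSnd_lcoproj_zero STy.rev₂ Γ .lvar)).trans
        (.of_eq (Tm.lsubst_lvar b)))).trans (.zero_add b)
  | succ x =>
    refine Rev.mk_eq (.refl _) (Tm.Eqv.symm ((key (.succ x)).trans ?_))
    refine (Tm.Eqv.add_congr
      (Tm.Eqv.lsubst (.refl K) (Tm.ctxFst_lcoproj_succ STy.rev₂ x .lvar))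
      ((Tm.Eqv.lsubst (.refl b) (Tm.ctxSnd_lcoproj_succ STy.rev₂ x .lvar)).trans
        (.lsubst_zero b))).trans (.add_zero _)

/-- Under a binder, the cotangents of the bound variable and of the others contribute to the two
components of the cotangents of the extended stage. -/
theorem revEnv_lift {Γ : Ctx STy} (A : STy)
    (τ : Tm.Sub Op LOp (Γ.map STy.rev₁) (Ctx.nil.snoc X₁))
    (K : Tm Op LOp (Ctx.nil.snoc X₁) (.lin (LTy.nprod (Γ.map STy.rev₂)) X₂)) :
    (revEnv dopT τ K).lift A =
      revEnv dopT (Γ := Γ.snoc A) (X₁ := .prod A.rev₁ X₁) (X₂ := .prod A.rev₂ X₂)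
        (τ.liftProd A.rev₁)
        (.add (.lpair .zero ((K.plug (.snd (.var .zero))).lsubst
            (.ctxFst STy.rev₂ Γ (a := A) .lvar)))
          (.lpair (.ctxSnd STy.rev₂ Γ .lvar) .zero)) := by
  refine Eq.trans ?_ (revEnv_snoc dopT _ (.lpair .zero (K.plug (.snd (.var .zero)))) _
    (.lpair .lvar .zero))
  refine congrArg (fun ρ => Semantics.Env.snoc ρ _) ?_
  funext B x
  refine Rev.mk_eq (.refl _) (.lpair_congr (.refl _) (Tm.Eqv.of_eq ?_))
  exact (Tm.lsubst_subst _ _ _).trans (congrArg (Tm.lsubst _) (Tm.lcoproj_subst _ x .lvar _))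

end

/-- The reverse-mode code transformation computes the interpretation in `Σ_CSyn LSynᵒᵖ`. -/
theorem interp_revEnv {Γ : Ctx STy} {A : STy} (t : STm Op Γ A) {X₁ : CTy} {X₂ : LTy}
    (τ : Tm.Sub Op LOp (Γ.map STy.rev₁) (Ctx.nil.snoc X₁))
    (K : Tm Op LOp (Ctx.nil.snoc X₁) (.lin (LTy.nprod (Γ.map STy.rev₂)) X₂)) :
    (revSem dopT).interp (revEnv dopT τ K) t = Rev.ofCode ((t.rev dopT).subst τ) K := by
  induction t generalizing X₁ X₂ with
  | @var Γ A x =>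
    refine Eq.trans ?_ (Rev.ofCode_eq (.refl _) K).symm
    have h : (Tm.lcoproj STy.rev₂ x .lvar).subst τ = Tm.lcoproj STy.rev₂ x .lvar :=
      Tm.lcoproj_subst STy.rev₂ x .lvar τ
    exact Rev.mk_eq (.refl _) (.of_eq (congrArg (Tm.lsubst K) h.symm))
  | @letin Γ A B t s iht ihs =>
    rw [Semantics.interp, iht, Rev.ofCode, revEnv_snoc]
    refine (ihs _ _).trans (Eq.trans ?_ (Rev.ofCode_eq ((Tm.plet_subst_eqv _ _ _).trans
      (Tm.plet_subst_eqv _ _ _)) K).symm)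
    have hs := Tm.wkLet_subst (s.rev dopT) τ ((t.rev dopT).subst τ)
    refine Rev.mk_eq (.of_eq (congrArg Tm.fst hs.symm)) (Tm.Eqv.symm ?_)
    refine (Tm.Eqv.lsubst (.refl K) (.llet_beta _ _)).trans
      ((Tm.Eqv.of_eq (Tm.lsubst_lsubst K _ _).symm).trans (.lsubst ?_
        (.of_eq (congrArg (fun u => Tm.lfapp (.snd u) .lvar) hs))))
    refine (Tm.Eqv.lsubst_add K _ _).trans (.of_eq (congrArg₂ Tm.add ?_ ?_))
    · exact congrArg (Tm.lsubst K) (Tm.ctxFst_subst STy.rev₂ Γ (a := A) .lvar _)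
    · refine Eq.trans ?_ (Tm.lsubst_lsubst K _ _).symm
      exact congrArg (fun r => K.lsubst (.lfapp _ r))
        (Tm.ctxSnd_subst STy.rev₂ Γ (a := A) .lvar _)
  | @op Γ ns m o ts ih =>
    -- the transforms of the arguments, to which the code binds the pairs of `xᵢ` and its derivative
    let u n (i : Var ns n) := ((ts n i).rev dopT).subst τ
    have hu : (fun n i => (revSem dopT).interp (revEnv dopT τ K) (ts n i)) =
        fun n i => Rev.mk (.fst (u n i)) (K.lsubst (.lfapp (.snd (u n i)) .lvar)) :=
      funext fun n => funext fun i => ih n i τ K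
    rw [Semantics.interp, hu]
    refine Eq.trans ?_ (Rev.ofCode_eq (Tm.lets_subst_eqv _ _ _ _ _) K).symm
    refine (Category.assoc _ _ _).symm.trans ((congrArg (· ≫ revOp dopT o)
      (Rev.tuple_eq CTy.real LTy.real ns _ _)).trans ?_)
    refine Rev.mk_eq ((Tm.subst_proj_plug _ _).trans (.of_eq ?_))
      ((Tm.Eqv.lsubst (.refl _) (Tm.subst_proj_plug _ _)).trans ?_)
    · refine congrArg (Tm.op o) (funext fun n => funext fun i => ?_)
      exact (Tm.Sub.ofMap_map _ _ i).trans (Tm.letsSub_var _ _ _ i).symm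
    · refine Tm.Eqv.symm ((Tm.Eqv.lsubst (.refl K) (.llet_beta _ _)).trans ?_)
      refine (Tm.Eqv.of_eq (Tm.lsubst_lsubst K _ _).symm).trans (.lsubst ?_ (.of_eq ?_))
      · refine (Tm.Eqv.lsubst (.refl K) (.of_eq (Tm.lsum_subst ns _ _))).trans
          ((Tm.lsubst_lsum ns _ K).trans (.of_eq ?_))
        refine congrArg (Tm.lsum ns) (funext fun n => funext fun i => ?_)
        refine Eq.trans ?_ (Tm.lsubst_lsubst K _ _).symm
        refine congrArg (Tm.lsubst K) (congrArg₂ Tm.lfapp (Tm.letsSub_var' _ _ _ i) ?_)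
        exact Tm.lproj_subst LTy.real i .lvar _
      · exact (Tm.subst_rename _ _ _).trans (congrArg (Tm.subst · _)
          (Tm.letsSub_comp_ofMap _ _ _))
  | unit =>
    refine Eq.trans ?_ (Rev.ofCode_eq (.refl _) K).symm
    exact (Category.comp_id _).trans (Rev.mk_eq (.refl _) (Tm.Eqv.lsubst_zero K).symm)
  | pair t s iht ihs =>
    rw [Semantics.interp, iht, ihs]
    refine Eq.trans ?_ (Rev.ofCode_eq ((Tm.plet_subst_eqv _ _ _).trans
      (Tm.plet_subst_eqv _ _ _)) K).symm
    rw [Tm.wk₃_subst]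
    refine (Category.comp_id _).trans (Rev.mk_eq (.refl _) (Tm.Eqv.symm
      ((Tm.Eqv.lsubst_add K _ _).trans (.of_eq ?_))))
    exact Eq.symm (congrArg₂ Tm.add (Tm.lsubst_lsubst K _ _) (Tm.lsubst_lsubst K _ _))
  | fst t ih =>
    rw [Semantics.interp, ih]
    refine Eq.trans ?_ (Rev.ofCode_eq (Tm.plet_subst_eqv _ _ _) K).symm
    refine (congrArg (_ ≫ ·) (Category.id_comp _)).trans ?_
    exact Rev.mk_eq (.refl _) (.of_eq (Tm.lsubst_lsubst K _ _))
  | snd t ih =>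
    rw [Semantics.interp, ih]
    refine Eq.trans ?_ (Rev.ofCode_eq (Tm.plet_subst_eqv _ _ _) K).symm
    refine (congrArg (_ ≫ ·) (Category.id_comp _)).trans ?_
    exact Rev.mk_eq (.refl _) (.of_eq (Tm.lsubst_lsubst K _ _))
  | @lam Γ A B t ih =>
    rw [Semantics.interp, revEnv_lift]
    refine Eq.trans ?_ (Rev.ofCode_eq (Tm.letin_subst_eqv _ _ _) K).symm
    refine (Category.comp_id _).trans ((congrArg (Rev.ccStr Op LOp).curry (ih _ _)).trans ?_)
    refine (Rev.curry_mk _ _).trans ?_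
    -- `hU` replaces the product variable, which encodes the environment under the binder, by two
    -- variables; by `hW`, the result is the application `y x` that occurs in the code
    let U := (t.rev dopT).subst (τ.liftProd A.rev₁)
    have hU : (Tm.split U).Eqv _ := Tm.subst_split (t.rev dopT) τ
    have hW := Tm.app_lam_wk ((t.rev dopT).subst (τ.lift A.rev₁))
    have hZ := Tm.Eqv.lfapp_congr (.snd_congr (hU.trans hW.symm)) (.refl .lvar)
    refine Rev.mk_eq (.lam_congr ?_) ?_
    · -- the cotangent of the bound variable
      refine Tm.Eqv.trans ?_ (Tm.plet_subst_eqv _ _ _).symm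
      refine .pair_congr (.fst_congr (hU.trans hW.symm)) (.lfun_congr ?_)
      refine (Tm.split_lfst STy.rev₂ Γ (a := A) K (.lfapp (.snd U) .lvar)).trans ?_
      refine Tm.Eqv.trans (Tm.Eqv.ctxSnd STy.rev₂ Γ hZ) (.of_eq ?_)
      exact Eq.symm (Eq.trans
        (Tm.ctxSnd_subst STy.rev₂ Γ (a := A) (.lfapp (.var .v₀) .lvar) _) rfl)
    · -- the cotangents of the variables of `Γ`
      refine Tm.Eqv.symm ((Tm.lsubst_cmatch K _).trans (.cmatch_congr (.refl _) (Tm.Eqv.symm ?_)))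
      refine (Tm.split_lsnd STy.rev₂ Γ (a := A) K (.lfapp (.snd U) .lvar)).trans
        (.lsubst (.refl _) ?_)
      refine (Tm.Eqv.ctxFst STy.rev₂ Γ hZ).trans (.of_eq ?_)
      exact Eq.symm (Eq.trans (Tm.ctxFst_subst STy.rev₂ Γ (a := A)
        (.lfapp (.snd (.app (.var .v₁) (.var .v₀))) .lvar) _) rfl)
  | app t s iht ihs =>
    rw [Semantics.interp, iht, ihs]
    refine Eq.trans ?_ (Rev.ofCode_eq ((Tm.plet_subst_eqv _ _ _).trans
      ((Tm.plet_subst_eqv _ _ _).trans (Tm.plet_subst_eqv _ _ _))) K).symm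
    rw [Tm.wk₃_subst]
    refine Eq.trans (congrArg (fun f => (Rev.ccStr Op LOp).pair _ f ≫ _) (Category.comp_id _))
      ((Rev.pair_mk_ev _ _ _ _).trans ?_)
    refine Rev.mk_eq (.refl _) (Tm.Eqv.symm ((Tm.Eqv.lsubst_add K _ _).trans (.of_eq ?_)))
    exact Eq.symm (congrArg₂ Tm.add (Tm.lsubst_lsubst K _ _) (Tm.lsubst_lsubst K _ _))

/-- The reverse-mode functors are the Cartesian closed extensions of the base types and operations
of `revSem`; `op` is only transported along `Rev.nprod_eq`. -/
theorem isRev_iff (F : Syn Op ⥤ Rev Op LOp) :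
    IsRev dopT F ↔ Extends (fun n => (revSem dopT).obj (.real n)) (revSem dopT).op F :=
  ⟨fun h => ⟨h.cartesianClosed, h.real, fun ns m o => (sendsTo_eqToHom_comp _).2 (h.op ns m o)⟩,
    fun h => ⟨h.cartesianClosed, h.real, fun ns m o => (sendsTo_eqToHom_comp _).1 (h.op ns m o)⟩⟩

theorem existsUnique_isRev : ∃! F : Syn Op ⥤ Rev Op LOp, IsRev dopT F := by
  simp only [isRev_iff]
  exact Semantics.existsUnique_extends (Rev.ccStr Op LOp) _ _

theorem IsRev.eq_functor {F : Syn Op ⥤ Rev Op LOp} (hF : IsRev dopT F) :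
    F = (revSem dopT).functor :=
  (existsUnique_isRev dopT).unique hF ((isRev_iff dopT _).2 (revSem dopT).extends_functor)

/-- The morphism represented by the code transformation of `t` is the interpretation of `t`. -/
theorem sendsTo_revHom {Γ : Ctx STy} {A : STy} (t : STm Op Γ A) :
    SendsTo (revSem dopT).functor t.hom (t.revHom dopT) := by
  have hX : (revSem dopT).obj (STy.nprod Γ) = ⟨⟨CTy.nprod (Γ.map STy.rev₁)⟩,
      LTy.nprod (Γ.map STy.rev₂)⟩ :=
    ((revSem dopT).obj_nprod Γ).trans (Rev.nprod_eq STy.rev₁ STy.rev₂ Γ)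
  refine sendsTo_of_eqToHom_comp hX ?_
  refine (congrArg (eqToHom hX.symm ≫ ·) ((revSem dopT).interp_subst t _ _)).trans ?_
  refine ((revSem dopT).comp_interp _ _ _).trans ?_
  have hρ : Semantics.Env.comp (eqToHom hX.symm) (fun A (i : Var Γ A) => (revSem dopT).interp
      (Semantics.Env.one (𝟙 _)) (.proj i (.var .zero))) =
      revEnv dopT (X₁ := CTy.nprod (Γ.map STy.rev₁)) (X₂ := LTy.nprod (Γ.map STy.rev₂))
        (fun _ i => .proj i (.var .zero)) .lvar := by
    funext A i
    refine Eq.trans ?_ (Rev.nproj_eq STy.rev₁ STy.rev₂ i (.var .zero) .lvar)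
    refine Eq.trans ?_ (Category.id_comp _).symm
    refine (congrArg (eqToHom hX.symm ≫ ·) (((revSem dopT).interp_proj _ _ _).trans
      (Category.id_comp _))).trans ?_
    refine (Category.assoc _ _ _).symm.trans (congrArg (· ≫ _) ?_)
    exact eqToHom_trans _ _
  refine (congrArg (fun ρ => (revSem dopT).interp ρ t) hρ).trans ?_
  exact interp_revEnv dopT t _ _

/-- The reverse-mode code transformation respects equivalence, since the interpretation of a term
determines its code transformation up to equivalence. -/
theorem STm.Eqv.rev {Γ : Ctx STy} {A : STy} {t s : STm Op Γ A} (h : t.Eqv s) :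
    (t.rev dopT).Eqv (s.rev dopT) := by
  have hom : t.hom = s.hom := STm.Cls.sound (h.subst _)
  have key : t.revHom dopT = s.revHom dopT :=
    (sendsTo_revHom dopT t).unique (hom ▸ sendsTo_revHom dopT s)
  have h₁ : (Tm.fst (t.rev dopT)).Eqv (.fst (s.rev dopT)) :=
    .of_cls_eq (congrArg SigOp.Hom.fst key)
  have h₂ : (Tm.lfapp (.snd (t.rev dopT)) .lvar).Eqv (.lfapp (.snd (s.rev dopT)) .lvar) :=
    .of_cls_eq (congrArg SigOp.Hom.snd key)
  exact Tm.Eqv.of_fst_of_lfapp_snd h₁ h₂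

end CHAD

theorem mainTheorem4 {Op : Ctx ℕ → ℕ → Type u}
    {LOp : Ctx ℕ → Ctx ℕ → Ctx ℕ → Type v} :
    (∀ (R : ℕ → Fwd Op LOp) (d : ∀ (ns : Ctx ℕ) (m : ℕ), Op ns m →
        (nprod (𝟙_ (Fwd Op LOp)) (· ⊗ ·) (ns.map R) ⟶ R m)),
      ∃! F : Syn Op ⥤ Fwd Op LOp, Extends R d F) ∧
    (∀ (R : ℕ → Rev Op LOp) (d : ∀ (ns : Ctx ℕ) (m : ℕ), Op ns m →
        (nprod (𝟙_ (Rev Op LOp)) (· ⊗ ·) (ns.map R) ⟶ R m)),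
      ∃! F : Syn Op ⥤ Rev Op LOp, Extends R d F) ∧
    (∀ dop : Der Op LOp,
      (∃! F : Syn Op ⥤ Fwd Op LOp, IsFwd dop F) ∧
      (∀ F : Syn Op ⥤ Fwd Op LOp, IsFwd dop F →
        (∀ A : STy, F.obj ⟨A⟩ = ⟨⟨A.fwd₁⟩, A.fwd₂⟩) ∧
        (∀ (Γ : Ctx STy) (A : STy) (t : STm Op Γ A),
          SendsTo F t.hom (t.fwdHom dop))) ∧
      (∀ (Γ : Ctx STy) (A : STy) (t s : STm Op Γ A),
        t.Eqv s → (t.fwd dop).Eqv (s.fwd dop))) ∧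
    (∀ dopT : DerT Op LOp,
      (∃! F : Syn Op ⥤ Rev Op LOp, IsRev dopT F) ∧
      (∀ F : Syn Op ⥤ Rev Op LOp, IsRev dopT F →
        (∀ A : STy, F.obj ⟨A⟩ = ⟨⟨A.rev₁⟩, A.rev₂⟩) ∧
        (∀ (Γ : Ctx STy) (A : STy) (t : STm Op Γ A),
          SendsTo F t.hom (t.revHom dopT))) ∧
      (∀ (Γ : Ctx STy) (A : STy) (t s : STm Op Γ A),
        t.Eqv s → (t.rev dopT).Eqv (s.rev dopT))) :=
  ⟨Semantics.existsUnique_extends (Fwd.ccStr Op LOp),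
    Semantics.existsUnique_extends (Rev.ccStr Op LOp),
    fun dop => ⟨existsUnique_isFwd dop, fun F hF => by
      rw [hF.eq_functor]
      exact ⟨fun _ => rfl, fun _ _ t => sendsTo_fwdHom dop t⟩, fun _ _ _ _ h => h.fwd dop⟩,
    fun dopT => ⟨existsUnique_isRev dopT, fun F hF => by
      rw [hF.eq_functor]
      exact ⟨fun _ => rfl, fun _ _ t => sendsTo_revHom dopT t⟩, fun _ _ _ _ h => h.rev dopT⟩⟩
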